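/- Let $X$ be a proper, geodesically complete $CAT(-1)$ space, let $T^1X$ be its unit tangent bundle (the space of germs at time $0$ of bi-infinite unit speed geodesics) with projection $\pi : T^1X \to X$, and let $\Gamma$ be a countable group acting on $X$ by isometries, nonelementary in the sense that it contains two loxodromic elements without a common fixed point in $\partial X$. Let $F : T^1X \to \mathbb{R}$ be a $\Gamma$-invariant function, measurable along geodesics (for instance continuous), and put $d_F(x,y) := \int_x^y F\,dt$, the integral being taken along the geodesic from $x$ to $y$. Assume that $F$ has the Hölder-control property: (a) there are $c_1 > 0$ and $c_2 \in (0,1)$ such that for all $x,y,x',y' \in X$ with $d(x,x') \le 1$ and $d(y,y') \le 1$, $$|d_F(x',y') - d_F(x,y)| \le \Big(c_1 + \sup_{\pi^{-1}(B(x,d(x,x')))}|F|\Big) d(x,x')^{c_2} + \Big(c_1 + \sup_{\pi^{-1}(B(y,d(y,y')))}|F|\Big) d(y,y')^{c_2},$$ where $B(x,r)$ is the closed ball; (b) for every $a > 1$ there is $b > 0$ such that $|F(v) - F(w)| \le b\, a^{d(\pi(v),\pi(w))}$ for all $v, w \in T^1X$. Let $o \in X$ and assume that the topological pressure $$v_F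 := \limsup_{n\to\infty} \frac1n \log \sum_{g \in \Gamma,\; n-1 \le d(o,go) \le n} e^{d_F(o,go)}$$ satisfies $v_F < \infty$. Let $\mu$ be a probability measure on $\Gamma$ whose support generates $\Gamma$ as a semigroup and which has a finite exponential moment, that is, $\sum_{g\in\Gamma} c^{\,d(o,go)}\mu(g) < \infty$ for some $c > 1$. Let $\omega_n = g_1 g_2\cdots g_n$ be the random walk with independent increments $g_i$ of law $\mu$, so that $\omega_n$ has law $\mu^n$, the $n$-th convolution power of $\mu$. Then $v_F$ is a real number; the entropy $$h_\mu := \lim_{n\to\infty} \frac1n \sum_{g\in\Gamma} -\mu^n(g)\log\mu^n(g)$$ exists and is finite (each sum being convergent); the limits $$\ell_\mu := \lim_{n\to\infty} \frac{d(o,\omega_n o)}{n}, \qquad \ell_{F,\mu} := \lim_{n\to\infty} \frac{d_F(o,\omega_n o)}{n}$$ exist almost surely, and are finite and almost surely constant; and $$h_\mu \le \ell_\mu\, v_F - \ell_{F,\mu}.$$ -/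

import Mathlib

open Filter Topology MeasureTheory Set
open scoped ENNReal UpperHalfPlane

namespace GibbsWalk

/-! ### CAT(-1) spaces -/

/-- `X` is a CAT(-1) space: it is a geodesic space, and every geodesic triangle is at least as thin
as its comparison triangle in the hyperbolic plane of curvature `-1` (Mathlib's metric on `ℍ`).
In a geodesic space the points `p` of the geodesic segments from `x` to `y` are exactly those with
`dist x p + dist p y = dist x y`; two sides of a triangle always have a common vertex `x`. -/
structure IsCATNegOne (X : Type*) [MetricSpace X] : Prop where
  geodesic : ∀ x y : X, ∃ γ : ℝ → X, γ 0 = x ∧ γ (dist x y) = y ∧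
    ∀ s ∈ Icc 0 (dist x y), ∀ t ∈ Icc 0 (dist x y), dist (γ s) (γ t) = |s - t|
  comparison : ∀ (x y z p q : X) (x' y' z' p' q' : ℍ),
    dist x' y' = dist x y → dist y' z' = dist y z → dist x' z' = dist x z →
    dist x p + dist p y = dist x y → dist x q + dist q z = dist x z →
    dist x' p' = dist x p → dist p' y' = dist p y →
    dist x' q' = dist x q → dist q' z' = dist q z →
    dist p q ≤ dist p' q'

/-- Unit speed bi-infinite geodesics. -/
def GeodesicLine (X : Type*) [MetricSpace X] : Type _ := {ℓ : ℝ → X // Isometry ℓ}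

/-- Geodesic completeness of a uniquely geodesic space: every nondegenerate geodesic segment
is contained in a bi-infinite geodesic. -/
def IsGeodesicallyComplete (X : Type*) [MetricSpace X] : Prop :=
  ∀ x y : X, x ≠ y → ∃ ℓ : GeodesicLine X, ℓ.1 0 = x ∧ ℓ.1 (dist x y) = y

/-! ### The unit tangent bundle -/

section UnitTangent

variable {X : Type*} [MetricSpace X]

/-- The geodesic flow: `ℓ.flow t` is the line `s ↦ ℓ (t + s)`. -/
def GeodesicLine.flow (ℓ : GeodesicLine X) (t : ℝ) : GeodesicLine X :=
  ⟨fun s => ℓ.1 (t + s), ℓ.2.comp (Isometry.of_dist_eq fun a b => by simp)⟩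

/-- The image of a geodesic line under an isometry of an acting group. -/
def GeodesicLine.translate {Γ : Type*} [Group Γ] [MulAction Γ X] [IsIsometricSMul Γ X]
    (g : Γ) (ℓ : GeodesicLine X) : GeodesicLine X :=
  ⟨fun s => g • ℓ.1 s, (isometry_smul X g).comp ℓ.2⟩

/-- Two geodesic lines have the same germ at time `0`. -/
def germSetoid (X : Type*) [MetricSpace X] : Setoid (GeodesicLine X) where
  r ℓ ℓ' := ℓ.1 =ᶠ[𝓝 0] ℓ'.1
  iseqv := ⟨fun _ => EventuallyEq.rfl, fun h => h.symm, fun h h' => h.trans h'⟩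

/-- The unit tangent bundle `T¹X`: germs at time `0` of geodesic lines. When geodesics do not
branch (as in a manifold) a germ determines the whole line. -/
def UnitTangent (X : Type*) [MetricSpace X] : Type _ := Quotient (germSetoid X)

/-- The unit tangent vector of a geodesic line at time `0`. -/
def GeodesicLine.germ (ℓ : GeodesicLine X) : UnitTangent X := Quotient.mk (germSetoid X) ℓ

/-- The projection `π : T¹X → X`. -/
def UnitTangent.base : UnitTangent X → X :=
  Quotient.lift (fun ℓ : GeodesicLine X => ℓ.1 0) fun _ _ h => EventuallyEq.eq_of_nhds h

open Classical in
/-- `d_F(x, y) = ∫_x^y F dt`, the integral of `F` over the unit tangent vectors of the geodesic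
from `x` to `y`, computed on a geodesic line that extends it (`0` if `x = y`). In a CAT(-1) space
the line does not matter, see `fakeDist_eq`. -/
noncomputable def fakeDist (F : UnitTangent X → ℝ) (x y : X) : ℝ :=
  if h : ∃ ℓ : GeodesicLine X, ℓ.1 0 = x ∧ ℓ.1 (dist x y) = y then
    ∫ t in (0 : ℝ)..dist x y, F (h.choose.flow t).germ
  else 0

theorem IsCATNegOne.eq_of_dist_eq (hX : IsCATNegOne X) {x y p q : X}
    (hp : dist x p + dist p y = dist x y) (hq : dist x q + dist q y = dist x y)
    (hpq : dist x p = dist x q) : p = q := by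
  have hiso := UpperHalfPlane.isometry_vertical_line 0
  let v : ℝ → ℍ := fun t => UpperHalfPlane.mk ⟨0, Real.exp t⟩ (Real.exp_pos t)
  have hv : ∀ s t, dist (v s) (v t) = |s - t| := fun s t => hiso.dist_eq s t
  have h0 : 0 ≤ dist x p := dist_nonneg
  have h1 : 0 ≤ dist p y := dist_nonneg
  have key := hX.comparison x y y p q (v 0) (v (dist x y)) (v (dist x y)) (v (dist x p))
    (v (dist x p)) (by simp [hv]) (by simp) (by simp [hv]) hp hq (by simp [hv])
    (by rw [hv, abs_sub_comm, abs_of_nonneg] <;> linarith) (by simp [hv, hpq])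
    (by rw [hv, abs_sub_comm, abs_of_nonneg] <;> linarith)
  rw [dist_self] at key
  exact dist_le_zero.1 key

/-- `fakeDist` can be computed on any geodesic line through the two points. -/
theorem fakeDist_eq (hX : IsCATNegOne X) (F : UnitTangent X → ℝ) (ℓ : GeodesicLine X)
    {a b : ℝ} (hab : a ≤ b) :
    fakeDist F (ℓ.1 a) (ℓ.1 b) = ∫ t in a..b, F (ℓ.flow t).germ := by
  have hd : dist (ℓ.1 a) (ℓ.1 b) = b - a := by
    rw [ℓ.2.dist_eq, Real.dist_eq, abs_sub_comm, abs_of_nonneg (by linarith)]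
  have h : ∃ ℓ' : GeodesicLine X, ℓ'.1 0 = ℓ.1 a ∧ ℓ'.1 (dist (ℓ.1 a) (ℓ.1 b)) = ℓ.1 b :=
    ⟨ℓ.flow a, by simp [GeodesicLine.flow], by simp [GeodesicLine.flow, hd]⟩
  rw [fakeDist, dif_pos h]
  obtain ⟨e0, e1⟩ := h.choose_spec
  set m := h.choose
  rw [hd] at e1 ⊢
  have hm : ∀ t ∈ Icc 0 (b - a), m.1 t = ℓ.1 (a + t) := by
    intro t ht
    have d1 : dist (ℓ.1 a) (m.1 t) = t := by
      rw [← e0, m.2.dist_eq, Real.dist_eq, zero_sub, abs_neg, abs_of_nonneg ht.1]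
    have d2 : dist (m.1 t) (ℓ.1 b) = b - a - t := by
      rw [← e1, m.2.dist_eq, Real.dist_eq, abs_sub_comm, abs_of_nonneg (by linarith [ht.2])]
    have d3 : dist (ℓ.1 a) (ℓ.1 (a + t)) = t := by
      rw [ℓ.2.dist_eq, Real.dist_eq, sub_add_cancel_left, abs_neg, abs_of_nonneg ht.1]
    have d4 : dist (ℓ.1 (a + t)) (ℓ.1 b) = b - a - t := by
      rw [ℓ.2.dist_eq, Real.dist_eq, abs_sub_comm, abs_of_nonneg (by linarith [ht.2])]
      ring
    exact hX.eq_of_dist_eq (by linarith) (by linarith) (by linarith)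
  have hcongr : ∫ t in (0 : ℝ)..(b - a), F (m.flow t).germ =
      ∫ t in (0 : ℝ)..(b - a), F (ℓ.flow (a + t)).germ := by
    refine intervalIntegral.integral_congr_ae ?_
    have hne : ∀ᵐ t : ℝ, t ≠ b - a := by simp [ae_iff]
    filter_upwards [hne] with t htne ht
    rw [uIoc_of_le (by linarith)] at ht
    have ht2 : t < b - a := lt_of_le_of_ne ht.2 htne
    congr 1
    refine Quotient.sound (s := germSetoid X) ?_
    have hnb : ∀ᶠ s : ℝ in 𝓝 0, t + s ∈ Ioo 0 (b - a) := by
      have : Tendsto (fun s : ℝ => t + s) (𝓝 0) (𝓝 t) := by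
        have := (continuous_const_add t).tendsto (0 : ℝ)
        simpa using this
      exact this.eventually (Ioo_mem_nhds ht.1 ht2)
    filter_upwards [hnb] with s hs
    change m.1 (t + s) = ℓ.1 (a + t + s)
    rw [hm _ ⟨hs.1.le, hs.2.le⟩, add_assoc]
  rw [hcongr, intervalIntegral.integral_comp_add_left (fun t => F (ℓ.flow t).germ) a]
  simp

/-! ### Potentials -/

/-- `max |F|` over the unit tangent vectors based in the closed ball `B(x, r)`. -/
noncomputable def maxAbsOver (F : UnitTangent X → ℝ) (x : X) (r : ℝ) : ℝ :=
  ⨆ v : {v : UnitTangent X // dist v.base x ≤ r}, |F v|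

/-- A `Γ`-invariant function on `T¹X` that can be integrated along geodesics. (Measurability along
the orbits of the geodesic flow is weaker than continuity.) -/
structure IsPotential (Γ : Type*) [Group Γ] [MulAction Γ X] [IsIsometricSMul Γ X]
    (F : UnitTangent X → ℝ) : Prop where
  invariant : ∀ (g : Γ) (ℓ : GeodesicLine X), F (ℓ.translate g).germ = F ℓ.germ
  measurable_along : ∀ ℓ : GeodesicLine X, Measurable fun t : ℝ => F (ℓ.flow t).germ

/-- The Hölder-control property (HC). -/
structure HolderControl (F : UnitTangent X → ℝ) : Prop where
  control : ∃ c₁ : ℝ, 0 < c₁ ∧ ∃ c₂ ∈ Ioo (0 : ℝ) 1, ∀ x y x' y' : X,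
    dist x x' ≤ 1 → dist y y' ≤ 1 →
      |fakeDist F x' y' - fakeDist F x y| ≤
        (c₁ + maxAbsOver F x (dist x x')) * dist x x' ^ c₂ +
        (c₁ + maxAbsOver F y (dist y y')) * dist y y' ^ c₂
  subexponential : ∀ a : ℝ, 1 < a → ∃ b : ℝ, 0 < b ∧ ∀ v w : UnitTangent X,
    |F v - F w| ≤ b * a ^ dist v.base w.base

end UnitTangent

/-! ### The group -/

section Group

variable (Γ : Type*) [Group Γ] {X : Type*} [MetricSpace X] [MulAction Γ X]

/-- `g` is loxodromic: it has positive stable translation length. -/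
def IsLoxodromic (X : Type*) [MetricSpace X] [MulAction Γ X] (g : Γ) : Prop :=
  ∃ c : ℝ, 0 < c ∧ ∀ (x : X) (n : ℕ), c * n ≤ dist x (g ^ n • x)

variable {Γ} in
/-- `g` fixes the point at infinity of the geodesic ray `r`, that is, `g ∘ r` and `r` are
asymptotic. -/
def FixesEnd (g : Γ) (r : ℝ → X) : Prop :=
  ∃ C : ℝ, ∀ t : ℝ, 0 ≤ t → dist (g • r t) (r t) ≤ C

/-- The action is nonelementary: there are two independent loxodromic elements, that is, two
loxodromic elements without a common fixed point in the boundary at infinity (the set of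
asymptoty classes of geodesic rays). -/
def IsNonelementary (X : Type*) [MetricSpace X] [MulAction Γ X] : Prop :=
  ∃ g h : Γ, IsLoxodromic Γ X g ∧ IsLoxodromic Γ X h ∧
    ∀ r : ℝ → X, (∀ s t : ℝ, 0 ≤ s → 0 ≤ t → dist (r s) (r t) = |s - t|) →
      ¬ (FixesEnd g r ∧ FixesEnd h r)

/-- The topological pressure
`v_F = limsup_n (1/n) log ∑_{n - 1 ≤ d(o, g o) ≤ n} exp (d_F(o, g o))`, an extended real number. -/
noncomputable def pressure (F : UnitTangent X → ℝ) (o : X) : EReal :=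
  limsup (fun n : ℕ =>
    ENNReal.log (∑' g : {g : Γ // (n : ℝ) - 1 ≤ dist o (g • o) ∧ dist o (g • o) ≤ n},
      ENNReal.ofReal (Real.exp (fakeDist F o ((g : Γ) • o)))) / (n : EReal)) atTop

end Group

/-! ### The random walk -/

section Walk

variable {Γ : Type*} [Group Γ]

/-- The `n`-th convolution power `μⁿ`. -/
noncomputable def convPow (μ : PMF Γ) : ℕ → PMF Γ
  | 0 => PMF.pure 1
  | n + 1 => (convPow μ n).bind fun g => μ.map fun x => g * x

/-- The position `ω_n = x_0 x_1 ⋯ x_{n-1}` at time `n` of the walk with increments `x`. -/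
def walk (x : ℕ → Γ) : ℕ → Γ
  | 0 => 1
  | n + 1 => walk x n * x n

/-- The law of the increments: the product measure `μ^ℕ`. -/
noncomputable def pathMeasure [MeasurableSpace Γ] (μ : PMF Γ) : Measure (ℕ → Γ) :=
  Measure.infinitePi fun _ : ℕ => μ.toMeasure

/-- The support of `μ` generates `Γ` as a semigroup. -/
def IsGenerating (μ : PMF Γ) : Prop := Subsemigroup.closure μ.support = ⊤

/-- `μ` has a finite exponential moment: `∑_g c ^ d(o, g o) μ(g) < ∞` for some `c > 1`. -/
def HasExponentialMoment {X : Type*} [MetricSpace X] [MulAction Γ X] (μ : PMF Γ) (o : X) : Prop :=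
  ∃ c : ℝ, 1 < c ∧ Summable fun g : Γ => c ^ dist o (g • o) * (μ g).toReal

/-- `h` is the entropy `h_μ = lim_n (1/n) ∑_g - μⁿ(g) log μⁿ(g)`, with convergent sums. -/
def IsEntropy (μ : PMF Γ) (h : ℝ) : Prop :=
  (∀ n : ℕ, Summable fun g : Γ => Real.negMulLog (convPow μ n g).toReal) ∧
  Tendsto (fun n : ℕ => (∑' g : Γ, Real.negMulLog (convPow μ n g).toReal) / n) atTop (𝓝 h)

/-- `l` is the drift: almost surely `d(o, ω_n o) / n → l`. -/
def IsDrift [MeasurableSpace Γ] {X : Type*} [MetricSpace X] [MulAction Γ X]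
    (μ : PMF Γ) (o : X) (l : ℝ) : Prop :=
  ∀ᵐ x ∂pathMeasure μ, Tendsto (fun n : ℕ => dist o (walk x n • o) / n) atTop (𝓝 l)

/-- `l` is the drift for the potential `F`: almost surely `d_F(o, ω_n o) / n → l`. -/
def IsFakeDrift [MeasurableSpace Γ] {X : Type*} [MetricSpace X] [MulAction Γ X]
    (μ : PMF Γ) (F : UnitTangent X → ℝ) (o : X) (l : ℝ) : Prop :=
  ∀ᵐ x ∂pathMeasure μ, Tendsto (fun n : ℕ => fakeDist F o (walk x n • o) / n) atTop (𝓝 l)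

end Walk

end GibbsWalk

namespace GibbsWalk

/-! ### Hyperbolic geometry -/

/-! The inequality is a Gibbs inequality. For s > v_F put u(g) = s d(o, go) - d_F(o, go). Then ∑
exp(-u) converges, so the entropy of μⁿ is at most ∫ u dμⁿ plus a constant independent of n.
Dividing by n gives h ≤ s ℓ - ℓ_F (`fundamental_inequality`), and s decreases to v_F. Positivity of
the drift (`drift_pos`) excludes v_F = -∞, since s could then tend to -∞. Convergence of ∑ exp(-u)
needs finitely many g of bounded displacement, which is itself a consequence of v_F < ∞
(`finite_setOf_dist_le`).

The main work is the existence of the limits: d_F is not subadditive and F may be unbounded. Thin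
triangles and Hölder control bound the defect d_F(o, gho) - d_F(o, go) - d_F(o, ho) by B exp(η (g⁻¹o
| ho)_o) for every η > 0 (`exists_quasiAdditive_fakeDist`). If the Gromov products (y | ω_n o)_o
have an exponential moment uniform in n and y, this defect is uniformly bounded in L²; so is that of
d, which equals -2 (g⁻¹o | ho)_o. For such functions the means are additive up to a constant and the
variance at time k⁴ is O(k⁶). Chebyshev's inequality along fourth powers, with L² control of the
increments in between, then gives almost sure convergence (`IsQuasiAdditive.exists_tendsto`).

The uniform moment comes from a contraction E exp(-κ d(ω_n o, z)) ≤ C rⁿ exp(-κ d(o, z)) with r < 1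
(`exists_contraction`). To first order in κ, a long Schottky family contracts exp(-κ d(o, ·)) on
average because most of its elements move points apart; a Green function of the remaining mass turns
this into a Lyapunov function for the whole walk. The contraction makes it unlikely that the segment
[o, ω_n o] passes near a distant point (`exists_iterSum_gromovProd_le`), and summation over the
points of [o, y] yields the moment (`exists_expMoment_gromovProd`). The same contraction and
Jensen's inequality give positive drift. -/

theorem cosh_sub_sinh_mul_cos_pos (r θ : ℝ) : 0 < Real.cosh r - Real.sinh r * Real.cos θ := by
  have h1 := Real.cosh_sq r
  have h2 := Real.cos_sq_add_sin_sq θ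
  rw [sub_pos]
  refine lt_of_pow_lt_pow_left₀ 2 (Real.cosh_pos r).le ?_
  nlinarith [mul_nonneg (sq_nonneg (Real.sinh r)) (sq_nonneg (Real.sin θ))]

/-- The point of `ℍ` with polar coordinates `(r, θ)` around `i`. -/
noncomputable def polarPoint (r θ : ℝ) : ℍ :=
  UpperHalfPlane.mk
    ⟨Real.sinh r * Real.sin θ / (Real.cosh r - Real.sinh r * Real.cos θ),
      (Real.cosh r - Real.sinh r * Real.cos θ)⁻¹⟩
    (inv_pos.2 (cosh_sub_sinh_mul_cos_pos r θ))

/-- The hyperbolic law of cosines at `i`, which allows comparison triangles to be placed explicitly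
with a vertex at `i`. -/
theorem cosh_dist_polarPoint (r s θ ψ : ℝ) :
    Real.cosh (dist (polarPoint r θ) (polarPoint s ψ)) =
      Real.cosh r * Real.cosh s - Real.sinh r * Real.sinh s * Real.cos (θ - ψ) := by
  have hr := cosh_sub_sinh_mul_cos_pos r θ
  have hs := cosh_sub_sinh_mul_cos_pos s ψ
  rw [UpperHalfPlane.cosh_dist, Complex.dist_eq, Complex.sq_norm, Complex.normSq_apply, Real.cos_sub]
  simp only [polarPoint, UpperHalfPlane.coe_mk, UpperHalfPlane.im, Complex.sub_re, Complex.sub_im]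
  have h1 := Real.cosh_sq r
  have h2 := Real.cos_sq_add_sin_sq θ
  have h3 := Real.cosh_sq s
  have h4 := Real.cos_sq_add_sin_sq ψ
  generalize Real.cosh r = a at *
  generalize Real.sinh r = b at *
  generalize Real.cosh s = c at *
  generalize Real.sinh s = d at *
  generalize Real.cos θ = e at *
  generalize Real.sin θ = f at *
  generalize Real.cos ψ = g at *
  generalize Real.sin ψ = h at *
  have e1 : b ^ 2 * f ^ 2 = (a - b * e) * (a + b * e) - 1 := by linear_combination b ^ 2 * h2 - h1
  have e2 : d ^ 2 * h ^ 2 = (c - d * g) * (c + d * g) - 1 := by linear_combination d ^ 2 * h4 - h3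
  obtain ⟨u, hu⟩ : ∃ u, u = a - b * e := ⟨_, rfl⟩
  obtain ⟨v, hv⟩ : ∃ v, v = c - d * g := ⟨_, rfl⟩
  rw [← hu] at e1 hr ⊢
  rw [← hv] at e2 hs ⊢
  have ha : a = u + b * e := by linarith
  have hc : c = v + d * g := by linarith
  subst ha hc
  field_simp
  linear_combination v ^ 2 * e1 + u ^ 2 * e2

theorem dist_polarPoint_of_cosh {r s θ ψ a : ℝ} (ha : 0 ≤ a)
    (h : Real.cosh r * Real.cosh s - Real.sinh r * Real.sinh s * Real.cos (θ - ψ) = Real.cosh a) :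
    dist (polarPoint r θ) (polarPoint s ψ) = a := by
  rw [← cosh_dist_polarPoint] at h
  have h1 := Real.cosh_le_cosh.1 h.le
  have h2 := Real.cosh_le_cosh.1 h.ge
  rw [abs_of_nonneg dist_nonneg, abs_of_nonneg ha] at h1 h2
  exact le_antisymm h1 h2

section Geometry

variable {X : Type*} [MetricSpace X]

/-- The Gromov product `(x | y)_o`. -/
noncomputable def gromovProd (o x y : X) : ℝ := (dist o x + dist o y - dist x y) / 2

theorem gromovProd_comm (o x y : X) : gromovProd o x y = gromovProd o y x := by
  simp only [gromovProd, dist_comm x y]; ring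

theorem gromovProd_nonneg (o x y : X) : 0 ≤ gromovProd o x y := by
  have := dist_triangle_left x y o
  simp only [gromovProd]; linarith

theorem gromovProd_le_left (o x y : X) : gromovProd o x y ≤ dist o x := by
  have := dist_triangle o x y
  simp only [gromovProd]; linarith

theorem gromovProd_le_right (o x y : X) : gromovProd o x y ≤ dist o y := by
  rw [gromovProd_comm]; exact gromovProd_le_left o y x

theorem gromovProd_add (o x y : X) : gromovProd o x y + gromovProd x o y = dist o x := by
  simp only [gromovProd, dist_comm x o]; ring

theorem gromovProd_le_add_base (o o' x y : X) :
    gromovProd o x y ≤ gromovProd o' x y + dist o o' := by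
  have h1 := dist_triangle o o' x
  have h2 := dist_triangle o o' y
  simp only [gromovProd]; linarith

theorem gromovProd_le_add_left (o x x' y : X) :
    gromovProd o x y ≤ gromovProd o x' y + dist x x' := by
  have h1 := dist_triangle o x' x
  have h2 := dist_triangle x' x y
  simp only [gromovProd]
  rw [dist_comm x' x] at h1 h2
  linarith

theorem gromovProd_le_add_right (o x y y' : X) :
    gromovProd o x y ≤ gromovProd o x y' + dist y y' := by
  rw [gromovProd_comm o x y, gromovProd_comm o x y']; exact gromovProd_le_add_left o y y' x

theorem gromovProd_smul {Γ : Type*} [Group Γ] [MulAction Γ X] [IsIsometricSMul Γ X] (g : Γ)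
    (o x y : X) : gromovProd (g • o) (g • x) (g • y) = gromovProd o x y := by
  simp [gromovProd]

theorem IsCATNegOne.exists_between (hX : IsCATNegOne X) (x y : X) {t : ℝ} (h0 : 0 ≤ t)
    (h1 : t ≤ dist x y) : ∃ p, dist x p = t ∧ dist x p + dist p y = dist x y := by
  obtain ⟨γ, g0, g1, hγ⟩ := hX.geodesic x y
  have e1 : dist x (γ t) = t := by
    conv_lhs => rw [← g0]
    rw [hγ 0 ⟨le_rfl, dist_nonneg⟩ t ⟨h0, h1⟩, zero_sub, abs_neg, abs_of_nonneg h0]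
  have e2 : dist (γ t) y = dist x y - t := by
    conv_lhs => rw [← g1]
    rw [hγ t ⟨h0, h1⟩ _ ⟨dist_nonneg, le_rfl⟩, abs_sub_comm, abs_of_nonneg (by linarith)]
  exact ⟨γ t, e1, by rw [e1, e2]; ring⟩

/-- Triangles in a CAT(-1) space are thin. -/
theorem IsCATNegOne.dist_le_two (hX : IsCATNegOne X) {x y z p q : X}
    (hp : dist x p + dist p y = dist x y) (hq : dist x q + dist q z = dist x z)
    (hpq : dist x p = dist x q) (hs : dist x p ≤ gromovProd x y z) : dist p q ≤ 2 := by
  rcases eq_or_lt_of_le (dist_nonneg (x := x) (y := p)) with h0 | h0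
  · have h1 := dist_triangle_left p q x
    linarith
  obtain ⟨s, hs_def⟩ : ∃ s, s = dist x p := ⟨_, rfl⟩
  rw [← hs_def] at h0 hp hpq hs
  obtain ⟨b, hb⟩ : ∃ b, b = dist x z := ⟨_, rfl⟩
  obtain ⟨c, hc⟩ : ∃ c, c = dist x y := ⟨_, rfl⟩
  obtain ⟨a, ha⟩ : ∃ a, a = dist y z := ⟨_, rfl⟩
  have hsb : s ≤ b := by rw [hb]; exact hs.trans (gromovProd_le_right x y z)
  have hsc : s ≤ c := by rw [hc]; exact hs.trans (gromovProd_le_left x y z)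
  have ha0 : 0 ≤ a := ha ▸ dist_nonneg
  have t1 : a ≤ b + c := by rw [ha, hb, hc]; linarith [dist_triangle_left y z x]
  have t2 : |b - c| ≤ a := by
    rw [ha, hb, hc, abs_le]
    constructor
    · linarith [dist_triangle x z y, dist_comm y z]
    · linarith [dist_triangle x y z]
  have hsG : s ≤ (c + b - a) / 2 := by rw [ha, hb, hc]; exact hs
  have hsb0 : 0 < Real.sinh b := Real.sinh_pos_iff.2 (by linarith)
  have hsc0 : 0 < Real.sinh c := Real.sinh_pos_iff.2 (by linarith)
  have k1 : Real.cosh (b - c) ≤ Real.cosh a := Real.cosh_le_cosh.2 (by rwa [abs_of_nonneg ha0])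
  have k2 : Real.cosh a ≤ Real.cosh (b + c) :=
    Real.cosh_le_cosh.2 (by rwa [abs_of_nonneg ha0, abs_of_nonneg (by linarith)])
  rw [Real.cosh_sub] at k1
  rw [Real.cosh_add] at k2
  obtain ⟨r, hr⟩ : ∃ r, r = (Real.cosh b * Real.cosh c - Real.cosh a) /
    (Real.sinh b * Real.sinh c) := ⟨_, rfl⟩
  have hpos : 0 < Real.sinh b * Real.sinh c := mul_pos hsb0 hsc0
  have hr1 : r ≤ 1 := by rw [hr, div_le_one hpos]; linarith
  have hr2 : -1 ≤ r := by rw [hr, le_div_iff₀ hpos]; linarith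
  have hrm : r * (Real.sinh b * Real.sinh c) = Real.cosh b * Real.cosh c - Real.cosh a := by
    rw [hr, div_mul_cancel₀ _ hpos.ne']
  have hcos : Real.cos (Real.arccos r) = r := Real.cos_arccos hr2 hr1
  have key := hX.comparison x y z p q (polarPoint 0 0) (polarPoint c 0)
    (polarPoint b (Real.arccos r)) (polarPoint s 0) (polarPoint s (Real.arccos r))
    (by rw [← hc]; exact dist_polarPoint_of_cosh (by linarith) (by simp))
    (by
      rw [← ha]; refine dist_polarPoint_of_cosh ha0 ?_
      rw [zero_sub, Real.cos_neg, hcos]; linear_combination -hrm)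
    (by rw [← hb]; exact dist_polarPoint_of_cosh (by linarith) (by simp))
    (by rw [← hs_def, hp]) hq
    (by rw [← hs_def]; exact dist_polarPoint_of_cosh h0.le (by simp))
    (by
      refine dist_polarPoint_of_cosh dist_nonneg ?_
      rw [show dist p y = c - s by linarith, Real.cosh_sub, sub_zero, Real.cos_zero]; ring)
    (by rw [← hpq]; exact dist_polarPoint_of_cosh h0.le (by simp))
    (by
      refine dist_polarPoint_of_cosh dist_nonneg ?_
      rw [show dist q z = b - s by linarith, Real.cosh_sub, sub_self, Real.cos_zero]; ring)
  refine key.trans ?_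
  -- The left side is 1 + sinh² s (1 - cos α), with α the comparison angle. The law of cosines gives
  -- (1 - cos α) sinh b sinh c = 2 sinh u sinh v, and s + u ≤ b, s + v ≤ c give sinh s sinh u ≤ sinh
  -- b and sinh s sinh v ≤ sinh c. The bound 3 is below cosh 2.
  have h3 : Real.cosh (dist (polarPoint s 0) (polarPoint s (Real.arccos r))) ≤ 3 := by
    rw [cosh_dist_polarPoint, zero_sub, Real.cos_neg, hcos]
    obtain ⟨u, hu⟩ : ∃ u, u = (a + b - c) / 2 := ⟨_, rfl⟩
    obtain ⟨v, hv⟩ : ∃ v, v = (a - b + c) / 2 := ⟨_, rfl⟩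
    have hu0 : 0 ≤ u := by rw [hu]; linarith [neg_abs_le (b - c)]
    have hv0 : 0 ≤ v := by rw [hv]; linarith [le_abs_self (b - c)]
    have j4 := Real.sinh_nonneg_iff.2 h0.le
    have aux : ∀ w, 0 ≤ w → Real.sinh s * Real.sinh w ≤ Real.sinh (s + w) := by
      intro w hw
      rw [Real.sinh_add]
      have j1 := mul_le_mul_of_nonneg_left (Real.sinh_lt_cosh w).le j4
      have j2 := mul_nonneg (Real.cosh_pos s).le (Real.sinh_nonneg_iff.2 hw)
      linarith
    have i1 : Real.sinh s * Real.sinh u ≤ Real.sinh b :=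
      (aux u hu0).trans (Real.sinh_le_sinh.2 (by rw [hu]; linarith))
    have i2 : Real.sinh s * Real.sinh v ≤ Real.sinh c :=
      (aux v hv0).trans (Real.sinh_le_sinh.2 (by rw [hv]; linarith))
    have i3 : Real.cosh a - (Real.cosh b * Real.cosh c - Real.sinh b * Real.sinh c) =
        2 * Real.sinh u * Real.sinh v := by
      rw [← Real.cosh_sub, show a = u + v by rw [hu, hv]; ring,
        show b - c = u - v by rw [hu, hv]; ring, Real.cosh_add, Real.cosh_sub]
      ring
    have i4 := mul_le_mul i1 i2 (mul_nonneg j4 (Real.sinh_nonneg_iff.2 hv0)) hsb0.le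
    have i5 : (1 - r) * (Real.sinh b * Real.sinh c) = 2 * Real.sinh u * Real.sinh v := by
      linear_combination i3 - hrm
    have i6 : Real.sinh s ^ 2 * (1 - r) * (Real.sinh b * Real.sinh c) ≤
        2 * (Real.sinh b * Real.sinh c) := by
      rw [mul_assoc, i5]; linear_combination 2 * i4
    have i7 := le_of_mul_le_mul_right i6 hpos
    have i8 := Real.cosh_sq s
    linear_combination i7 + i8
  by_contra! hlt
  have h4 : Real.cosh 2 < Real.cosh (dist (polarPoint s 0) (polarPoint s (Real.arccos r))) :=
    Real.cosh_lt_cosh.2 (by rwa [abs_of_nonneg (by norm_num), abs_of_nonneg dist_nonneg])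
  have h5 : (3 : ℝ) ≤ Real.cosh 2 := by
    have e2 : Real.exp 2 = Real.exp 1 * Real.exp 1 := by rw [← Real.exp_add]; norm_num
    have e3 := Real.exp_one_gt_d9
    have e4 := Real.exp_pos (-2)
    rw [Real.cosh_eq]
    nlinarith
  linarith

/-- CAT(-1) spaces are Gromov hyperbolic. -/
theorem IsCATNegOne.four_point (hX : IsCATNegOne X) (o x y z : X) :
    min (gromovProd o x y) (gromovProd o y z) ≤ gromovProd o x z + 2 := by
  set t := min (gromovProd o x y) (gromovProd o y z)
  have t0 : 0 ≤ t := le_min (gromovProd_nonneg ..) (gromovProd_nonneg ..)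
  have t1 : t ≤ gromovProd o x y := min_le_left _ _
  have t2 : t ≤ gromovProd o y z := min_le_right _ _
  obtain ⟨p, p1, p2⟩ := hX.exists_between o x t0 (t1.trans (gromovProd_le_left ..))
  obtain ⟨q, q1, q2⟩ := hX.exists_between o y t0 (t1.trans (gromovProd_le_right ..))
  obtain ⟨r, r1, r2⟩ := hX.exists_between o z t0 (t2.trans (gromovProd_le_right ..))
  have d1 := hX.dist_le_two p2 q2 (p1.trans q1.symm) (p1.trans_le t1)
  have d2 := hX.dist_le_two q2 r2 (q1.trans r1.symm) (q1.trans_le t2)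
  have d3 : dist x z ≤ dist p x + (dist p q + dist q r) + dist r z :=
    calc dist x z ≤ dist x p + dist p q + dist q r + dist r z := by
          linarith [dist_triangle4 x p q r, dist_triangle x r z]
      _ = _ := by rw [dist_comm x p]; ring
  rw [show gromovProd o x z = (dist o x + dist o z - dist x z) / 2 from rfl]
  rw [dist_comm p x] at d3
  linarith [dist_comm p x]

end Geometry

/-! ### Schottky families -/

section Schottky

variable {X : Type*} [MetricSpace X]

theorem IsCATNegOne.dist_eq_abs_sub (hX : IsCATNegOne X) {x y p q : X}
    (hp : dist x p + dist p y = dist x y) (hq : dist x q + dist q y = dist x y) :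
    dist p q = |dist x p - dist x q| := by
  obtain ⟨γ, g0, g1, hγ⟩ := hX.geodesic x y
  have aux : ∀ p, dist x p + dist p y = dist x y → p = γ (dist x p) := by
    intro p hp
    have hm : dist x p ∈ Icc 0 (dist x y) :=
      ⟨dist_nonneg, by linarith [dist_nonneg (x := p) (y := y)]⟩
    have e1 : dist x (γ (dist x p)) = dist x p := by
      have := hγ 0 ⟨le_rfl, dist_nonneg⟩ _ hm
      rwa [g0, zero_sub, abs_neg, abs_of_nonneg hm.1] at this
    have e2 : dist (γ (dist x p)) y = dist x y - dist x p := by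
      have := hγ _ hm _ ⟨dist_nonneg, le_rfl⟩
      rwa [g1, abs_sub_comm, abs_of_nonneg (by linarith [hm.2])] at this
    exact hX.eq_of_dist_eq hp (by rw [e1, e2]; ring) e1.symm
  have hm : ∀ p, dist x p + dist p y = dist x y → dist x p ∈ Icc 0 (dist x y) := fun p hp =>
    ⟨dist_nonneg, by linarith [dist_nonneg (x := p) (y := y)]⟩
  conv_lhs => rw [aux p hp, aux q hq]
  exact hγ _ (hm p hp) _ (hm q hq)

/-- A family of segments of unbounded length starting at `o` has a limit ray. -/
theorem IsCATNegOne.exists_limit_ray [ProperSpace X] (hX : IsCATNegOne X) (o : X) (P : ℕ → X)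
    (hP : Tendsto (fun k => dist o (P k)) atTop atTop) :
    ∃ r : ℝ → X, (∀ s t : ℝ, 0 ≤ s → 0 ≤ t → dist (r s) (r t) = |s - t|) ∧
      ∀ t, 0 ≤ t → ∃ q : ℕ → X, Tendsto q (hyperfilter ℕ) (𝓝 (r t)) ∧
        ∀ᶠ k in (hyperfilter ℕ : Filter ℕ), dist o (q k) = t ∧
          dist o (q k) + dist (q k) (P k) = dist o (P k) := by
  have hle : (hyperfilter ℕ : Filter ℕ) ≤ atTop := by
    rw [← Nat.cofinite_eq_atTop]; exact hyperfilter_le_cofinite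
  choose γ g0 g1 hγ using fun k => hX.geodesic o (P k)
  -- The k-th segment with time clipped to its domain. These points stay in a ball, compact by
  -- properness, so a single ultrafilter provides limits for all `t` at once, without a diagonal
  -- subsequence.
  let q : ℝ → ℕ → X := fun t k => γ k (min (max t 0) (dist o (P k)))
  have hmem : ∀ t k, min (max t 0) (dist o (P k)) ∈ Icc 0 (dist o (P k)) := fun t k =>
    ⟨le_min (le_max_right _ _) dist_nonneg, min_le_right _ _⟩
  have hq0 : ∀ t k, dist o (q t k) = min (max t 0) (dist o (P k)) := by
    intro t k
    conv_lhs => rw [← g0 k]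
    rw [hγ k 0 ⟨le_rfl, dist_nonneg⟩ _ (hmem t k), zero_sub, abs_neg, abs_of_nonneg (hmem t k).1]
  have hq1 : ∀ t k, dist (q t k) (P k) = dist o (P k) - min (max t 0) (dist o (P k)) := by
    intro t k
    conv_lhs => rw [← g1 k]
    rw [hγ k _ (hmem t k) _ ⟨dist_nonneg, le_rfl⟩, abs_sub_comm,
      abs_of_nonneg (by linarith [(hmem t k).2])]
  have hlim : ∀ t, ∃ y, Tendsto (q t) (hyperfilter ℕ) (𝓝 y) := by
    intro t
    have hc := isCompact_closedBall o (max t 0)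
    obtain ⟨y, -, hy⟩ := hc.ultrafilter_le_nhds ((hyperfilter ℕ).map (q t)) (by
      rw [le_principal_iff]
      refine Filter.mem_map.2 (Filter.univ_mem' fun k => ?_)
      simp only [mem_preimage, Metric.mem_closedBall]
      rw [dist_comm, hq0]; exact min_le_left _ _)
    exact ⟨y, hy⟩
  choose r hr using hlim
  have hev : ∀ t, 0 ≤ t → ∀ᶠ k in (hyperfilter ℕ : Filter ℕ),
      min (max t 0) (dist o (P k)) = t := by
    intro t ht
    filter_upwards [hle (hP.eventually_ge_atTop t)] with k hk
    rw [max_eq_left ht, min_eq_left hk]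
  refine ⟨r, fun s t hs ht => ?_, fun t ht => ⟨q t, hr t, ?_⟩⟩
  · have h1 := (hr s).dist (hr t)
    refine tendsto_nhds_unique h1 (tendsto_const_nhds.congr' ?_)
    filter_upwards [hev s hs, hev t ht] with k h1 h2
    simp only [q]
    rw [hγ k _ (hmem s k) _ (hmem t k), h1, h2]
  · filter_upwards [hev t ht] with k hk
    rw [hq1, hq0, hk]
    exact ⟨rfl, by ring⟩

variable {Γ : Type*} [Group Γ] [MulAction Γ X] [IsIsometricSMul Γ X]

/-- An isometry that moves the endpoints of a segment by at most `D` displaces the points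
of the segment by a bounded amount. -/
theorem IsCATNegOne.dist_smul_le (hX : IsCATNegOne X) (g : Γ) {o P p : X} {D : ℝ}
    (ho : dist o (g • o) ≤ D) (hP : dist P (g • P) ≤ D)
    (hp : dist o p + dist p P = dist o P) (ht : dist o p + D ≤ dist o P) :
    dist (g • p) p ≤ 4 + 3 * D := by
  have hD : 0 ≤ D := dist_nonneg.trans ho
  rcases le_total (dist o p) D with hpD | hpD
  · have h1 : dist (g • o) (g • p) = dist o p := dist_smul g o p
    have h2 := dist_triangle4 (g • p) (g • o) o p
    rw [dist_comm (g • p) (g • o), dist_comm (g • o) o] at h2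
    linarith
  have h1 := dist_triangle o (g • P) P
  rw [dist_comm (g • P)] at h1
  -- Thinness of the triangle (o, P, gP) takes p to e, and thinness of (gP, o, go) takes e to f.
  -- Then f and gp lie on the same segment [gP, go], where distances are differences of distances to
  -- an endpoint.
  obtain ⟨e, e1, e2⟩ := hX.exists_between o (g • P) (t := dist o p) dist_nonneg (by linarith)
  have d1 : dist p e ≤ 2 := hX.dist_le_two hp e2 e1.symm (by
    simp only [gromovProd]; linarith)
  have h3 : dist (g • o) (g • P) = dist o P := dist_smul g o P
  have h4 : dist (g • o) (g • p) = dist o p := dist_smul g o p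
  have h5 : dist (g • p) (g • P) = dist p P := dist_smul g p P
  have h6 := dist_triangle o (g • o) (g • P)
  have h7 := dist_triangle_left (g • o) (g • P) o
  obtain ⟨f, f1, f2⟩ := hX.exists_between (g • P) (g • o) (t := dist (g • P) e) dist_nonneg (by
    rw [dist_comm _ e, dist_comm _ (g • o)]; linarith)
  have d2 : dist e f ≤ 2 := hX.dist_le_two (x := g • P) (y := o) (z := g • o)
    (by rw [dist_comm _ e, dist_comm e o, dist_comm _ o]; linarith) f2 f1.symm (by
      simp only [gromovProd]
      rw [dist_comm _ e, dist_comm _ o, dist_comm _ (g • o)]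
      linarith)
  have d3 : dist f (g • p) ≤ D := by
    rw [hX.dist_eq_abs_sub (x := g • P) (y := g • o) f2
      (by rw [dist_comm _ (g • p), dist_comm _ (g • o), dist_comm _ (g • o)]; linarith), f1,
      dist_comm _ e, dist_comm _ (g • p), abs_le]
    constructor <;> linarith
  have h8 := dist_triangle4 p e f (g • p)
  rw [dist_comm]
  linarith

/-- The orbits of the powers of two isometries without a common fixed point at infinity diverge
from each other. -/
theorem IsCATNegOne.exists_gromovProd_zpow_le [ProperSpace X] (hX : IsCATNegOne X) {a b : Γ}
    (hab : ∀ r : ℝ → X, (∀ s t : ℝ, 0 ≤ s → 0 ≤ t → dist (r s) (r t) = |s - t|) →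
      ¬ (FixesEnd a r ∧ FixesEnd b r)) (o : X) :
    ∃ C : ℝ, ∀ n m : ℤ, gromovProd o (a ^ n • o) (b ^ m • o) ≤ C := by
  by_contra! hcon
  choose n m hnm using fun k : ℕ => hcon k
  have hle : (hyperfilter ℕ : Filter ℕ) ≤ atTop := by
    rw [← Nat.cofinite_eq_atTop]; exact hyperfilter_le_cofinite
  have hta : Tendsto (fun k => dist o (a ^ n k • o)) atTop atTop :=
    tendsto_atTop_mono (fun k => (hnm k).le.trans (gromovProd_le_left ..))
      tendsto_natCast_atTop_atTop
  have htb : Tendsto (fun k => dist o (b ^ m k • o)) atTop atTop :=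
    tendsto_atTop_mono (fun k => (hnm k).le.trans (gromovProd_le_right ..))
      tendsto_natCast_atTop_atTop
  obtain ⟨r, hr, hrq⟩ := hX.exists_limit_ray o _ hta
  obtain ⟨r', hr', hrq'⟩ := hX.exists_limit_ray o _ htb
  -- Since g commutes with its powers, it moves gⁿo by exactly d(o, go). Hence it displaces the
  -- segments [o, gⁿo], and then their limit ray, by a bounded amount.
  have key : ∀ (g : Γ) (n : ℕ → ℤ) (r : ℝ → X),
      Tendsto (fun k => dist o (g ^ n k • o)) atTop atTop →
      (∀ t, 0 ≤ t → ∃ q : ℕ → X, Tendsto q (hyperfilter ℕ) (𝓝 (r t)) ∧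
        ∀ᶠ k in (hyperfilter ℕ : Filter ℕ), dist o (q k) = t ∧
          dist o (q k) + dist (q k) (g ^ n k • o) = dist o (g ^ n k • o)) →
      ∀ t, 0 ≤ t → dist (g • r t) (r t) ≤ 4 + 3 * dist o (g • o) := by
    intro g n r ht h t ht0
    obtain ⟨q, q1, q2⟩ := h t ht0
    refine le_of_tendsto ((q1.const_smul g).dist q1) ?_
    filter_upwards [q2, hle (ht.eventually_ge_atTop (t + dist o (g • o)))] with k k1 k2
    refine hX.dist_smul_le g le_rfl (P := g ^ n k • o) ?_ k1.2 (by rw [k1.1]; exact k2)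
    rw [smul_smul, ← zpow_one_add, add_comm, zpow_add_one, ← smul_smul, dist_smul]
  -- Unbounded Gromov products force the two limit rays to be asymptotic, so that a and b fix a
  -- common end.
  have hrr : ∀ t, 0 ≤ t → dist (r t) (r' t) ≤ 2 := by
    intro t ht
    obtain ⟨q, q1, q2⟩ := hrq t ht
    obtain ⟨q', q1', q2'⟩ := hrq' t ht
    refine le_of_tendsto (q1.dist q1') ?_
    filter_upwards [q2, q2', hle (tendsto_natCast_atTop_atTop.eventually_ge_atTop t)]
      with k k1 k2 k3
    exact hX.dist_le_two k1.2 k2.2 (k1.1.trans k2.1.symm) (by rw [k1.1]; exact k3.trans (hnm k).le)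
  refine hab r hr ⟨⟨_, key a n r hta hrq⟩, ⟨4 + 3 * dist o (b • o) + 4, fun t ht => ?_⟩⟩
  have h1 := key b m r' htb hrq' t ht
  have h2 := hrr t ht
  have h3 := dist_triangle4 (b • r t) (b • r' t) (r' t) (r t)
  rw [dist_smul, dist_comm (r' t) (r t)] at h3
  linarith

/-- The elements are uᵢ aⁿ uᵢ⁻¹ with uᵢ = b^(l i). The conjugators separate the endpoints, so `C`
depends on them only, while n makes the displacements arbitrarily large. The contraction estimate
needs `C` fixed before `L`. -/
theorem exists_schottky [ProperSpace X] (hX : IsCATNegOne X) (hΓ : IsNonelementary Γ X)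
    (o : X) (M : ℕ) : ∃ C : ℝ, ∀ L₀ : ℝ, ∃ L, L₀ ≤ L ∧ ∃ s : Fin M → Γ,
      (∀ i, L ≤ dist o (s i • o) ∧ dist o (s i • o) ≤ 2 * L) ∧
      ∀ i j, i ≠ j → gromovProd o (s i • o) (s j • o) ≤ C ∧
        gromovProd o ((s i)⁻¹ • o) ((s j)⁻¹ • o) ≤ C := by
  obtain ⟨a, b, ⟨ca, ca0, hca⟩, ⟨cb, cb0, hcb⟩, hab⟩ := hΓ
  obtain ⟨C₀, hC₀⟩ := hX.exists_gromovProd_zpow_le hab o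
  obtain ⟨l, hl⟩ := exists_nat_gt ((2 * C₀ + 2) / cb)
  rw [div_lt_iff₀ cb0] at hl
  have hpow : ∀ k : ℤ, k ≠ 0 → 2 * C₀ + 2 < dist o (b ^ (l * k) • o) := by
    intro k hk
    have h1 : ∀ n : ℕ, n ≠ 0 → 2 * C₀ + 2 < dist o (b ^ (l * n) • o) := by
      intro n hn
      have h1 := hcb o (l * n)
      have h2 : cb * l ≤ cb * (l * n : ℕ) := by
        push_cast; rw [← mul_assoc]
        exact le_mul_of_one_le_right (by positivity) (by exact_mod_cast Nat.one_le_iff_ne_zero.2 hn)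
      linarith [mul_comm (l : ℝ) cb]
    obtain ⟨n, rfl | rfl⟩ := k.eq_nat_or_neg
    · rw [← Nat.cast_mul, zpow_natCast]; exact h1 n (by simpa using hk)
    · rw [mul_neg, ← Nat.cast_mul, zpow_neg, zpow_natCast, ← dist_smul (b ^ (l * n)), smul_inv_smul,
        dist_comm]
      exact h1 n (by simpa using hk)
  let u : Fin M → Γ := fun i => b ^ ((l : ℤ) * (i : ℕ))
  have hu : ∀ i j, i ≠ j → ∀ n m : ℤ,
      gromovProd o ((u i * a ^ n) • o) ((u j * a ^ m) • o) ≤ C₀ + 2 + dist o (u i • o) := by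
    intro i j hij n m
    refine (gromovProd_le_add_base o (u i • o) _ _).trans ?_
    have hk : ((j : ℕ) : ℤ) - ((i : ℕ) : ℤ) ≠ 0 := by
      intro h; apply hij; ext; omega
    set v := b ^ ((l : ℤ) * (((j : ℕ) : ℤ) - ((i : ℕ) : ℤ))) with hv
    have hvu : u j = u i * v := by
      simp only [u, hv, ← zpow_add]; congr 1; ring
    rw [hvu, mul_assoc, mul_smul, mul_smul (u i) (v * _), gromovProd_smul]
    have h1 : gromovProd o (a ^ n • o) (v • o) ≤ C₀ := hC₀ _ _
    have h2 : gromovProd (v • o) o ((v * a ^ m) • o) ≤ C₀ := by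
      rw [← gromovProd_smul v⁻¹, inv_smul_smul, mul_smul, inv_smul_smul, gromovProd_comm, hv,
        ← zpow_neg]
      exact hC₀ _ _
    have h3 := gromovProd_add o (v • o) ((v * a ^ m) • o)
    have h4 := hpow _ hk
    -- Seen from o, the product of v o and v aᵐo is at least d(o, vo) - C₀ > C₀ + 2, by the choice
    -- of `l`, whereas that of aⁿo and vo is at most C₀. The four-point inequality therefore bounds
    -- the remaining product by C₀ + 2.
    have h5 := hX.four_point o (a ^ n • o) ((v * a ^ m) • o) (v • o)
    rw [gromovProd_comm o ((v * a ^ m) • o)] at h5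
    rcases min_le_iff.1 h5 with h | h <;> linarith
  obtain ⟨U, hU⟩ : ∃ U, ∀ i, dist o (u i • o) ≤ U :=
    ⟨∑ i, dist o (u i • o), fun i =>
      Finset.single_le_sum (f := fun i => dist o (u i • o)) (fun _ _ => dist_nonneg)
        (Finset.mem_univ i)⟩
  refine ⟨C₀ + 2 + 3 * U, fun L₀ => ?_⟩
  -- With d = d(o, aⁿo) the displacements lie in [d - 2U, d + 2U], and d ≥ 6U ensures d + 2U ≤ 2 (d
  -- - 2U).
  obtain ⟨n, hn⟩ := exists_nat_gt (max (L₀ + 2 * U) (6 * U) / ca)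
  rw [div_lt_iff₀ ca0, mul_comm _ ca] at hn
  have hn' := hn.trans_le (hca o n)
  have hn1 := (le_max_left _ _).trans hn'.le
  have hn2 := (le_max_right _ _).trans hn'.le
  have hclose : ∀ i (k : ℤ), dist ((u i * a ^ k * (u i)⁻¹) • o) ((u i * a ^ k) • o) ≤ U := by
    intro i k
    rw [mul_smul, dist_smul, ← dist_smul (u i), smul_inv_smul]
    exact hU i
  have hinv : ∀ i, (u i * a ^ (n : ℤ) * (u i)⁻¹)⁻¹ = u i * a ^ (-(n : ℤ)) * (u i)⁻¹ := by
    intro i; rw [zpow_neg]; group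
  have hgp : ∀ i j, i ≠ j → ∀ k : ℤ, gromovProd o ((u i * a ^ k * (u i)⁻¹) • o)
      ((u j * a ^ k * (u j)⁻¹) • o) ≤ C₀ + 2 + 3 * U := by
    intro i j hij k
    have h1 := gromovProd_le_add_left o ((u i * a ^ k * (u i)⁻¹) • o) ((u i * a ^ k) • o)
      ((u j * a ^ k * (u j)⁻¹) • o)
    have h2 := gromovProd_le_add_right o ((u i * a ^ k) • o)
      ((u j * a ^ k * (u j)⁻¹) • o) ((u j * a ^ k) • o)
    linarith [hclose i k, hclose j k, hu i j hij k k, hU i]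
  refine ⟨dist o (a ^ n • o) - 2 * U, by linarith, fun i => u i * a ^ (n : ℤ) * (u i)⁻¹,
    fun i => ?_, fun i j hij => ⟨hgp i j hij n, ?_⟩⟩
  · have h1 := hclose i n
    have h2 : dist (u i • o) ((u i * a ^ (n : ℤ)) • o) = dist o (a ^ n • o) := by
      rw [mul_smul, dist_smul, zpow_natCast]
    have h3 := hU i
    have h4 := dist_triangle4 o (u i • o) ((u i * a ^ (n : ℤ)) • o)
      ((u i * a ^ (n : ℤ) * (u i)⁻¹) • o)
    have h5 := dist_triangle4 (u i • o) o ((u i * a ^ (n : ℤ) * (u i)⁻¹) • o)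
      ((u i * a ^ (n : ℤ)) • o)
    rw [dist_comm ((u i * a ^ (n : ℤ)) • o)] at h4
    rw [dist_comm (u i • o) o] at h5
    constructor <;> linarith
  · rw [hinv, hinv]; exact hgp i j hij _

/-- Most elements of a Schottky family move any point away from any other one. -/
theorem IsCATNegOne.exists_finset_forall_notMem (hX : IsCATNegOne X) {o : X} {M : ℕ}
    {s : Fin M → Γ} {C : ℝ} (hlong : ∀ i, 2 * C + 6 < dist o (s i • o))
    (hs : ∀ i j, i ≠ j → gromovProd o (s i • o) (s j • o) ≤ C ∧
        gromovProd o ((s i)⁻¹ • o) ((s j)⁻¹ • o) ≤ C) (x z : X) :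
    ∃ B : Finset (Fin M), B.card ≤ 2 ∧ ∀ i ∉ B,
      dist o z + dist o (s i • o) + dist o x - (4 * C + 16) ≤ dist (s i • x) z := by
  classical
  -- Two members whose products with z exceed C + 2 would have mutual product above C. So there is
  -- at most one bad index for z and, through the inverses, at most one for x.
  have aux : ∀ (t : Fin M → X) (z : X), (∀ i j, i ≠ j → gromovProd o (t i) (t j) ≤ C) →
      (Finset.univ.filter fun i => C + 2 < gromovProd o (t i) z).card ≤ 1 := by
    intro t z ht
    refine Finset.card_le_one.2 fun i hi j hj => ?_
    by_contra hij
    simp only [Finset.mem_filter, Finset.mem_univ, true_and] at hi hj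
    rw [gromovProd_comm] at hj
    have h1 := hX.four_point o (t i) z (t j)
    have h2 := ht i j hij
    rcases min_le_iff.1 h1 with h | h <;> linarith
  refine ⟨(Finset.univ.filter fun i => C + 2 < gromovProd o (s i • o) z) ∪
    (Finset.univ.filter fun i => C + 2 < gromovProd o ((s i)⁻¹ • o) x),
    (Finset.card_union_le _ _).trans (add_le_add (aux _ z fun i j h => (hs i j h).1)
      (aux _ x fun i j h => (hs i j h).2)), fun i hi => ?_⟩
  simp only [Finset.mem_union, Finset.mem_filter, Finset.mem_univ, true_and, not_or, not_lt] at hi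
  obtain ⟨h1, h2⟩ := hi
  have h3 : gromovProd (s i • o) o (s i • x) ≤ C + 2 := by
    rwa [← gromovProd_smul (s i)⁻¹, inv_smul_smul, inv_smul_smul]
  have h4 := gromovProd_add o (s i • o) (s i • x)
  have h5 := hlong i
  -- The product of sᵢo and sᵢx exceeds C + 4 because sᵢ is long, so that of sᵢx and z is at most C
  -- + 4: the broken path z, o, sᵢo, sᵢx is nearly geodesic.
  have h6 := hX.four_point o (s i • o) (s i • x) z
  have h7 : dist (s i • o) (s i • x) = dist o x := dist_smul ..
  have h8 : gromovProd o (s i • x) z ≤ C + 4 := by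
    rcases min_le_iff.1 h6 with h | h <;> linarith
  simp only [gromovProd] at h3 h8
  rw [dist_comm _ o, h7] at h3
  linarith

end Schottky

/-! ### Iterated sums -/

section IterSum

variable {Γ : Type*} [Group Γ]

/-- The integral of `f` against the `k`-th convolution power of the weights `T`. -/
noncomputable def iterSum (T : Γ → ℝ≥0∞) : ℕ → (Γ → ℝ≥0∞) → ℝ≥0∞
  | 0, f => f 1
  | k + 1, f => ∑' g, T g * iterSum T k fun h => f (g * h)

/-- The integral of `f` against the Green function of the weights `T`. -/
noncomputable def greenSum (T : Γ → ℝ≥0∞) (f : Γ → ℝ≥0∞) : ℝ≥0∞ := ∑' k, iterSum T k f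

variable {T : Γ → ℝ≥0∞}

theorem iterSum_mono {f f' : Γ → ℝ≥0∞} (h : ∀ g, f g ≤ f' g) (k : ℕ) :
    iterSum T k f ≤ iterSum T k f' := by
  induction k generalizing f f' with
  | zero => exact h 1
  | succ k ih => exact ENNReal.tsum_le_tsum fun g => mul_le_mul_right (ih fun x => h _) _

theorem iterSum_add (f f' : Γ → ℝ≥0∞) (k : ℕ) :
    iterSum T k (fun g => f g + f' g) = iterSum T k f + iterSum T k f' := by
  induction k generalizing f f' with
  | zero => rfl
  | succ k ih => simp only [iterSum, ih, mul_add, ENNReal.tsum_add]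

theorem iterSum_mul_left (c : ℝ≥0∞) (f : Γ → ℝ≥0∞) (k : ℕ) :
    iterSum T k (fun g => c * f g) = c * iterSum T k f := by
  induction k generalizing f with
  | zero => rfl
  | succ k ih => simp only [iterSum, ih, mul_left_comm _ c, ENNReal.tsum_mul_left]

theorem iterSum_one (k : ℕ) : iterSum T k (fun _ => 1) = (∑' g, T g) ^ k := by
  induction k with
  | zero => simp [iterSum]
  | succ k ih => simp only [iterSum, ih, ENNReal.tsum_mul_right, pow_succ']

theorem iterSum_add_right (f : Γ → ℝ≥0∞) (k l : ℕ) :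
    iterSum T (k + l) f = iterSum T k fun g => iterSum T l fun h => f (g * h) := by
  induction k generalizing f with
  | zero => simp [iterSum]
  | succ k ih => simp only [Nat.succ_add, iterSum, ih, mul_assoc]

/-- A submultiplicative function splits over the increments. It is applied to exp(κ d(o, go)), for
powers of the walk as well as for Green functions. -/
theorem iterSum_le_pow {f : Γ → ℝ≥0∞} (h1 : f 1 ≤ 1) (hmul : ∀ g h, f (g * h) ≤ f g * f h)
    (k : ℕ) : iterSum T k f ≤ (∑' g, T g * f g) ^ k := by
  induction k with
  | zero => simpa [iterSum] using h1
  | succ k ih =>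
    calc iterSum T (k + 1) f ≤ ∑' g, T g * iterSum T k fun h => f g * f h :=
          ENNReal.tsum_le_tsum fun g => mul_le_mul_right (iterSum_mono (hmul g) k) _
      _ = (∑' g, T g * f g) * iterSum T k f := by
          simp only [iterSum_mul_left, ← mul_assoc, ENNReal.tsum_mul_right]
      _ ≤ _ := by rw [pow_succ']; exact mul_le_mul_right ih _

theorem greenSum_mono {f f' : Γ → ℝ≥0∞} (h : ∀ g, f g ≤ f' g) :
    greenSum T f ≤ greenSum T f' := ENNReal.tsum_le_tsum fun k => iterSum_mono h k

theorem greenSum_add (f f' : Γ → ℝ≥0∞) :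
    greenSum T (fun g => f g + f' g) = greenSum T f + greenSum T f' := by
  simp only [greenSum, iterSum_add, ENNReal.tsum_add]

theorem greenSum_mul_left (c : ℝ≥0∞) (f : Γ → ℝ≥0∞) :
    greenSum T (fun g => c * f g) = c * greenSum T f := by
  simp only [greenSum, iterSum_mul_left, ENNReal.tsum_mul_left]

theorem greenSum_finset_sum {ι : Type*} (s : Finset ι) (f : ι → Γ → ℝ≥0∞) :
    greenSum T (fun g => ∑ i ∈ s, f i g) = ∑ i ∈ s, greenSum T (f i) := by
  classical
  induction s using Finset.induction_on with
  | empty =>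
    simp only [Finset.sum_empty]
    have := greenSum_mul_left (T := T) 0 fun _ => 0
    simpa using this
  | insert i s hi ih => simp only [Finset.sum_insert hi, greenSum_add, ih]

theorem greenSum_one : greenSum T (fun _ => 1) = (1 - ∑' g, T g)⁻¹ := by
  simp only [greenSum, iterSum_one, ENNReal.tsum_geometric]

theorem greenSum_le {f : Γ → ℝ≥0∞} (h1 : f 1 ≤ 1) (hmul : ∀ g h, f (g * h) ≤ f g * f h) :
    greenSum T f ≤ (1 - ∑' g, T g * f g)⁻¹ := by
  rw [← ENNReal.tsum_geometric]
  exact ENNReal.tsum_le_tsum fun k => iterSum_le_pow h1 hmul k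

/-- The renewal equation: split off k = 0 and condition on the first step. -/
theorem greenSum_eq_add (f : Γ → ℝ≥0∞) :
    greenSum T f = f 1 + ∑' g, T g * greenSum T fun h => f (g * h) := by
  rw [greenSum, tsum_eq_zero_add' ENNReal.summable]
  simp only [greenSum, iterSum, ← ENNReal.tsum_mul_left]
  rw [ENNReal.tsum_comm]

theorem tsum_bind_map_mul (p q : PMF Γ) (f : Γ → ℝ≥0∞) :
    ∑' g, (p.bind fun a => q.map fun x => a * x) g * f g = ∑' a, p a * ∑' x, q x * f (a * x) := by
  have hmap : ∀ a, ∑' g, (q.map fun x => a * x) g * f g = ∑' x, q x * f (a * x) := by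
    intro a
    rw [← (Equiv.mulLeft a).tsum_eq]
    refine tsum_congr fun x => ?_
    rw [Equiv.coe_mulLeft, PMF.map_apply, tsum_eq_single x]
    · simp
    · intro y hy; simp [hy.symm]
  simp only [PMF.bind_apply, ← ENNReal.tsum_mul_right]
  rw [ENNReal.tsum_comm]
  refine tsum_congr fun a => ?_
  simp only [mul_assoc, ENNReal.tsum_mul_left, hmap]

theorem tsum_convPow (μ : PMF Γ) (n : ℕ) (f : Γ → ℝ≥0∞) :
    ∑' g, convPow μ n g * f g = iterSum μ n f := by
  induction n generalizing f with
  | zero =>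
    rw [convPow, tsum_eq_single 1]
    · simp [iterSum]
    · intro g hg; simp [hg]
  | succ n ih =>
    rw [convPow, tsum_bind_map_mul, ih, iterSum_add_right]
    simp [iterSum]

theorem tsum_convPow_add (μ : PMF Γ) (n m : ℕ) (f : Γ → ℝ≥0∞) :
    ∑' g, convPow μ (n + m) g * f g =
      ∑' g, convPow μ n g * ∑' h, convPow μ m h * f (g * h) := by
  simp only [tsum_convPow, iterSum_add_right]

theorem exists_convPow_ne_zero {μ : PMF Γ} (hgen : IsGenerating μ) (g : Γ) :
    ∃ n, convPow μ n g ≠ 0 := by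
  classical
  have hg : g ∈ Subsemigroup.closure μ.support := by rw [hgen]; trivial
  have hpos : ∀ n x, convPow μ n x ≠ 0 ↔
      ∑' g, convPow μ n g * (if g = x then 1 else 0) ≠ 0 := by simp
  induction hg using Subsemigroup.closure_induction with
  | mem x hx =>
    refine ⟨1, ?_⟩
    rw [hpos, tsum_convPow]
    simpa [iterSum] using hx
  | mul x y _ _ hx hy =>
    obtain ⟨n, hn⟩ := hx
    obtain ⟨m, hm⟩ := hy
    refine ⟨n + m, ?_⟩
    rw [hpos, tsum_convPow_add]
    refine ((pos_iff_ne_zero.2 (mul_ne_zero hn hm)).trans_le ?_).ne'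
    refine le_trans ?_ (ENNReal.le_tsum x)
    refine mul_le_mul_right ?_ _
    refine le_trans ?_ (ENNReal.le_tsum y)
    simp

end IterSum

/-! ### Exponentials of the distance and their contraction by a Schottky family -/

section Contraction

variable {X : Type*} [MetricSpace X] {Γ : Type*} [Group Γ] [MulAction Γ X] [IsIsometricSMul Γ X]

/-- `exp (κ d(o, z))` in `[0, ∞]`. -/
noncomputable def expDist (κ : ℝ) (o z : X) : ℝ≥0∞ := ENNReal.ofReal (Real.exp (κ * dist o z))

theorem expDist_ne_top (κ : ℝ) (o z : X) : expDist κ o z ≠ ⊤ := ENNReal.ofReal_ne_top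

theorem expDist_self (κ : ℝ) (o : X) : expDist κ o o = 1 := by simp [expDist]

theorem expDist_mono {κ κ' : ℝ} (h : κ ≤ κ') (o z : X) : expDist κ o z ≤ expDist κ' o z :=
  ENNReal.ofReal_le_ofReal (Real.exp_le_exp.2 (mul_le_mul_of_nonneg_right h dist_nonneg))

theorem expDist_mul_smul_le {κ : ℝ} (hκ : 0 ≤ κ) (o : X) (g h : Γ) :
    expDist κ o ((g * h) • o) ≤ expDist κ o (g • o) * expDist κ o (h • o) := by
  rw [expDist, expDist, expDist, ← ENNReal.ofReal_mul (Real.exp_pos _).le, ← Real.exp_add,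
    ← mul_add]
  refine ENNReal.ofReal_le_ofReal (Real.exp_le_exp.2 (mul_le_mul_of_nonneg_left ?_ hκ))
  have := dist_triangle o (g • o) (g • h • o)
  rwa [dist_smul, ← mul_smul] at this

/-- The triangle inequality in Harnack form: it compares the Lyapunov function with exp(-κ d(o, ·))
once the Green function has an exponential moment. -/
theorem expDist_neg_inv_smul_le {κ : ℝ} (hκ : 0 ≤ κ) (o z : X) (g : Γ) :
    expDist (-κ) o (g⁻¹ • z) ≤ expDist κ o (g • o) * expDist (-κ) o z := by
  rw [expDist, expDist, expDist, ← ENNReal.ofReal_mul (Real.exp_pos _).le, ← Real.exp_add]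
  refine ENNReal.ofReal_le_ofReal (Real.exp_le_exp.2 ?_)
  have h1 := dist_triangle o (g • o) z
  rw [← dist_smul g o (g⁻¹ • z), smul_inv_smul]
  nlinarith

/-- Interpolation of exponential moments. -/
theorem expDist_le_one_add {κ κ' : ℝ} (h0 : 0 ≤ κ) (hκ' : 0 < κ') (h : κ ≤ κ') (o z : X) :
    expDist κ o z ≤ 1 + ENNReal.ofReal (κ / κ') * expDist κ' o z := by
  have ht : κ / κ' ≤ 1 := (div_le_one hκ').2 h
  have ht0 : 0 ≤ κ / κ' := by positivity
  have h1 := convexOn_exp.2 (mem_univ 0) (mem_univ (κ' * dist o z)) (sub_nonneg.2 ht) ht0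
    (by ring)
  simp only [smul_eq_mul, mul_zero, zero_add, Real.exp_zero, mul_one] at h1
  rw [← mul_assoc, div_mul_cancel₀ _ hκ'.ne'] at h1
  rw [expDist, expDist, ← ENNReal.ofReal_mul ht0, ← ENNReal.ofReal_one,
    ← ENNReal.ofReal_add zero_le_one (by positivity)]
  exact ENNReal.ofReal_le_ofReal (h1.trans (by linarith))

theorem exp_neg_le_quadratic {y : ℝ} (hy : 0 ≤ y) : Real.exp (-y) ≤ 1 - y + y ^ 2 := by
  rcases le_total y 1 with h | h
  · have := Real.abs_exp_sub_one_sub_id_le (x := -y) (by rwa [abs_neg, abs_of_nonneg hy])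
    rw [neg_sq] at this
    linarith [le_abs_self (Real.exp (-y) - 1 - -y)]
  · have : Real.exp (-y) ≤ 1 := Real.exp_le_one_iff.2 (by linarith)
    nlinarith

theorem exp_le_quadratic {y : ℝ} (hy : 0 ≤ y) : Real.exp y ≤ 1 + y + y ^ 2 * Real.exp y := by
  have h1 := exp_neg_le_quadratic hy
  have h2 := Real.exp_pos y
  have h3 : Real.exp (-y) * Real.exp y = 1 := by rw [← Real.exp_add]; simp
  have h4 := mul_le_mul_of_nonneg_right (Real.one_sub_le_exp_neg y) h2.le
  have h5 : 1 + y ≤ Real.exp y := by linarith [Real.add_one_le_exp y]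
  rcases le_total y 1 with h | h
  · have := Real.abs_exp_sub_one_sub_id_le (x := y) (by rwa [abs_of_nonneg hy])
    have h6 := le_abs_self (Real.exp y - 1 - y)
    have h7 : y ^ 2 * 1 ≤ y ^ 2 * Real.exp y :=
      mul_le_mul_of_nonneg_left (by linarith) (sq_nonneg y)
    linarith
  · have h7 : 1 * Real.exp y ≤ y ^ 2 * Real.exp y :=
      mul_le_mul_of_nonneg_right (by nlinarith) h2.le
    linarith

/-- A long Schottky family contracts `exp (-κ d(o, ·))` on average. -/
theorem IsCATNegOne.sum_exp_schottky_le (hX : IsCATNegOne X) {o : X} {s : Fin 16 → Γ} {C L κ κ₁ : ℝ}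
    (hC : 0 ≤ C) (hL : 4 * (4 * C + 16) ≤ L)
    (hsL : ∀ i, L ≤ dist o (s i • o) ∧ dist o (s i • o) ≤ 2 * L)
    (hs : ∀ i j, i ≠ j → gromovProd o (s i • o) (s j • o) ≤ C ∧
        gromovProd o ((s i)⁻¹ • o) ((s j)⁻¹ • o) ≤ C)
    (hκ : 0 < κ) (hκ₁ : 4 * κ ≤ κ₁) (x z : X) :
    ∑ i, Real.exp (-κ * dist (s i • x) z) ≤ 16 * (Real.exp (-κ * dist o z) *
      ((1 - κ * L / 4) + κ ^ 2 * (16 / κ₁ ^ 2 * Real.exp (κ₁ * L)) * Real.exp (κ₁ * dist o x))) := by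
  obtain ⟨B, hB, hgood⟩ := hX.exists_finset_forall_notMem
    (fun i => by linarith [(hsL i).1]) hs x z
  set K := 4 * C + 16
  set T := L + dist o x with hT
  have hTL : L ≤ T := le_add_of_nonneg_right dist_nonneg
  have hK : 0 ≤ K := by positivity
  have hT0 : 0 ≤ T := by linarith
  have e0 := Real.exp_pos (-κ * dist o z)
  -- A good element gains T - K in distance, and one of the at most 2 bad ones loses at most 2T. To
  -- first order in κ the sum of the 16 terms changes by -14 (T - K) + 4T ≤ -4L, because K ≤ L / 4 ≤
  -- T / 4.
  have step1 : ∀ i, Real.exp (-κ * dist (s i • x) z) ≤ Real.exp (-κ * dist o z) *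
      if i ∈ B then Real.exp (2 * κ * T) else Real.exp (-(κ * (T - K))) := by
    intro i
    split_ifs with hi
    · rw [← Real.exp_add]
      refine Real.exp_le_exp.2 ?_
      have h1 := dist_triangle4 o (s i • o) (s i • x) z
      rw [dist_smul] at h1
      have h2 : dist o z ≤ 2 * T + dist (s i • x) z := by
        have := (hsL i).2; have := dist_nonneg (x := o) (y := x); linarith
      nlinarith
    · rw [← Real.exp_add]
      refine Real.exp_le_exp.2 ?_
      have h1 := hgood i hi
      have h2 : dist o z + (T - K) ≤ dist (s i • x) z := by have := (hsL i).1; linarith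
      nlinarith
  have step2 : ∑ i : Fin 16, (if i ∈ B then Real.exp (2 * κ * T) else Real.exp (-(κ * (T - K)))) ≤
      2 * Real.exp (2 * κ * T) + 14 * Real.exp (-(κ * (T - K))) := by
    have hle : Real.exp (-(κ * (T - K))) ≤ Real.exp (2 * κ * T) := Real.exp_le_exp.2 (by
      have : 0 ≤ κ * (T - K) := mul_nonneg hκ.le (by linarith)
      have : 0 ≤ κ * T := mul_nonneg hκ.le hT0
      linarith)
    have hrw : ∀ i : Fin 16, (if i ∈ B then Real.exp (2 * κ * T) else Real.exp (-(κ * (T - K)))) =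
        Real.exp (-(κ * (T - K))) +
          if i ∈ B then Real.exp (2 * κ * T) - Real.exp (-(κ * (T - K))) else 0 := by
      intro i; split_ifs <;> ring
    simp only [hrw, Finset.sum_add_distrib, Finset.sum_ite_mem, Finset.univ_inter,
      Finset.sum_const, Finset.card_univ, Fintype.card_fin, nsmul_eq_mul]
    have hB' : (B.card : ℝ) ≤ 2 := by exact_mod_cast hB
    push_cast
    nlinarith
  have hy1 : 0 ≤ 2 * κ * T := by positivity
  have hy2 : 0 ≤ κ * (T - K) := mul_nonneg hκ.le (by linarith)
  have q1 := exp_le_quadratic hy1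
  have q2 := exp_neg_le_quadratic hy2
  -- The second-order error is absorbed into exp(κ₁ d(o, x)), at a rate κ₁ that does not depend on
  -- κ.
  have q3 : T ^ 2 * Real.exp (2 * κ * T) ≤
      8 / κ₁ ^ 2 * Real.exp (κ₁ * L) * Real.exp (κ₁ * dist o x) := by
    have hk : 0 < κ₁ := by linarith
    have r1 : T ^ 2 ≤ 8 / κ₁ ^ 2 * Real.exp (κ₁ * T / 2) := by
      have := Real.quadratic_le_exp_of_nonneg (x := κ₁ * T / 2) (by positivity)
      have h0 : 0 ≤ κ₁ * T := by positivity
      rw [div_mul_eq_mul_div, le_div_iff₀ (by positivity)]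
      nlinarith
    have r2 : Real.exp (2 * κ * T) ≤ Real.exp (κ₁ * T / 2) := Real.exp_le_exp.2 (by nlinarith)
    calc T ^ 2 * Real.exp (2 * κ * T)
        ≤ 8 / κ₁ ^ 2 * Real.exp (κ₁ * T / 2) * Real.exp (κ₁ * T / 2) :=
          mul_le_mul r1 r2 (Real.exp_pos _).le (by positivity)
      _ = _ := by
          rw [mul_assoc, mul_assoc, ← Real.exp_add, ← Real.exp_add, hT]; congr 2; ring
  have q4 : (κ * (T - K)) ^ 2 ≤ κ ^ 2 * (T ^ 2 * Real.exp (2 * κ * T)) := by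
    rw [mul_pow]
    refine mul_le_mul_of_nonneg_left ?_ (sq_nonneg _)
    have : (T - K) ^ 2 ≤ T ^ 2 := by nlinarith
    refine this.trans (le_mul_of_one_le_right (sq_nonneg _) (Real.one_le_exp hy1))
  have q5 : 2 * Real.exp (2 * κ * T) + 14 * Real.exp (-(κ * (T - K))) ≤
      16 * ((1 - κ * L / 4) + 2 * κ ^ 2 * (T ^ 2 * Real.exp (2 * κ * T))) := by
    have : 0 ≤ κ * (T - L) := mul_nonneg hκ.le (by linarith)
    have : 0 ≤ κ * (L - 4 * K) := mul_nonneg hκ.le (by linarith)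
    have : 0 ≤ κ ^ 2 * (T ^ 2 * Real.exp (2 * κ * T)) := by positivity
    have h2 : (2 * κ * T) ^ 2 * Real.exp (2 * κ * T) =
      4 * (κ ^ 2 * (T ^ 2 * Real.exp (2 * κ * T))) := by ring
    rw [h2] at q1
    nlinarith
  calc ∑ i, Real.exp (-κ * dist (s i • x) z)
      ≤ ∑ i, Real.exp (-κ * dist o z) *
        (if i ∈ B then Real.exp (2 * κ * T) else Real.exp (-(κ * (T - K)))) :=
        Finset.sum_le_sum fun i _ => step1 i
    _ ≤ Real.exp (-κ * dist o z) *
        (16 * ((1 - κ * L / 4) + 2 * κ ^ 2 * (T ^ 2 * Real.exp (2 * κ * T)))) := by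
        rw [← Finset.mul_sum]; exact mul_le_mul_of_nonneg_left (step2.trans q5) e0.le
    _ ≤ _ := by
        rw [mul_left_comm]
        refine mul_le_mul_of_nonneg_left (mul_le_mul_of_nonneg_left ?_ e0.le) (by norm_num)
        have := mul_le_mul_of_nonneg_left q3 (by positivity : 0 ≤ 2 * κ ^ 2)
        linear_combination this

end Contraction

/-! ### A Lyapunov function for a probability of full support -/

section Contraction

variable {X : Type*} [MetricSpace X] {Γ : Type*} [Group Γ] [MulAction Γ X] [IsIsometricSMul Γ X]

theorem exists_pos_ofReal_div_mul_le {K ε : ℝ≥0∞} (hK : K ≠ ⊤) (hε : ε ≠ 0) {a : ℝ} (ha : 0 < a) :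
    ∃ κ, 0 < κ ∧ κ ≤ a ∧ ENNReal.ofReal (κ / a) * K ≤ ε := by
  rcases eq_or_ne ε ⊤ with rfl | hε'
  · exact ⟨a, ha, le_rfl, le_top⟩
  have hε0 : 0 < ε.toReal := ENNReal.toReal_pos hε hε'
  have hK0 : 0 ≤ K.toReal := ENNReal.toReal_nonneg
  refine ⟨a * (ε.toReal / (ε.toReal + K.toReal)), by positivity, ?_, ?_⟩
  · exact mul_le_of_le_one_right ha.le (div_le_one_of_le₀ (by linarith) (by positivity))
  · rw [mul_div_right_comm, div_self ha.ne', one_mul, ← ENNReal.ofReal_toReal hK,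
      ← ENNReal.ofReal_mul (by positivity), ← ENNReal.ofReal_toReal hε',
      ENNReal.toReal_ofReal hε0.le, ENNReal.toReal_ofReal hK0]
    refine ENNReal.ofReal_le_ofReal ?_
    rw [div_mul_eq_mul_div, div_le_iff₀ (by positivity)]
    nlinarith

/-- The averaging operator of a probability that charges every group element has a Lyapunov
function comparable to `exp (-κ d(o, ·))`. -/
theorem exists_lyapunov_of_forall_ne_zero [ProperSpace X] (hX : IsCATNegOne X)
    (hΓ : IsNonelementary Γ X) (o : X) (m : Γ → ℝ≥0∞) (hm : ∑' g, m g = 1) (hpos : ∀ g, m g ≠ 0)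
    {κ₂ : ℝ} (hκ₂ : 0 < κ₂) (hexp : ∑' g, m g * expDist κ₂ o (g • o) ≠ ⊤) :
    ∃ κ, 0 < κ ∧ κ ≤ κ₂ ∧ ∃ r < (1 : ℝ≥0∞), ∃ C : ℝ≥0∞, C ≠ ⊤ ∧ ∃ θ : X → ℝ≥0∞,
      (∀ z, expDist (-κ) o z ≤ θ z ∧ θ z ≤ C * expDist (-κ) o z) ∧
      ∀ z, ∑' g, m g * θ (g⁻¹ • z) ≤ r * θ z := by
  classical
  obtain ⟨C₀, hS⟩ := exists_schottky hX hΓ o 16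
  set C := max C₀ 0 with hCdef
  obtain ⟨L, hL, s, hsL, hs'⟩ := hS (4 * (4 * C + 16))
  have hC : 0 ≤ C := le_max_right _ _
  have hs : ∀ i j, i ≠ j → gromovProd o (s i • o) (s j • o) ≤ C ∧
        gromovProd o ((s i)⁻¹ • o) ((s j)⁻¹ • o) ≤ C := fun i j h =>
    ⟨(hs' i j h).1.trans (le_max_left _ _), (hs' i j h).2.trans (le_max_left _ _)⟩
  have hL0 : 0 < L := by linarith
  -- the mass of the Schottky part
  obtain ⟨α, hα0, hαm⟩ : ∃ α : ℝ≥0∞, α ≠ 0 ∧ ∀ i, α ≤ m (s i) := by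
    refine ⟨Finset.univ.inf' Finset.univ_nonempty fun i => m (s i), ?_, fun i =>
      Finset.inf'_le _ (Finset.mem_univ i)⟩
    obtain ⟨i, -, hi⟩ := Finset.exists_mem_eq_inf' Finset.univ_nonempty fun i => m (s i)
    rw [hi]; exact hpos _
  have hα1 : α ≤ 1 := (hαm 0).trans (hm ▸ ENNReal.le_tsum (s 0))
  have hαt : α ≠ ⊤ := ne_top_of_le_ne_top ENNReal.one_ne_top hα1
  -- The mass α spread evenly over the Schottky family; `T` is the rest of `m`.
  let A : Γ → ℝ≥0∞ := fun g => ∑ i, α / 16 * if s i = g then 1 else 0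
  have hAm : ∀ g, A g ≤ m g := by
    intro g
    by_cases hg : ∃ i, s i = g
    · obtain ⟨j, rfl⟩ := hg
      calc A (s j) ≤ ∑ i : Fin 16, α / 16 := Finset.sum_le_sum fun i _ => by
              refine mul_le_of_le_one_right zero_le ?_
              split_ifs <;> simp
        _ = α := by
              rw [Finset.sum_const, Finset.card_univ, Fintype.card_fin, nsmul_eq_mul]
              exact ENNReal.mul_div_cancel (by norm_num) (by norm_num)
        _ ≤ m (s j) := hαm j
    · push Not at hg
      simp [A, hg]
  have hAsum : ∀ f : Γ → ℝ≥0∞, ∑' g, A g * f g = α / 16 * ∑ i, f (s i) := by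
    intro f
    simp only [A, Finset.sum_mul, Finset.mul_sum, mul_assoc]
    rw [Summable.tsum_finsetSum fun _ _ => ENNReal.summable]
    refine Finset.sum_congr rfl fun i _ => ?_
    rw [ENNReal.tsum_mul_left, tsum_eq_single (s i)]
    · simp
    · intro g hg; simp [hg.symm]
  let T : Γ → ℝ≥0∞ := fun g => m g - A g
  have hAT : ∀ g, A g + T g = m g := fun g => add_tsub_cancel_of_le (hAm g)
  have hTm : ∀ g, T g ≤ m g := fun g => tsub_le_self
  have hA1 : ∑' g, A g = α := by
    have := hAsum fun _ => 1
    simp only [mul_one, Finset.sum_const, Finset.card_univ, Fintype.card_fin, nsmul_eq_mul] at this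
    rw [this]
    exact ENNReal.div_mul_cancel (by norm_num) (by norm_num)
  have hT1 : α + ∑' g, T g = 1 := by
    rw [← hA1, ← ENNReal.tsum_add, ← hm]; exact tsum_congr hAT
  have hTt : ∑' g, T g ≠ ⊤ := by
    intro h; rw [h] at hT1; simp at hT1
  have hT1' : 1 - ∑' g, T g = α := by
    rw [← hT1]; exact ENNReal.add_sub_cancel_right hTt
  -- the exponential moment of the Green function of the rest
  obtain ⟨κ₁, hκ₁0, hκ₁, hκ₁K⟩ := exists_pos_ofReal_div_mul_le hexp
    (ENNReal.half_pos hα0).ne' hκ₂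
  have hβ : ∑' g, T g * expDist κ₁ o (g • o) + α / 2 ≤ 1 := by
    calc ∑' g, T g * expDist κ₁ o (g • o) + α / 2
        ≤ (∑' g, T g + ENNReal.ofReal (κ₁ / κ₂) * ∑' g, m g * expDist κ₂ o (g • o)) + α / 2 := by
          refine add_le_add_left ?_ _
          rw [← ENNReal.tsum_mul_left, ← ENNReal.tsum_add]
          refine ENNReal.tsum_le_tsum fun g => ?_
          refine (mul_le_mul_right (expDist_le_one_add hκ₁0.le hκ₂ hκ₁ o (g • o)) _).trans ?_
          rw [mul_add, mul_one, mul_left_comm]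
          exact add_le_add_right (mul_le_mul_right (mul_le_mul_left (hTm g) _) _) _
      _ ≤ (∑' g, T g + α / 2) + α / 2 := by gcongr
      _ = 1 := by rw [add_assoc, ENNReal.add_halves, add_comm, hT1]
  have hE : greenSum T (fun w => expDist κ₁ o (w • o)) ≤ (α / 2)⁻¹ := by
    refine (greenSum_le (by simp [expDist_self]) fun g h =>
      expDist_mul_smul_le hκ₁0.le o g h).trans ?_
    refine ENNReal.inv_le_inv.2 (ENNReal.le_sub_of_add_le_left ?_ hβ)
    exact ne_top_of_le_ne_top ENNReal.one_ne_top ((self_le_add_right _ _).trans hβ)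
  -- the exponent
  set K := 16 / κ₁ ^ 2 * Real.exp (κ₁ * L) with hK
  have hK0 : 0 < K := by positivity
  obtain ⟨κ, hκ0, hκa, hκb, hκc⟩ : ∃ κ, 0 < κ ∧ 4 * κ ≤ κ₁ ∧ κ * L / 4 ≤ 1 ∧
      2 * (κ ^ 2 * K) ≤ κ * L / 8 := by
    refine ⟨min (κ₁ / 4) (min (4 / L) (L / (16 * K))), by positivity, ?_, ?_, ?_⟩
    · have := min_le_left (κ₁ / 4) (min (4 / L) (L / (16 * K))); linarith
    · have := (min_le_right (κ₁ / 4) (min (4 / L) (L / (16 * K)))).trans (min_le_left _ _)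
      rw [le_div_iff₀ hL0] at this; linarith
    · have := (min_le_right (κ₁ / 4) (min (4 / L) (L / (16 * K)))).trans (min_le_right _ _)
      have h0 : 0 < min (κ₁ / 4) (min (4 / L) (L / (16 * K))) := by positivity
      rw [le_div_iff₀ (by positivity)] at this
      nlinarith
  let φ : X → ℝ≥0∞ := expDist (-κ) o
  -- The potential of φ for the part `T`, so that θ = φ + Tθ. Hence mθ = Aθ + θ - φ, and an estimate
  -- Aθ ≤ (1 - c) φ is enough: it yields mθ ≤ θ - cφ, where φ is at least a constant multiple of θ.
  let θ : X → ℝ≥0∞ := fun z => greenSum T fun w => φ (w⁻¹ • z)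
  have hκ₁' : κ ≤ κ₁ := by linarith
  have hθrec : ∀ z, θ z = φ z + ∑' g, T g * θ (g⁻¹ • z) := by
    intro z
    simp only [θ]
    rw [greenSum_eq_add]
    simp only [inv_one, one_smul, mul_inv_rev, mul_smul]
  have hθle : ∀ z, θ z ≤ (α / 2)⁻¹ * φ z := by
    intro z
    calc θ z ≤ greenSum T fun w => φ z * expDist κ₁ o (w • o) := by
          refine greenSum_mono fun w => ?_
          rw [mul_comm]
          exact (expDist_neg_inv_smul_le hκ0.le o z w).trans
            (mul_le_mul_left (expDist_mono hκ₁' _ _) _)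
      _ ≤ (α / 2)⁻¹ * φ z := by
          rw [greenSum_mul_left, mul_comm]; exact mul_le_mul_left hE _
  -- `A` puts a Schottky element in front of a word w weighted by the Green function of `T`, and the
  -- Schottky estimate applies with x = wo. The Green function has total mass exactly 1 / α, which
  -- cancels the mass of `A`, and exponential moment at most 2 / α. So the gain κL / 4 survives the
  -- error 2κ²K ≤ κL / 8.
  have hAθ : ∀ z, ∑' g, A g * θ (g⁻¹ • z) ≤ ENNReal.ofReal (1 - κ * L / 8) * φ z := by
    intro z
    rw [hAsum fun g => θ (g⁻¹ • z)]
    simp only [θ]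
    rw [← greenSum_finset_sum]
    have hb : ∀ w : Γ, ∑ i, φ (w⁻¹ • (s i)⁻¹ • z) ≤ 16 * φ z * (ENNReal.ofReal (1 - κ * L / 4) * 1 +
        ENNReal.ofReal (κ ^ 2 * K) * expDist κ₁ o (w • o)) := by
      intro w
      have h0 : 0 ≤ 1 - κ * L / 4 := by linarith
      have h1 := hX.sum_exp_schottky_le hC hL hsL hs hκ0 hκa (w • o) z
      have h2 : ∀ i, φ (w⁻¹ • (s i)⁻¹ • z) =
          ENNReal.ofReal (Real.exp (-κ * dist (s i • w • o) z)) := by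
        intro i
        simp only [φ, expDist]
        rw [← dist_smul w o, smul_inv_smul, ← dist_smul (s i) (w • o), smul_inv_smul]
      simp only [h2]
      rw [← ENNReal.ofReal_sum_of_nonneg fun _ _ => (Real.exp_pos _).le]
      refine (ENNReal.ofReal_le_ofReal h1).trans_eq ?_
      simp only [φ, expDist]
      rw [ENNReal.ofReal_mul (by norm_num), ENNReal.ofReal_mul (Real.exp_pos _).le,
        ENNReal.ofReal_add h0 (by positivity), ENNReal.ofReal_mul (by positivity : 0 ≤ κ ^ 2 * K),
        ← mul_assoc, mul_one]
      norm_num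
    refine (mul_le_mul_right (greenSum_mono hb) _).trans ?_
    rw [greenSum_mul_left, greenSum_add, greenSum_mul_left, greenSum_mul_left, greenSum_one, hT1']
    have hfin : α / 16 * (16 * φ z * (ENNReal.ofReal (1 - κ * L / 4) * α⁻¹ +
        ENNReal.ofReal (κ ^ 2 * K) * (α / 2)⁻¹)) = ENNReal.ofReal (1 - κ * L / 4 + 2 * (κ ^ 2 * K)) *
          φ z := by
      rw [ENNReal.ofReal_add (by linarith) (by positivity),
        ENNReal.ofReal_mul (p := 2) (by norm_num),
        ENNReal.inv_div (by norm_num) (by norm_num), ENNReal.div_eq_inv_mul,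
        ENNReal.div_eq_inv_mul, ENNReal.ofReal_ofNat]
      have h16 : (16 : ℝ≥0∞)⁻¹ * 16 = 1 := ENNReal.inv_mul_cancel (by norm_num) (by norm_num)
      have ha : α⁻¹ * α = 1 := ENNReal.inv_mul_cancel hα0 hαt
      calc _ = ((16 : ℝ≥0∞)⁻¹ * 16) * (α⁻¹ * α) * ((ENNReal.ofReal (1 - κ * L / 4) +
            2 * ENNReal.ofReal (κ ^ 2 * K)) * φ z) := by ring
        _ = _ := by rw [h16, ha, one_mul, one_mul]
    calc _ ≤ α / 16 * (16 * φ z * (ENNReal.ofReal (1 - κ * L / 4) * α⁻¹ +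
          ENNReal.ofReal (κ ^ 2 * K) * (α / 2)⁻¹)) := by gcongr
      _ ≤ _ := by
          rw [hfin]
          exact mul_le_mul_left (ENNReal.ofReal_le_ofReal (by linarith)) _
  -- the inequality for the full weights
  set c := ENNReal.ofReal (κ * L / 8) with hc
  have hc0 : c ≠ 0 := (ENNReal.ofReal_pos.2 (by positivity)).ne'
  have hcc : ∀ z, ENNReal.ofReal (1 - κ * L / 8) * φ z + c * φ z = φ z := by
    intro z
    rw [← add_mul, hc, ← ENNReal.ofReal_add (by linarith) (by positivity)]
    simp
  have hmain : ∀ z, ∑' g, m g * θ (g⁻¹ • z) + c * φ z ≤ θ z := by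
    intro z
    have : ∑' g, m g * θ (g⁻¹ • z) = ∑' g, A g * θ (g⁻¹ • z) + ∑' g, T g * θ (g⁻¹ • z) := by
      rw [← ENNReal.tsum_add]; exact tsum_congr fun g => by rw [← hAT, add_mul]
    rw [this, hθrec z, add_right_comm]
    refine add_le_add_left ?_ _
    calc _ ≤ ENNReal.ofReal (1 - κ * L / 8) * φ z + c * φ z := by gcongr; exact hAθ z
      _ = φ z := hcc z
  have hct : c * (α / 2) ≠ ⊤ :=
    ENNReal.mul_ne_top ENNReal.ofReal_ne_top (ENNReal.div_ne_top hαt (by norm_num))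
  refine ⟨κ, hκ0, hκ₁'.trans hκ₁, 1 - c * (α / 2), ?_, (α / 2)⁻¹,
    ENNReal.inv_ne_top.2 (ENNReal.half_pos hα0).ne', θ, fun z => ⟨?_, hθle z⟩, fun z => ?_⟩
  · exact ENNReal.sub_lt_self ENNReal.one_ne_top one_ne_zero
      (mul_ne_zero hc0 (ENNReal.half_pos hα0).ne')
  · rw [hθrec z]; exact self_le_add_right _ _
  · have hθt : θ z ≠ ⊤ := ne_top_of_le_ne_top (ENNReal.mul_ne_top
      (ENNReal.inv_ne_top.2 (ENNReal.half_pos hα0).ne') (expDist_ne_top _ _ _)) (hθle z)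
    rw [ENNReal.sub_mul fun _ _ => hθt, one_mul]
    refine ENNReal.le_sub_of_add_le_right (ENNReal.mul_ne_top hct hθt) ?_
    refine le_trans (add_le_add_right ?_ _) (hmain z)
    rw [mul_assoc]
    refine mul_le_mul_right ?_ _
    calc α / 2 * θ z ≤ α / 2 * ((α / 2)⁻¹ * φ z) := mul_le_mul_right (hθle z) _
      _ = φ z := by
        rw [← mul_assoc, ENNReal.mul_inv_cancel (ENNReal.half_pos hα0).ne'
          (ENNReal.div_ne_top hαt (by norm_num)), one_mul]

end Contraction

/-! ### Decay along the walk and exponential moments of Gromov products -/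

section Decay

variable {X : Type*} [MetricSpace X] {Γ : Type*} [Group Γ] [MulAction Γ X]

theorem HasExponentialMoment.exists_expDist {μ : PMF Γ} {o : X} (hμ : HasExponentialMoment μ o) :
    ∃ κ, 0 < κ ∧ ∑' g, μ g * expDist κ o (g • o) ≠ ⊤ := by
  obtain ⟨c, hc, hs⟩ := hμ
  refine ⟨Real.log c, Real.log_pos hc, ?_⟩
  have h := hs.tsum_ofReal_ne_top
  have he : ∀ g : Γ, ENNReal.ofReal (c ^ dist o (g • o) * (μ g).toReal) =
      μ g * expDist (Real.log c) o (g • o) := by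
    intro g
    rw [ENNReal.ofReal_mul (by positivity), ENNReal.ofReal_toReal (μ.apply_ne_top g), mul_comm,
      expDist, Real.rpow_def_of_pos (by linarith)]
  simpa only [he] using h

variable [IsIsometricSMul Γ X]

theorem exists_contraction [ProperSpace X] (hX : IsCATNegOne X) (hΓ : IsNonelementary Γ X) (o : X)
    {μ : PMF Γ} (hgen : IsGenerating μ) (hμ : HasExponentialMoment μ o) :
    ∃ κ, 0 < κ ∧ ∑' g, μ g * expDist κ o (g • o) ≠ ⊤ ∧ ∃ r < (1 : ℝ≥0∞), ∃ C : ℝ≥0∞, C ≠ ⊤ ∧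
      ∀ n z, iterSum μ n (fun g => expDist (-κ) o (g⁻¹ • z)) ≤ C * r ^ n * expDist (-κ) o z := by
  obtain ⟨κ₀, hκ₀, hμ₀⟩ := hμ.exists_expDist
  obtain ⟨κ₂, hκ₂, hκ₂₀, hκK⟩ := exists_pos_ofReal_div_mul_le hμ₀
    (ε := 2⁻¹) (by simp) hκ₀
  have hμ₂ : ∑' g, μ g * expDist κ₂ o (g • o) ≤ 1 + 2⁻¹ := by
    calc ∑' g, μ g * expDist κ₂ o (g • o)
        ≤ ∑' g, (μ g + ENNReal.ofReal (κ₂ / κ₀) * (μ g * expDist κ₀ o (g • o))) := by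
          refine ENNReal.tsum_le_tsum fun g => ?_
          refine (mul_le_mul_right (expDist_le_one_add hκ₂.le hκ₀ hκ₂₀ o (g • o)) _).trans_eq ?_
          ring
      _ ≤ _ := by
          rw [ENNReal.tsum_add, ENNReal.tsum_mul_left, μ.tsum_coe]
          exact add_le_add_right hκK _
  -- μ need not charge every element, but this mixture of its powers does, as the support generates.
  -- Its exponential moment is finite because κ₂ makes that of μ at most 3/2, and half of 3/2 is
  -- less than 1.
  let m : Γ → ℝ≥0∞ := fun g => ∑' n : ℕ, 2⁻¹ ^ (n + 1) * convPow μ n g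
  have hmf : ∀ f : Γ → ℝ≥0∞, ∑' g, m g * f g = ∑' n : ℕ, 2⁻¹ ^ (n + 1) * iterSum μ n f := by
    intro f
    simp only [m, ← ENNReal.tsum_mul_right]
    rw [ENNReal.tsum_comm]
    refine tsum_congr fun n => ?_
    simp only [mul_assoc, ENNReal.tsum_mul_left, tsum_convPow]
  have hm : ∑' g, m g = 1 := by
    have := hmf fun _ => 1
    simp only [mul_one, iterSum_one, μ.tsum_coe, one_pow] at this
    rw [this, ENNReal.tsum_geometric_add_one, ENNReal.one_sub_inv_two, inv_inv]
    exact ENNReal.inv_mul_cancel (by norm_num) (by norm_num)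
  have hpos : ∀ g, m g ≠ 0 := by
    intro g
    obtain ⟨n, hn⟩ := exists_convPow_ne_zero hgen g
    refine (lt_of_lt_of_le (pos_iff_ne_zero.2 (mul_ne_zero ?_ hn)) (ENNReal.le_tsum n)).ne'
    exact pow_ne_zero _ (by simp)
  have hexp : ∑' g, m g * expDist κ₂ o (g • o) ≠ ⊤ := by
    rw [hmf]
    have h34 : (2⁻¹ : ℝ≥0∞) * (1 + 2⁻¹) < 1 := by
      rw [mul_add, mul_one]
      calc (2⁻¹ : ℝ≥0∞) + 2⁻¹ * 2⁻¹ < 2⁻¹ + 2⁻¹ := by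
            refine ENNReal.add_lt_add_left (by simp) ?_
            calc (2⁻¹ : ℝ≥0∞) * 2⁻¹ < 2⁻¹ * 1 :=
                  ENNReal.mul_lt_mul_right (by simp) (by simp) (by simp)
              _ = 2⁻¹ := mul_one _
        _ = 1 := ENNReal.inv_two_add_inv_two
    refine ne_top_of_le_ne_top (b := ∑' n : ℕ, (2⁻¹ * (1 + 2⁻¹)) ^ n) ?_ ?_
    · rw [ENNReal.tsum_geometric]
      exact ENNReal.inv_ne_top.2 (tsub_pos_of_lt h34).ne'
    · refine ENNReal.tsum_le_tsum fun n => ?_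
      rw [mul_pow]
      refine mul_le_mul' ?_ ?_
      · rw [pow_succ]; exact mul_le_of_le_one_right zero_le (by simp)
      · exact (iterSum_le_pow (by simp [expDist_self])
          (fun g h => expDist_mul_smul_le hκ₂.le o g h) n).trans (pow_le_pow_left₀ zero_le hμ₂ n)
  obtain ⟨κ, hκ, hκκ, r, hr, C, hC, θ, hθ, hmθ⟩ :=
    exists_lyapunov_of_forall_ne_zero hX hΓ o m hm hpos hκ₂ hexp
  let θ' : X → ℝ≥0∞ := fun z => ∑' g, m g * θ (g⁻¹ • z)
  have hθt : ∀ z, θ z ≠ ⊤ := fun z =>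
    ne_top_of_le_ne_top (ENNReal.mul_ne_top hC (expDist_ne_top _ _ _)) (hθ z).2
  have hθ't : ∀ z, θ' z ≠ ⊤ := fun z =>
    ne_top_of_le_ne_top (ENNReal.mul_ne_top (hr.trans ENNReal.one_lt_top).ne (hθt z)) (hmθ z)
  have hrec : ∀ z, θ' z = 2⁻¹ * θ z + 2⁻¹ * ∑' g, μ g * θ' (g⁻¹ • z) := by
    intro z
    simp only [θ']
    rw [hmf, tsum_eq_zero_add' ENNReal.summable]
    congr 1
    · simp [iterSum]
    · simp only [fun z' => hmf fun g => θ (g⁻¹ • z'), iterSum, mul_inv_rev, mul_smul,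
        ← ENNReal.tsum_mul_left]
      rw [ENNReal.tsum_comm]
      refine tsum_congr fun g => tsum_congr fun n => ?_
      rw [pow_succ']; ring
  -- As averaging operators m = (2 - μ)⁻¹, so μθ' = 2θ' - θ with θ' = mθ ≤ rθ. Since r (2 - r) ≤ 1,
  -- it follows that (2 - r) θ' ≤ θ, whence μθ' ≤ rθ'.
  have hstep : ∀ z, ∑' g, μ g * θ' (g⁻¹ • z) ≤ r * θ' z := by
    intro z
    set p := ∑' g, μ g * θ' (g⁻¹ • z) with hp
    have h1 := hrec z
    rw [← hp] at h1
    have hpt : p ≠ ⊤ := by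
      intro h; rw [h] at h1
      exact hθ't z (by rw [h1]; simp)
    have hrt : r ≠ ⊤ := (hr.trans ENNReal.one_lt_top).ne
    have h2 := congrArg ENNReal.toReal h1
    rw [ENNReal.toReal_add (ENNReal.mul_ne_top (by simp) (hθt z))
      (ENNReal.mul_ne_top (by simp) hpt)] at h2
    simp only [ENNReal.toReal_mul, ENNReal.toReal_inv, ENNReal.toReal_ofNat] at h2
    have h3 := ENNReal.toReal_mono (ENNReal.mul_ne_top hrt (hθt z)) (hmθ z)
    rw [ENNReal.toReal_mul] at h3
    change (θ' z).toReal ≤ _ at h3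
    rw [← ENNReal.toReal_le_toReal hpt (ENNReal.mul_ne_top hrt (hθ't z)), ENNReal.toReal_mul]
    have hr1 : r.toReal ≤ 1 := by
      simpa using ENNReal.toReal_mono ENNReal.one_ne_top hr.le
    have hr0 : 0 ≤ r.toReal := ENNReal.toReal_nonneg
    have ht0 : 0 ≤ (θ z).toReal := ENNReal.toReal_nonneg
    nlinarith [mul_nonneg (sq_nonneg (1 - r.toReal)) ht0,
      mul_le_mul_of_nonneg_left h3 (by linarith : 0 ≤ 2 - r.toReal)]
  have hiter : ∀ n z, iterSum μ n (fun g => θ' (g⁻¹ • z)) ≤ r ^ n * θ' z := by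
    intro n
    induction n with
    | zero => intro z; simp [iterSum]
    | succ n ih =>
      intro z
      simp only [iterSum, mul_inv_rev, mul_smul]
      calc ∑' g, μ g * iterSum μ n (fun h => θ' (h⁻¹ • g⁻¹ • z))
          ≤ ∑' g, r ^ n * (μ g * θ' (g⁻¹ • z)) := ENNReal.tsum_le_tsum fun g => by
            rw [mul_left_comm]; exact mul_le_mul_right (ih _) _
        _ ≤ r ^ (n + 1) * θ' z := by
            rw [ENNReal.tsum_mul_left, pow_succ, mul_assoc]
            exact mul_le_mul_right (hstep z) _
  refine ⟨κ, hκ, ?_, r, hr, 2 * C, ENNReal.mul_ne_top (by simp) hC, fun n z => ?_⟩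
  · refine ne_top_of_le_ne_top (b := (1 + 2⁻¹ : ℝ≥0∞)) (by simp) (le_trans ?_ hμ₂)
    exact ENNReal.tsum_le_tsum fun g => mul_le_mul_right (expDist_mono hκκ _ _) _
  · have hφ : ∀ z, expDist (-κ) o z ≤ 2 * θ' z := by
      intro z
      refine (hθ z).1.trans ?_
      rw [hrec z, mul_add, ← mul_assoc, ENNReal.mul_inv_cancel (by simp) (by simp), one_mul]
      exact self_le_add_right _ _
    have hφ' : θ' z ≤ C * expDist (-κ) o z :=
      (hmθ z).trans ((mul_le_of_le_one_left zero_le hr.le).trans (hθ z).2)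
    calc iterSum μ n (fun g => expDist (-κ) o (g⁻¹ • z))
        ≤ iterSum μ n (fun g => 2 * θ' (g⁻¹ • z)) := iterSum_mono (fun g => hφ _) n
      _ ≤ 2 * (r ^ n * θ' z) := by rw [iterSum_mul_left]; exact mul_le_mul_right (hiter n z) _
      _ ≤ 2 * (r ^ n * (C * expDist (-κ) o z)) := by gcongr
      _ = _ := by ring

/-- The product (o | go)_z measures how far the segment [o, go] stays from z. The four-point
inequality splits the segment to ω_n o at an intermediate time: its first part is estimated crudely,
and the second by induction, with z translated and the contraction applied. -/
theorem exists_iterSum_gromovProd_le (hX : IsCATNegOne X) (o : X) {μ : PMF Γ}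
    {κ : ℝ} (hκ : 0 < κ) (hM : ∑' g, μ g * expDist κ o (g • o) ≠ ⊤) {r C : ℝ≥0∞} (hr : r < 1)
    (hC : C ≠ ⊤) (hcontr : ∀ n z, iterSum μ n (fun g => expDist (-κ) o (g⁻¹ • z)) ≤
      C * r ^ n * expDist (-κ) o z) :
    ∃ A : ℝ≥0∞, A ≠ ⊤ ∧ ∀ n z,
      iterSum μ n (fun g => ENNReal.ofReal (Real.exp (-κ * gromovProd z o (g • o)))) ≤
        A * expDist (-κ) o z := by
  set M := ∑' g, μ g * expDist κ o (g • o) with hMdef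
  have hM1 : 1 ≤ M := by
    rw [← μ.tsum_coe]
    refine ENNReal.tsum_le_tsum fun g => le_mul_of_one_le_right zero_le ?_
    rw [expDist, ENNReal.one_le_ofReal]
    exact Real.one_le_exp (mul_nonneg hκ.le dist_nonneg)
  set D := ENNReal.ofReal (Real.exp (2 * κ)) with hD
  have hD1 : 1 ≤ D := ENNReal.one_le_ofReal.2 (Real.one_le_exp (by positivity))
  have hDt : D ≠ ⊤ := ENNReal.ofReal_ne_top
  -- After N + 1 steps the contraction beats the four-point loss `D` by a factor 2, so that A = 2 D
  -- M^(N+1) solves A = D M^(N+1) + A / 2 and the induction closes.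
  obtain ⟨N, hN⟩ : ∃ N, D * (C * r ^ (N + 1)) ≤ 2⁻¹ := by
    have h1 : Tendsto (fun n : ℕ => D * C * r ^ (n + 1)) atTop (𝓝 (D * C * 0)) :=
      ENNReal.Tendsto.const_mul ((ENNReal.tendsto_pow_atTop_nhds_zero_of_lt_one hr).comp
        (tendsto_add_atTop_nat 1)) (Or.inr (ENNReal.mul_ne_top hDt hC))
    rw [mul_zero] at h1
    obtain ⟨N, hN⟩ := (h1.eventually_le_const (u := 2⁻¹) (by simp)).exists
    exact ⟨N, by rwa [← mul_assoc]⟩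
  set A := 2 * (D * M ^ (N + 1)) with hA
  have hAt : A ≠ ⊤ := ENNReal.mul_ne_top (by simp) (ENNReal.mul_ne_top hDt (ENNReal.pow_ne_top hM))
  let J : X → Γ → ℝ≥0∞ := fun z g => ENNReal.ofReal (Real.exp (-κ * gromovProd z o (g • o)))
  have hJ1 : ∀ z g, J z g ≤ expDist κ o (g • o) * expDist (-κ) o z := by
    intro z g
    simp only [J, expDist]
    rw [← ENNReal.ofReal_mul (Real.exp_pos _).le, ← Real.exp_add]
    refine ENNReal.ofReal_le_ofReal (Real.exp_le_exp.2 ?_)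
    have h1 := gromovProd_add o z (g • o)
    have h2 := gromovProd_le_right o z (g • o)
    nlinarith
  have hJn : ∀ n z, iterSum μ n (J z) ≤ M ^ n * expDist (-κ) o z := by
    intro n z
    refine (iterSum_mono (fun g => (hJ1 z g).trans_eq (mul_comm _ _)) n).trans ?_
    rw [iterSum_mul_left, mul_comm]
    exact mul_le_mul_left (iterSum_le_pow (by simp [expDist_self])
      (fun g h => expDist_mul_smul_le hκ.le o g h) n) _
  have hJmul : ∀ z g h, J z (g * h) ≤ D * (J z g + J (g⁻¹ • z) h) := by
    intro z g h
    have h1 : gromovProd z (g • o) ((g * h) • o) = gromovProd (g⁻¹ • z) o (h • o) := by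
      rw [← gromovProd_smul g (g⁻¹ • z), smul_inv_smul, mul_smul]
    have h2 := hX.four_point z o (g • o) ((g * h) • o)
    rw [h1] at h2
    simp only [J]
    rw [hD, ← ENNReal.ofReal_add (Real.exp_pos _).le (Real.exp_pos _).le,
      ← ENNReal.ofReal_mul (Real.exp_pos _).le, mul_add, ← Real.exp_add, ← Real.exp_add]
    refine ENNReal.ofReal_le_ofReal ?_
    rcases min_le_iff.1 h2 with h3 | h3
    · refine le_add_of_le_of_nonneg (Real.exp_le_exp.2 ?_) (Real.exp_pos _).le
      nlinarith
    · refine le_add_of_nonneg_of_le (Real.exp_pos _).le (Real.exp_le_exp.2 ?_)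
      nlinarith
  refine ⟨A, hAt, fun n => ?_⟩
  induction n using Nat.strong_induction_on with
  | _ n ih =>
    intro z
    rcases lt_or_ge n (N + 1) with hn | hn
    · refine (hJn n z).trans (mul_le_mul_left ?_ _)
      calc M ^ n ≤ M ^ (N + 1) := pow_le_pow_right₀ hM1 hn.le
        _ ≤ D * M ^ (N + 1) := le_mul_of_one_le_left zero_le hD1
        _ ≤ A := le_mul_of_one_le_left zero_le (by norm_num)
    · obtain ⟨k, rfl⟩ := Nat.exists_eq_add_of_le hn
      rw [iterSum_add_right]
      calc iterSum μ (N + 1) (fun g => iterSum μ k fun h => J z (g * h))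
          ≤ iterSum μ (N + 1) (fun g => D * (J z g + A * expDist (-κ) o (g⁻¹ • z))) := by
            refine iterSum_mono (fun g => ?_) _
            refine (iterSum_mono (hJmul z g) k).trans ?_
            rw [iterSum_mul_left, iterSum_add]
            refine mul_le_mul_right (add_le_add ?_ (ih k (by omega) _)) _
            have := iterSum_mul_left (T := μ) (J z g) (fun _ => 1) k
            rw [iterSum_one, μ.tsum_coe, one_pow] at this
            simpa using this.le
        _ ≤ D * (M ^ (N + 1) * expDist (-κ) o z + A * (C * r ^ (N + 1) * expDist (-κ) o z)) := by
            rw [iterSum_mul_left, iterSum_add, iterSum_mul_left]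
            exact mul_le_mul_right (add_le_add (hJn _ z) (mul_le_mul_right (hcontr _ z) _)) _
        _ = (D * M ^ (N + 1) + A * (D * (C * r ^ (N + 1)))) * expDist (-κ) o z := by ring
        _ ≤ (D * M ^ (N + 1) + A * 2⁻¹) * expDist (-κ) o z := by gcongr
        _ = A * expDist (-κ) o z := by
            rw [hA, mul_comm (2 : ℝ≥0∞), mul_assoc, ENNReal.mul_inv_cancel (by simp) (by simp)]
            ring

omit [IsIsometricSMul Γ X] in
/-- The Gromov products of the random walk with any point have uniform exponential moments. -/
theorem exists_expMoment_gromovProd (hX : IsCATNegOne X) (o : X) {μ : PMF Γ}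
    {κ : ℝ} (hκ : 0 < κ) {A : ℝ≥0∞} (hA : A ≠ ⊤)
    (hAJ : ∀ n z, iterSum μ n (fun g => ENNReal.ofReal (Real.exp (-κ * gromovProd z o (g • o)))) ≤
        A * expDist (-κ) o z) :
    ∃ B : ℝ≥0∞, B ≠ ⊤ ∧ ∀ n y,
      iterSum μ n (fun g => ENNReal.ofReal (Real.exp (κ / 2 * gromovProd o y (g • o)))) ≤ B := by
  set D := ENNReal.ofReal (Real.exp (2 * κ)) with hD
  set E := ENNReal.ofReal (Real.exp (κ / 2)) with hE
  set q := ENNReal.ofReal (Real.exp (-(κ / 2))) with hq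
  have hq1 : q < 1 := by
    rw [hq, ENNReal.ofReal_lt_one, Real.exp_lt_one_iff]; linarith
  refine ⟨∑' t : ℕ, E * D * A * q ^ t, ?_, fun n y => ?_⟩
  · rw [ENNReal.tsum_mul_left, ENNReal.tsum_geometric]
    exact ENNReal.mul_ne_top (ENNReal.mul_ne_top (ENNReal.mul_ne_top ENNReal.ofReal_ne_top
      ENNReal.ofReal_ne_top) hA) (ENNReal.inv_ne_top.2 (tsub_pos_of_lt hq1).ne')
  have hpt : ∀ t : ℕ, ∃ p : X, (t : ℝ) ≤ dist o y →
      dist o p = t ∧ dist o p + dist p y = dist o y := by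
    intro t
    by_cases h : (t : ℝ) ≤ dist o y
    · obtain ⟨p, h1, h2⟩ := hX.exists_between o y (Nat.cast_nonneg t) h
      exact ⟨p, fun _ => ⟨h1, h2⟩⟩
    · exact ⟨o, fun h' => (h h').elim⟩
  choose p hp using hpt
  -- If t ≤ (y | go)_o ≤ t + 1, then (o | go)_{p t} ≤ 2. The value exp(κ (t + 1) / 2) is then
  -- weighed against the decay exp(-κt) at p t, which leaves a geometric series of ratio exp(-κ/2).
  let F : ℕ → Γ → ℝ≥0∞ := fun t g => if (t : ℝ) ≤ dist o y then
    ENNReal.ofReal (Real.exp (κ / 2 * (t + 1))) * D *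
      ENNReal.ofReal (Real.exp (-κ * gromovProd (p t) o (g • o))) else 0
  have hF : ∀ g : Γ, ENNReal.ofReal (Real.exp (κ / 2 * gromovProd o y (g • o))) ≤ ∑' t, F t g := by
    intro g
    refine le_trans ?_ (ENNReal.le_tsum ⌊gromovProd o y (g • o)⌋₊)
    set t := ⌊gromovProd o y (g • o)⌋₊
    have h1 : (t : ℝ) ≤ gromovProd o y (g • o) := Nat.floor_le (gromovProd_nonneg ..)
    have h2 := (Nat.lt_floor_add_one (gromovProd o y (g • o))).le
    have h3 := h1.trans (gromovProd_le_left ..)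
    obtain ⟨h4, h5⟩ := hp t h3
    have h6 : gromovProd o (p t) y = t := by simp only [gromovProd]; linarith
    have h7 := hX.four_point o (p t) y (g • o)
    rw [h6, min_eq_left h1] at h7
    have h8 := gromovProd_add o (p t) (g • o)
    simp only [F, if_pos h3]
    rw [hD, ← ENNReal.ofReal_mul (Real.exp_pos _).le, ← ENNReal.ofReal_mul (by positivity),
      ← Real.exp_add, ← Real.exp_add]
    refine ENNReal.ofReal_le_ofReal (Real.exp_le_exp.2 ?_)
    nlinarith
  calc iterSum μ n (fun g => ENNReal.ofReal (Real.exp (κ / 2 * gromovProd o y (g • o))))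
      ≤ iterSum μ n (fun g => ∑' t, F t g) := iterSum_mono hF n
    _ = ∑' t, iterSum μ n (F t) := by
        simp only [← tsum_convPow, ← ENNReal.tsum_mul_left]
        exact ENNReal.tsum_comm
    _ ≤ _ := ENNReal.tsum_le_tsum fun t => ?_
  by_cases h : (t : ℝ) ≤ dist o y
  · simp only [F, if_pos h]
    rw [iterSum_mul_left]
    refine (mul_le_mul_right (hAJ n (p t)) _).trans_eq ?_
    have hexp : ENNReal.ofReal (Real.exp (κ / 2 * (t + 1))) * expDist (-κ) o (p t) = E * q ^ t := by
      rw [expDist, (hp t h).1, hE, hq, ← ENNReal.ofReal_pow (Real.exp_pos _).le, ← Real.exp_nat_mul,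
        ← ENNReal.ofReal_mul (Real.exp_pos _).le, ← ENNReal.ofReal_mul (Real.exp_pos _).le,
        ← Real.exp_add, ← Real.exp_add]
      congr 2; ring
    calc _ = D * A * (ENNReal.ofReal (Real.exp (κ / 2 * (t + 1))) * expDist (-κ) o (p t)) := by ring
      _ = _ := by rw [hexp]; ring
  · simp only [F, if_neg h]
    have := iterSum_mul_left (T := μ) 0 (fun _ => 0) n
    simp only [zero_mul] at this
    rw [this]; exact zero_le

end Decay

/-! ### Potentials along geodesics -/

section Potential

variable {X : Type*} [MetricSpace X] {F : UnitTangent X → ℝ}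

/-- The rate η is arbitrarily small, so the growth of F can be beaten by the fixed exponential
moment of the Gromov products. -/
theorem HolderControl.exists_abs_le (hF : HolderControl F) (o : X) {η : ℝ} (hη : 0 < η) :
    ∃ B, 0 < B ∧ ∀ v, |F v| ≤ B * Real.exp (η * dist o v.base) := by
  obtain ⟨b, hb, hbF⟩ := hF.subexponential (Real.exp η) (Real.one_lt_exp_iff.2 hη)
  rcases isEmpty_or_nonempty (UnitTangent X) with hE | ⟨⟨w⟩⟩
  · exact ⟨1, one_pos, fun v => hE.elim v⟩
  refine ⟨|F w| + b * Real.exp (η * dist o w.base), by positivity, fun v => ?_⟩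
  have h1 := hbF v w
  rw [← Real.exp_mul] at h1
  have h2 : Real.exp (η * dist v.base w.base) ≤
      Real.exp (η * dist o w.base) * Real.exp (η * dist o v.base) := by
    rw [← Real.exp_add, ← mul_add]
    refine Real.exp_le_exp.2 (mul_le_mul_of_nonneg_left ?_ hη.le)
    linarith [dist_triangle_left v.base w.base o]
  have h3 : 1 ≤ Real.exp (η * dist o v.base) := Real.one_le_exp (by positivity)
  have h4 := abs_sub_abs_le_abs_sub (F v) (F w)
  have h5 : |F w| * 1 ≤ |F w| * Real.exp (η * dist o v.base) :=
    mul_le_mul_of_nonneg_left h3 (abs_nonneg _)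
  have h6 := mul_le_mul_of_nonneg_left h2 hb.le
  linarith

theorem maxAbsOver_nonneg (F : UnitTangent X → ℝ) (x : X) (r : ℝ) : 0 ≤ maxAbsOver F x r :=
  Real.iSup_nonneg fun _ => abs_nonneg _

theorem maxAbsOver_le {o : X} {η B : ℝ} (hη : 0 ≤ η) (hB : 0 ≤ B)
    (hF : ∀ v, |F v| ≤ B * Real.exp (η * dist o v.base)) (x : X) (r : ℝ) :
    maxAbsOver F x r ≤ B * Real.exp (η * (dist o x + r)) := by
  refine Real.iSup_le (fun v => (hF v).trans ?_) (by positivity)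
  refine mul_le_mul_of_nonneg_left (Real.exp_le_exp.2 (mul_le_mul_of_nonneg_left ?_ hη)) hB
  linarith [v.2, dist_triangle o x v.1.base, dist_comm x v.1.base]

theorem GeodesicLine.base_germ_flow (ℓ : GeodesicLine X) (t : ℝ) :
    (ℓ.flow t).germ.base = ℓ.1 t := by
  change ℓ.1 (t + 0) = ℓ.1 t
  rw [add_zero]

theorem fakeDist_self (F : UnitTangent X → ℝ) (x : X) : fakeDist F x x = 0 := by
  rw [fakeDist]
  split_ifs <;> simp

theorem GeodesicLine.dist_apply (ℓ : GeodesicLine X) (s t : ℝ) : dist (ℓ.1 s) (ℓ.1 t) = |s - t| := by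
  rw [ℓ.2.dist_eq, Real.dist_eq]

theorem abs_flow_le {o : X} {η B : ℝ} (hη : 0 ≤ η) (hB : 0 ≤ B)
    (hF : ∀ v, |F v| ≤ B * Real.exp (η * dist o v.base)) (ℓ : GeodesicLine X) {a b t : ℝ}
    (ht : t ∈ uIoc a b) : ‖F (ℓ.flow t).germ‖ ≤ B * Real.exp (η * (dist o (ℓ.1 a) + |b - a|)) := by
  refine (hF _).trans ?_
  rw [ℓ.base_germ_flow]
  refine mul_le_mul_of_nonneg_left (Real.exp_le_exp.2 (mul_le_mul_of_nonneg_left ?_ hη)) hB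
  have h1 := dist_triangle o (ℓ.1 a) (ℓ.1 t)
  rw [ℓ.dist_apply, abs_sub_comm] at h1
  have h2 : |t - a| ≤ |b - a| := abs_sub_left_of_mem_uIcc (uIoc_subset_uIcc ht)
  linarith

variable {Γ : Type*} [Group Γ] [MulAction Γ X] [IsIsometricSMul Γ X]

theorem IsPotential.intervalIntegrable (hP : IsPotential Γ F) {o : X} {η B : ℝ} (hη : 0 ≤ η)
    (hB : 0 ≤ B) (hF : ∀ v, |F v| ≤ B * Real.exp (η * dist o v.base)) (ℓ : GeodesicLine X)
    (a b : ℝ) : IntervalIntegrable (fun t => F (ℓ.flow t).germ) volume a b := by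
  rw [intervalIntegrable_iff]
  refine Measure.integrableOn_of_bounded (M := B * Real.exp (η * (dist o (ℓ.1 a) + |b - a|)))
    (by simp [uIoc]) (hP.measurable_along ℓ).aestronglyMeasurable ?_
  filter_upwards [ae_restrict_mem measurableSet_uIoc] with t ht
  exact abs_flow_le hη hB hF ℓ ht

theorem abs_fakeDist_le (hX : IsCATNegOne X) (hXc : IsGeodesicallyComplete X) {o : X} {η B : ℝ}
    (hη : 0 ≤ η) (hB : 0 ≤ B) (hF : ∀ v, |F v| ≤ B * Real.exp (η * dist o v.base)) (x y : X) :
    |fakeDist F x y| ≤ B * Real.exp (η * (dist o x + dist x y)) * dist x y := by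
  rcases eq_or_ne x y with rfl | hxy
  · simp [fakeDist_self]
  obtain ⟨ℓ, h0, h1⟩ := hXc x y hxy
  have h2 := fakeDist_eq hX F ℓ (dist_nonneg (x := x) (y := y))
  rw [h0, h1] at h2
  rw [h2]
  have h3 := intervalIntegral.norm_integral_le_of_norm_le_const (a := 0) (b := dist x y)
    (f := fun t => F (ℓ.flow t).germ) fun t ht => abs_flow_le hη hB hF ℓ ht
  rwa [h0, sub_zero, abs_of_nonneg dist_nonneg] at h3

theorem fakeDist_add (hX : IsCATNegOne X) (hXc : IsGeodesicallyComplete X) (hP : IsPotential Γ F)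
    (hHC : HolderControl F) {x y p : X} (hp : dist x p + dist p y = dist x y) :
    fakeDist F x p + fakeDist F p y = fakeDist F x y := by
  obtain ⟨B, hB, hF⟩ := hHC.exists_abs_le x one_pos
  rcases eq_or_ne x y with rfl | hxy
  · have : dist x p = 0 := by
      have := dist_nonneg (x := x) (y := p); have := dist_nonneg (x := p) (y := x)
      rw [dist_self] at hp; linarith
    rw [← dist_eq_zero.1 this]; simp [fakeDist_self]
  obtain ⟨ℓ, h0, h1⟩ := hXc x y hxy
  have hnn := dist_nonneg (x := x) (y := p)
  have hle : dist x p ≤ dist x y := by linarith [dist_nonneg (x := p) (y := y)]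
  have d1 : dist x (ℓ.1 (dist x p)) = dist x p := by
    have := ℓ.dist_apply 0 (dist x p)
    rwa [h0, zero_sub, abs_neg, abs_of_nonneg hnn] at this
  have d2 : dist (ℓ.1 (dist x p)) y = dist x y - dist x p := by
    have := ℓ.dist_apply (dist x p) (dist x y)
    rwa [h1, abs_sub_comm, abs_of_nonneg (by linarith)] at this
  have hpe : ℓ.1 (dist x p) = p := hX.eq_of_dist_eq (by rw [d1, d2]; ring) hp d1
  have e1 := fakeDist_eq hX F ℓ hnn
  have e2 := fakeDist_eq hX F ℓ hle
  have e3 := fakeDist_eq hX F ℓ (dist_nonneg (x := x) (y := y))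
  rw [h0, hpe] at e1
  rw [hpe, h1] at e2
  rw [h0, h1] at e3
  rw [e1, e2, e3]
  exact intervalIntegral.integral_add_adjacent_intervals
    (hP.intervalIntegrable zero_le_one hB.le hF ℓ _ _)
    (hP.intervalIntegrable zero_le_one hB.le hF ℓ _ _)

theorem fakeDist_smul (hX : IsCATNegOne X) (hXc : IsGeodesicallyComplete X) (hP : IsPotential Γ F)
    (g : Γ) (x y : X) : fakeDist F (g • x) (g • y) = fakeDist F x y := by
  rcases eq_or_ne x y with rfl | hxy
  · simp [fakeDist_self]
  obtain ⟨ℓ, h0, h1⟩ := hXc x y hxy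
  have e1 := fakeDist_eq hX F ℓ (dist_nonneg (x := x) (y := y))
  have e2 := fakeDist_eq hX F (ℓ.translate g) (dist_nonneg (x := x) (y := y))
  change fakeDist F (g • ℓ.1 0) (g • ℓ.1 (dist x y)) = _ at e2
  rw [h0, h1] at e1 e2
  rw [e1, e2]
  exact intervalIntegral.integral_congr fun t _ => hP.invariant g (ℓ.flow t)

-- Unit steps chained along a geodesic: Hölder control concerns points at distance at most 1,
-- whereas thin triangles produce distance 2.
omit [MulAction Γ X] [IsIsometricSMul Γ X] [Group Γ] in
theorem abs_sub_le_of_step (hX : IsCATNegOne X) {G : X → ℝ} {o : X} {c η B : ℝ} (hη : 0 ≤ η)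
    (hB : 0 ≤ B) (hG : ∀ x x', dist x x' ≤ 1 → |G x' - G x| ≤ c + B * Real.exp (η * (dist o x + 1)))
    (N : ℕ) (x x' : X) (h : dist x x' ≤ N) :
    |G x' - G x| ≤ N * (c + B * Real.exp (η * (dist o x + N))) := by
  induction N generalizing x' with
  | zero =>
    have : x = x' := dist_le_zero.1 (by simpa using h)
    simp [this]
  | succ N ih =>
    push_cast at h ⊢
    obtain ⟨p, p1, p2⟩ := hX.exists_between x x' (t := min (dist x x') N)
      (le_min dist_nonneg (Nat.cast_nonneg N)) (min_le_left _ _)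
    have hpN : dist x p ≤ N := p1.trans_le (min_le_right _ _)
    have hp1 : dist p x' ≤ 1 := by
      rcases min_choice (dist x x') (N : ℝ) with h' | h' <;> rw [h'] at p1 <;> linarith
    have h1 := ih p hpN
    have h2 := hG p x' hp1
    have m1 : B * Real.exp (η * (dist o x + N)) ≤ B * Real.exp (η * (dist o x + (N + 1))) := by
      refine mul_le_mul_of_nonneg_left (Real.exp_le_exp.2 (mul_le_mul_of_nonneg_left ?_ hη)) hB
      linarith
    have m2 : B * Real.exp (η * (dist o p + 1)) ≤ B * Real.exp (η * (dist o x + (N + 1))) := by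
      refine mul_le_mul_of_nonneg_left (Real.exp_le_exp.2 (mul_le_mul_of_nonneg_left ?_ hη)) hB
      linarith [dist_triangle o x p]
    have m3 := mul_le_mul_of_nonneg_left m1 (Nat.cast_nonneg (α := ℝ) N)
    have h3 := abs_sub_le (G x') (G p) (G x)
    linarith

theorem HolderControl.exists_step (hX : IsCATNegOne X) (hHC : HolderControl F) {o : X} {η B : ℝ}
    (hη : 0 ≤ η) (hB : 0 ≤ B) (hF : ∀ v, |F v| ≤ B * Real.exp (η * dist o v.base)) :
    ∃ c, 0 < c ∧ ∀ x x' y, dist x x' ≤ 2 →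
      |fakeDist F x' y - fakeDist F x y| ≤ 2 * (c + B * Real.exp (η * (dist o x + 2))) ∧
      |fakeDist F y x' - fakeDist F y x| ≤ 2 * (c + B * Real.exp (η * (dist o x + 2))) := by
  obtain ⟨c₁, hc₁, c₂, hc₂, hctrl⟩ := hHC.control
  have key : ∀ x x', dist x x' ≤ 1 → (c₁ + maxAbsOver F x (dist x x')) * dist x x' ^ c₂ ≤
      c₁ + B * Real.exp (η * (dist o x + 1)) := by
    intro x x' h
    have h0 := maxAbsOver_nonneg F x (dist x x')
    refine (mul_le_of_le_one_right (by linarith)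
      (Real.rpow_le_one dist_nonneg h hc₂.1.le)).trans ?_
    have := maxAbsOver_le hη hB hF x (dist x x')
    have m : B * Real.exp (η * (dist o x + dist x x')) ≤ B * Real.exp (η * (dist o x + 1)) := by
      refine mul_le_mul_of_nonneg_left (Real.exp_le_exp.2 (mul_le_mul_of_nonneg_left ?_ hη)) hB
      linarith
    linarith
  have hz : (0 : ℝ) ^ c₂ = 0 := Real.zero_rpow hc₂.1.ne'
  refine ⟨c₁, hc₁, fun x x' y h => ⟨?_, ?_⟩⟩
  · refine abs_sub_le_of_step hX (G := fun x => fakeDist F x y) hη hB (fun x x' h => ?_) 2 x x' h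
    have := hctrl x y x' y h (by simp)
    rw [dist_self, hz, mul_zero, add_zero] at this
    exact this.trans (key x x' h)
  · refine abs_sub_le_of_step hX (G := fun x => fakeDist F y x) hη hB (fun x x' h => ?_) 2 x x' h
    have := hctrl y x y x' (by simp) h
    rw [dist_self, hz, mul_zero, zero_add] at this
    exact this.trans (key x x' h)

/-- The defect of additivity of `d_F` grows subexponentially with the Gromov product. -/
theorem HolderControl.exists_abs_fakeDist_sub_le (hX : IsCATNegOne X)
    (hXc : IsGeodesicallyComplete X) (hP : IsPotential Γ F) (hHC : HolderControl F) (o : X) {η : ℝ}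
    (hη : 0 < η) : ∃ B, 0 < B ∧ ∀ x y,
      |fakeDist F x y - fakeDist F x o - fakeDist F o y| ≤ B * Real.exp (η * gromovProd o x y) := by
  -- An integral over a segment of length t starting or ending at o is at most a multiple of t
  -- exp((η/4) 2t), and t itself costs a further exp((η/4) t); the total rate 3η/4 stays below η.
  have hη' : 0 < η / 4 := by positivity
  obtain ⟨B, hB, hF⟩ := hHC.exists_abs_le o hη'
  obtain ⟨c, hc, hstep⟩ := hHC.exists_step hX hη'.le hB.le hF
  refine ⟨4 * (c + B * Real.exp (η / 4 * 2)) + 2 * (B * (4 / η)), by positivity, fun x y => ?_⟩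
  set t := gromovProd o x y with ht
  have t0 : 0 ≤ t := gromovProd_nonneg ..
  have txo : gromovProd x o y = dist o x - t := by linarith [gromovProd_add o x y]
  have tyo : gromovProd y o x = dist o y - t := by
    linarith [gromovProd_add o y x, gromovProd_comm o y x]
  obtain ⟨p, p1, p2⟩ := hX.exists_between o x t0 (gromovProd_le_left ..)
  obtain ⟨q, q1, q2⟩ := hX.exists_between o y t0 (gromovProd_le_right ..)
  -- The points p, q, m are the inner points of the triangle (o, x, y). Comparing m with p and with
  -- q costs errors localised at distance t from o; what remains of the defect is d_F(p, o) + d_F(o,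
  -- q).
  obtain ⟨m, m1, m2⟩ := hX.exists_between x y (gromovProd_nonneg x o y) (gromovProd_le_right ..)
  have hm3 : dist y m = gromovProd y o x := by
    rw [dist_comm y m, tyo]
    have : gromovProd o x y = (dist o x + dist o y - dist x y) / 2 := rfl
    linarith
  have hp' : dist x p + dist p o = dist x o := by
    rw [dist_comm x p, dist_comm p o, dist_comm x o]; linarith
  have hq' : dist y q + dist q o = dist y o := by
    rw [dist_comm y q, dist_comm q o, dist_comm y o]; linarith
  have hxp : dist x p = dist x m := by rw [m1, txo, dist_comm x p]; linarith
  have hyq : dist y q = dist y m := by rw [hm3, tyo, dist_comm y q]; linarith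
  have dp : dist p m ≤ 2 := hX.dist_le_two hp' m2 hxp (by rw [hxp, m1])
  have m2' : dist y m + dist m x = dist y x := by
    rw [dist_comm y m, dist_comm m x, dist_comm y x]; linarith
  have dq : dist q m ≤ 2 := hX.dist_le_two hq' m2' hyq (by rw [hyq, hm3])
  have a1 := fakeDist_add hX hXc hP hHC m2
  have a2 := fakeDist_add hX hXc hP hHC hp'
  have a3 := fakeDist_add hX hXc hP hHC q2
  have b1 := (hstep p m x dp).2
  have b2 := (hstep q m y dq).1
  have b3 := abs_fakeDist_le hX hXc hη'.le hB.le hF p o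
  have b4 := abs_fakeDist_le hX hXc hη'.le hB.le hF o q
  rw [p1] at b1
  rw [q1] at b2
  rw [dist_comm p o, p1] at b3
  rw [dist_self, q1] at b4
  have c0 : t ≤ 4 / η * Real.exp (η / 4 * t) := by
    rw [div_mul_eq_mul_div, le_div_iff₀ hη]
    nlinarith [Real.add_one_le_exp (η / 4 * t)]
  have hηt : 0 ≤ η * t := mul_nonneg hη.le t0
  have e1 : Real.exp (η / 4 * (t + 2)) ≤ Real.exp (η / 4 * 2) * Real.exp (η * t) := by
    rw [← Real.exp_add]; exact Real.exp_le_exp.2 (by linarith)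
  have e0 : 1 ≤ Real.exp (η * t) := Real.one_le_exp (by positivity)
  have e2 : Real.exp (η / 4 * (t + t)) * t ≤ 4 / η * Real.exp (η * t) := by
    calc Real.exp (η / 4 * (t + t)) * t
        ≤ Real.exp (η / 4 * (t + t)) * (4 / η * Real.exp (η / 4 * t)) :=
          mul_le_mul_of_nonneg_left c0 (Real.exp_pos _).le
      _ = 4 / η * Real.exp (η / 4 * (t + t) + η / 4 * t) := by rw [Real.exp_add]; ring
      _ ≤ _ := mul_le_mul_of_nonneg_left (Real.exp_le_exp.2 (by linarith)) (by positivity)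
  have e3 : Real.exp (η / 4 * (0 + t)) * t ≤ 4 / η * Real.exp (η * t) :=
    (mul_le_mul_of_nonneg_right (Real.exp_le_exp.2 (by linarith)) t0).trans e2
  have f1 := mul_le_mul_of_nonneg_left e1 hB.le
  have f2 := mul_le_mul_of_nonneg_left e2 hB.le
  have f3 := mul_le_mul_of_nonneg_left e3 hB.le
  have f4 := mul_le_mul_of_nonneg_left e0 hc.le
  rw [abs_le] at b1 b2 b3 b4 ⊢
  constructor <;> linarith

theorem exists_quasiAdditive_fakeDist (hX : IsCATNegOne X) (hXc : IsGeodesicallyComplete X)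
    (hP : IsPotential Γ F) (hHC : HolderControl F) (o : X) {η : ℝ} (hη : 0 < η) :
    ∃ B, 0 < B ∧ (∀ g : Γ, |fakeDist F o (g • o)| ≤ B * Real.exp (η * dist o (g • o))) ∧
      ∀ g h : Γ, |fakeDist F o ((g * h) • o) - fakeDist F o (g • o) - fakeDist F o (h • o)| ≤
        B * Real.exp (η * gromovProd o (g⁻¹ • o) (h • o)) := by
  obtain ⟨B, hB, hdef⟩ := hHC.exists_abs_fakeDist_sub_le hX hXc hP o hη
  obtain ⟨B', hB', hF⟩ := hHC.exists_abs_le o (half_pos hη)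
  refine ⟨max B (B' * (2 / η)), by positivity, fun g => ?_, fun g h => ?_⟩
  · have h1 := abs_fakeDist_le hX hXc (half_pos hη).le hB'.le hF o (g • o)
    rw [dist_self, zero_add] at h1
    set d := dist o (g • o)
    have h2 : d ≤ 2 / η * Real.exp (η / 2 * d) := by
      rw [div_mul_eq_mul_div, le_div_iff₀ hη]
      nlinarith [Real.add_one_le_exp (η / 2 * d)]
    calc _ ≤ _ := h1
      _ ≤ B' * Real.exp (η / 2 * d) * (2 / η * Real.exp (η / 2 * d)) :=
          mul_le_mul_of_nonneg_left h2 (by positivity)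
      _ = B' * (2 / η) * Real.exp (η * d) := by
          rw [show η * d = η / 2 * d + η / 2 * d by ring, Real.exp_add]; ring
      _ ≤ _ := mul_le_mul_of_nonneg_right (le_max_right _ _) (Real.exp_pos _).le
  · have h1 := hdef (g⁻¹ • o) (h • o)
    rw [← fakeDist_smul hX hXc hP g, ← fakeDist_smul hX hXc hP g (g⁻¹ • o) o, smul_inv_smul,
      ← mul_smul] at h1
    exact h1.trans (mul_le_mul_of_nonneg_right (le_max_left _ _) (Real.exp_pos _).le)

end Potential

/-! ### Quasi-additive functions along the random walk -/

section Law

theorem walk_congr {Γ : Type*} [Group Γ] {x y : ℕ → Γ} {n : ℕ} (h : ∀ i < n, x i = y i) :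
    walk x n = walk y n := by
  induction n with
  | zero => rfl
  | succ n ih => rw [walk, walk, ih fun i hi => h i (by omega), h n (by omega)]

variable {Γ : Type*} [Countable Γ] [MeasurableSpace Γ] [DiscreteMeasurableSpace Γ]

theorem lintegral_toMeasure (p : PMF Γ) (f : Γ → ℝ≥0∞) :
    ∫⁻ g, f g ∂p.toMeasure = ∑' g, p g * f g := by
  rw [lintegral_countable']
  refine tsum_congr fun g => ?_
  rw [p.toMeasure_apply_singleton g (measurableSet_singleton g), mul_comm]

variable [Group Γ]

omit [Countable Γ] [MeasurableSpace Γ] [DiscreteMeasurableSpace Γ] in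
theorem convPow_one (μ : PMF Γ) : convPow μ 1 = μ := by
  rw [convPow, convPow, PMF.pure_bind]
  simp only [one_mul]
  exact PMF.map_id μ

theorem measurePreserving_mul_convPow (μ : PMF Γ) (n m : ℕ) :
    MeasurePreserving (fun p : Γ × Γ => p.1 * p.2)
      ((convPow μ n).toMeasure.prod (convPow μ m).toMeasure) (convPow μ (n + m)).toMeasure := by
  refine ⟨.of_discrete, Measure.ext_of_lintegral _ fun f hf => ?_⟩
  rw [lintegral_map hf .of_discrete, lintegral_prod _ (Measurable.of_discrete).aemeasurable]
  simp only [lintegral_toMeasure, tsum_convPow_add]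

theorem measurable_walk (n : ℕ) : Measurable fun x : ℕ → Γ => walk x n := by
  induction n with
  | zero => exact measurable_const
  | succ n ih =>
    exact (Measurable.of_discrete (f := fun p : Γ × Γ => p.1 * p.2)).comp
      (ih.prodMk (measurable_pi_apply n))

instance isProbabilityMeasure_pathMeasure (μ : PMF Γ) : IsProbabilityMeasure (pathMeasure μ) := by
  unfold pathMeasure; infer_instance

/-- The position at time n depends on the first n increments only, hence is independent of the next
one. The second assertion at n gives the first at n + 1. -/
theorem measurePreserving_walk_prodMk (μ : PMF Γ) (n : ℕ) :
    MeasurePreserving (fun x : ℕ → Γ => walk x n) (pathMeasure μ) (convPow μ n).toMeasure ∧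
    MeasurePreserving (fun x : ℕ → Γ => (walk x n, x n)) (pathMeasure μ)
      ((convPow μ n).toMeasure.prod μ.toMeasure) := by
  have key : ∀ n, MeasurePreserving (fun x : ℕ → Γ => walk x n) (pathMeasure μ)
      (convPow μ n).toMeasure → MeasurePreserving (fun x : ℕ → Γ => (walk x n, x n)) (pathMeasure μ)
      ((convPow μ n).toMeasure.prod μ.toMeasure) := by
    intro n hn
    refine ⟨(measurable_walk n).prodMk (measurable_pi_apply n), ?_⟩
    have hind : ProbabilityTheory.iIndepFun (fun (i : ℕ) (x : ℕ → Γ) => x i) (pathMeasure μ) :=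
      ProbabilityTheory.iIndepFun_infinitePi (P := fun _ : ℕ => μ.toMeasure)
        (X := fun _ x => x) fun _ => measurable_id
    have h1 := hind.indepFun_finset (Finset.range n) {n} (by simp) fun i => measurable_pi_apply i
    have hlast : Measurable fun y : ({n} : Finset ℕ) → Γ => y ⟨n, by simp⟩ :=
      measurable_pi_apply _
    have h2 := h1.comp
      (φ := fun y => walk (fun i => if h : i ∈ Finset.range n then y ⟨i, h⟩ else 1) n)
      (ψ := fun y => y ⟨n, by simp⟩) ((measurable_walk n).comp (measurable_pi_lambda _ fun i => by
        split_ifs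
        · exact measurable_pi_apply _
        · exact measurable_const)) hlast
    have h3 : (fun y : (i : Finset.range n) → Γ =>
        walk (fun i => if h : i ∈ Finset.range n then y ⟨i, h⟩ else 1) n) ∘
        (fun (a : ℕ → Γ) (i : Finset.range n) => a i) = fun x => walk x n := by
      funext x
      exact walk_congr fun i hi => by simp [hi]
    rw [h3] at h2
    have h4 := (ProbabilityTheory.indepFun_iff_map_prod_eq_prod_map_map
      (measurable_walk n).aemeasurable (measurable_pi_apply n).aemeasurable).1 h2
    have h5 : (pathMeasure μ).map (fun x => x n) = μ.toMeasure :=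
      (measurePreserving_eval_infinitePi (fun _ : ℕ => μ.toMeasure) n).map_eq
    rw [hn.map_eq] at h4
    exact h4.trans (by rw [← h5])
  suffices h : MeasurePreserving (fun x : ℕ → Γ => walk x n) (pathMeasure μ)
      (convPow μ n).toMeasure from ⟨h, key n h⟩
  induction n with
  | zero =>
    refine ⟨measurable_walk 0, ?_⟩
    simp [walk, convPow, Measure.map_const, PMF.toMeasure_pure]
  | succ n ih =>
    have h1 := measurePreserving_mul_convPow μ n 1
    rw [convPow_one] at h1
    exact h1.comp (key n ih)

end Law

/-! ### Growth and convergence of real sequences, almost sure convergence from second moments -/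

section Numeric

/-- Each doubling of n multiplies the bound by 2 · 5/4 = 5/2, and (5/2)⁴ ≤ 2⁶. Growth k⁶ at time k⁴
is slow enough for V(k⁴) / k⁸ to be summable. -/
theorem exists_forall_le_pow_six {V : ℕ → ℝ} {c : ℝ} (hc : 0 ≤ c) (h0 : ∀ n, 0 ≤ V n)
    (hV : ∀ n m, V (n + m) ≤ 5 / 4 * (V n + V m) + c) :
    ∃ C, 0 ≤ C ∧ ∀ k : ℕ, 1 ≤ k → V (k ^ 4) ≤ C * k ^ 6 := by
  set C := V 0 + V 1 + c with hC
  have hC0 : 0 ≤ C := by have := h0 0; have := h0 1; positivity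
  have key : ∀ j n, n ≤ 2 ^ j → V n ≤ C * (5 / 2) ^ j - c := by
    intro j
    induction j with
    | zero =>
      intro n hn
      have : n = 0 ∨ n = 1 := by rw [pow_zero] at hn; omega
      rcases this with rfl | rfl <;> simp only [pow_zero, hC] <;> linarith [h0 0, h0 1]
    | succ j ih =>
      intro n hn
      have h1 := ih (n / 2) (by rw [pow_succ] at hn; omega)
      have h2 := ih (n - n / 2) (by rw [pow_succ] at hn; omega)
      have h3 := hV (n / 2) (n - n / 2)
      rw [Nat.add_sub_of_le (Nat.div_le_self n 2)] at h3
      rw [pow_succ]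
      linarith
  refine ⟨64 * C, by positivity, fun k hk => ?_⟩
  set i := Nat.clog 2 k
  have h1 : k ≤ 2 ^ i := Nat.le_pow_clog one_lt_two k
  have h2 : 2 ^ i ≤ 2 * k := by
    rcases Nat.lt_or_ge 1 k with h | h
    · have h3 := Nat.pow_pred_clog_lt_self one_lt_two h
      have h4 : 0 < i := Nat.clog_pos one_lt_two h
      calc 2 ^ i = 2 * 2 ^ i.pred := by
            rw [← pow_succ']; congr 1; exact (Nat.succ_pred_eq_of_pos h4).symm
        _ ≤ 2 * k := by gcongr
    · have : k = 1 := le_antisymm h hk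
      simp [i, this]
  have h3 := key (4 * i) (k ^ 4) (by rw [mul_comm, pow_mul]; exact Nat.pow_le_pow_left h1 4)
  have h4 : ((5 : ℝ) / 2) ^ (4 * i) ≤ 64 * k ^ 6 := by
    calc ((5 : ℝ) / 2) ^ (4 * i) = ((5 / 2) ^ 4) ^ i := pow_mul _ _ _
      _ ≤ ((2 : ℝ) ^ 6) ^ i := pow_le_pow_left₀ (by norm_num) (by norm_num) i
      _ = ((2 : ℝ) ^ i) ^ 6 := by rw [← pow_mul, ← pow_mul, mul_comm]
      _ ≤ (2 * k : ℝ) ^ 6 := pow_le_pow_left₀ (by positivity) (by exact_mod_cast h2) 6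
      _ = 64 * k ^ 6 := by ring
  nlinarith [mul_le_mul_of_nonneg_left h4 hC0]

/-- Convergence along fourth powers, with small oscillation in between, implies convergence. -/
theorem tendsto_div_of_tendsto_pow_four {u : ℕ → ℝ} {l : ℝ}
    (h1 : Tendsto (fun k : ℕ => u ((k + 1) ^ 4) / ((k + 1 : ℕ) ^ 4 : ℕ)) atTop (𝓝 l))
    (h2 : Tendsto (fun k : ℕ => (∑ i ∈ Finset.Ico ((k + 1) ^ 4) ((k + 2) ^ 4), |u (i + 1) - u i|) /
      ((k + 1 : ℕ) ^ 4 : ℕ)) atTop (𝓝 0)) :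
    Tendsto (fun n : ℕ => u n / n) atTop (𝓝 l) := by
  have h3 : Tendsto (fun k : ℕ => |l| * (15 / ((k + 1 : ℕ) : ℝ))) atTop (𝓝 0) := by
    have := (tendsto_const_div_atTop_nhds_zero_nat (15 : ℝ)).comp (tendsto_add_atTop_nat 1)
    simpa using this.const_mul |l|
  rw [Metric.tendsto_atTop] at h1 h2 h3 ⊢
  intro ε hε
  obtain ⟨k1, hk1⟩ := h1 (ε / 3) (by positivity)
  obtain ⟨k2, hk2⟩ := h2 (ε / 3) (by positivity)
  obtain ⟨k3, hk3⟩ := h3 (ε / 3) (by positivity)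
  set K := max k1 (max k2 k3)
  refine ⟨(K + 1) ^ 4, fun n hn => ?_⟩
  have hex : ∃ k, n < (k + 2) ^ 4 := ⟨n, lt_of_lt_of_le (by omega : n < n + 2)
    (Nat.le_self_pow (by norm_num) _)⟩
  classical
  set k := Nat.find hex with hk
  have hlt : n < (k + 2) ^ 4 := Nat.find_spec hex
  have hKk : K ≤ k := by
    by_contra! h
    have : (k + 2) ^ 4 ≤ (K + 1) ^ 4 := Nat.pow_le_pow_left (by omega) 4
    omega
  have hle : (k + 1) ^ 4 ≤ n := by
    rcases Nat.eq_zero_or_pos k with h | h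
    · rw [h]
      refine le_trans ?_ hn
      exact Nat.pow_le_pow_left (by omega) 4
    · have := Nat.find_min hex (m := k - 1) (by omega)
      rw [show k - 1 + 2 = k + 1 by omega] at this
      omega
  have e1 := hk1 k (le_trans (le_max_left _ _) hKk)
  have e2 := hk2 k (le_trans ((le_max_left _ _).trans (le_max_right _ _)) hKk)
  have e3 := hk3 k (le_trans ((le_max_right _ _).trans (le_max_right _ _)) hKk)
  set N : ℝ := (((k + 1) ^ 4 : ℕ) : ℝ) with hN
  have hN0 : 0 < N := Nat.cast_pos.2 (pow_pos k.succ_pos 4)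
  have hNn : N ≤ n := by rw [hN]; exact_mod_cast hle
  have hn0 : 0 < (n : ℝ) := hN0.trans_le hNn
  set S := ∑ i ∈ Finset.Ico ((k + 1) ^ 4) ((k + 2) ^ 4), |u (i + 1) - u i|
  have hS : |u n - u ((k + 1) ^ 4)| ≤ S := by
    rw [← Finset.sum_Ico_sub u hle]
    refine (Finset.abs_sum_le_sum_abs _ _).trans ?_
    exact Finset.sum_le_sum_of_subset_of_nonneg (Finset.Ico_subset_Ico_right hlt.le)
      fun _ _ _ => abs_nonneg _
  have hgap : (n : ℝ) - N ≤ 15 / ((k + 1 : ℕ) : ℝ) * N := by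
    have h1 : (n : ℝ) ≤ ((k : ℝ) + 2) ^ 4 := by exact_mod_cast hlt.le
    rw [hN]; push_cast
    have h2 : 15 / ((k : ℝ) + 1) * (k + 1) ^ 4 = 15 * (k + 1) ^ 3 := by field_simp
    rw [h2]
    have hk0 : (0 : ℝ) ≤ k := Nat.cast_nonneg k
    have : 15 * ((k : ℝ) + 1) ^ 3 - ((k + 2) ^ 4 - (k + 1) ^ 4) = k * (11 * k ^ 2 + 27 * k + 17) := by
      ring
    have : 0 ≤ (k : ℝ) * (11 * k ^ 2 + 27 * k + 17) := by positivity
    linarith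
  rw [Real.dist_eq] at e1 e2 e3 ⊢
  rw [sub_zero] at e2 e3
  replace e2 := (le_abs_self _).trans_lt e2
  replace e3 := (le_abs_self _).trans_lt e3
  rw [div_lt_iff₀ hN0] at e2
  have e1' : |u ((k + 1) ^ 4) - l * N| < ε / 3 * N := by
    have : u ((k + 1) ^ 4) - l * N = (u ((k + 1) ^ 4) / N - l) * N := by field_simp
    rw [this, abs_mul, abs_of_pos hN0]
    exact mul_lt_mul_of_pos_right e1 hN0
  have e3' : |l * N - l * n| < ε / 3 * N := by
    rw [← mul_sub, abs_mul, abs_sub_comm, abs_of_nonneg (sub_nonneg.2 hNn)]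
    calc |l| * (n - N) ≤ |l| * (15 / ((k + 1 : ℕ) : ℝ) * N) :=
          mul_le_mul_of_nonneg_left hgap (abs_nonneg _)
      _ = |l| * (15 / ((k + 1 : ℕ) : ℝ)) * N := by ring
      _ < ε / 3 * N := mul_lt_mul_of_pos_right e3 hN0
  have : u n / n - l = (u n - l * n) / n := by field_simp
  rw [this, abs_div, abs_of_pos hn0, div_lt_iff₀ hn0]
  have t : |u n - l * n| ≤ |u n - u ((k + 1) ^ 4)| + |u ((k + 1) ^ 4) - l * N| + |l * N - l * n| := by
    refine le_trans (le_of_eq ?_)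
      (abs_add_three (u n - u ((k + 1) ^ 4)) (u ((k + 1) ^ 4) - l * N) (l * N - l * n))
    congr 1; ring
  have : ε * N ≤ ε * n := mul_le_mul_of_nonneg_left hNn hε.le
  linarith

/-- Fekete's lemma for the subadditive sequence a + c; the lower half of the hypothesis keeps the
quotients bounded below. -/
theorem exists_tendsto_div_of_quasiAdditive {a : ℕ → ℝ} {c : ℝ}
    (ha : ∀ n m, |a (n + m) - a n - a m| ≤ c) :
    ∃ l, Tendsto (fun n : ℕ => a n / n) atTop (𝓝 l) := by
  have hc : 0 ≤ c := (abs_nonneg _).trans (ha 0 0)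
  have hsub : Subadditive fun n => a n + c := by
    intro n m
    have := (abs_le.1 (ha n m)).2
    linarith
  have hlow : ∀ n : ℕ, -(|a 1| + c) * n - c ≤ a n + c := by
    intro n
    induction n with
    | zero =>
      have := (abs_le.1 (ha 0 0)).2
      simp only [add_zero] at this
      push_cast; linarith
    | succ n ih =>
      have := (abs_le.1 (ha n 1)).1
      push_cast
      linarith [neg_abs_le (a 1)]
  have hbdd : BddBelow (range fun n : ℕ => (a n + c) / n) := by
    refine ⟨-(|a 1| + c) - c, ?_⟩
    rintro _ ⟨n, rfl⟩
    rcases Nat.eq_zero_or_pos n with rfl | hn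
    · simp; linarith [abs_nonneg (a 1)]
    · have hn1 : (1 : ℝ) ≤ n := by exact_mod_cast hn
      rw [le_div_iff₀ (by positivity)]
      nlinarith [hlow n]
  refine ⟨hsub.lim, ?_⟩
  have h := (hsub.tendsto_lim hbdd).sub (tendsto_const_div_atTop_nhds_zero_nat c)
  rw [sub_zero] at h
  refine h.congr fun n => ?_
  rw [← sub_div, add_sub_cancel_right]

theorem ae_tendsto_zero_of_lintegral_sq_le {Ω : Type*} [MeasurableSpace Ω] {P : Measure Ω}
    {Y : ℕ → Ω → ℝ} (hY : ∀ k, Measurable (Y k)) {C : ℝ}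
    (h : ∀ k, ∫⁻ x, ENNReal.ofReal (Y k x ^ 2) ∂P ≤ ENNReal.ofReal (C / ((k + 1 : ℕ) : ℝ) ^ 2)) :
    ∀ᵐ x ∂P, Tendsto (fun k => Y k x) atTop (𝓝 0) := by
  have hm : ∀ k, Measurable fun x => ENNReal.ofReal (Y k x ^ 2) := fun k =>
    ((hY k).pow_const 2).ennreal_ofReal
  have hs : Summable fun k : ℕ => C / ((k + 1 : ℕ) : ℝ) ^ 2 := by
    have h1 : Summable fun n : ℕ => 1 / (n : ℝ) ^ 2 := Real.summable_one_div_nat_pow.2 one_lt_two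
    have h2 := ((summable_nat_add_iff 1).2 h1).mul_left C
    simpa only [mul_one_div] using h2
  have hlt : ∫⁻ x, ∑' k, ENNReal.ofReal (Y k x ^ 2) ∂P ≠ ⊤ := by
    rw [lintegral_tsum fun k => (hm k).aemeasurable]
    exact ne_top_of_le_ne_top hs.tsum_ofReal_ne_top (ENNReal.tsum_le_tsum h)
  filter_upwards [ae_lt_top (Measurable.tsum hm) hlt] with x hx
  have h1 := ENNReal.tendsto_atTop_zero_of_tsum_ne_top hx.ne
  have h2 := (ENNReal.tendsto_toReal ENNReal.zero_ne_top).comp h1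
  have h3 : Tendsto (fun k => Y k x ^ 2) atTop (𝓝 0) := by
    refine h2.congr fun k => ?_
    simp [ENNReal.toReal_ofReal (sq_nonneg (Y k x))]
  have h4 := h3.sqrt
  simp only [Real.sqrt_sq_eq_abs, Real.sqrt_zero] at h4
  exact tendsto_zero_iff_abs_tendsto_zero _ |>.2 h4

end Numeric

/-! ### Convergence of quasi-additive functions along the walk -/

section QuasiAdditive

variable {Γ : Type*} [Group Γ] [Countable Γ] [MeasurableSpace Γ] [DiscreteMeasurableSpace Γ]

theorem integrable_sq_of_lintegral_le {Ω : Type*} [MeasurableSpace Ω] {P : Measure Ω} {f : Ω → ℝ}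
    (hf : Measurable f) {K : ℝ≥0∞} (hK : K ≠ ⊤) (h : ∫⁻ x, ENNReal.ofReal (f x ^ 2) ∂P ≤ K) :
    Integrable (fun x => f x ^ 2) P ∧ ∫ x, f x ^ 2 ∂P ≤ K.toReal := by
  have hi : Integrable (fun x => f x ^ 2) P := by
    refine ⟨(hf.pow_const 2).aestronglyMeasurable, ?_⟩
    rw [hasFiniteIntegral_iff_ofReal (ae_of_all _ fun x => sq_nonneg _)]
    exact h.trans_lt hK.lt_top
  refine ⟨hi, ?_⟩
  rw [integral_eq_lintegral_of_nonneg_ae (ae_of_all _ fun x => sq_nonneg _) hi.1]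
  exact ENNReal.toReal_mono hK h

/-- `A` has uniformly square integrable defects of additivity along the random walk. -/
structure IsQuasiAdditive (μ : PMF Γ) (A : Γ → ℝ) (K : ℝ≥0∞) : Prop where
  ne_top : K ≠ ⊤
  defect : ∀ n g, ∫⁻ h, ENNReal.ofReal ((A (g * h) - A g - A h) ^ 2) ∂(convPow μ n).toMeasure ≤ K
  sq : ∫⁻ g, ENNReal.ofReal (A g ^ 2) ∂μ.toMeasure ≤ K

variable {μ : PMF Γ} {A : Γ → ℝ} {K : ℝ≥0∞}

theorem IsQuasiAdditive.defect_prod (hA : IsQuasiAdditive μ A K) (n m : ℕ) :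
    ∫⁻ p, ENNReal.ofReal ((A (p.1 * p.2) - A p.1 - A p.2) ^ 2)
      ∂((convPow μ n).toMeasure.prod (convPow μ m).toMeasure) ≤ K := by
  rw [lintegral_prod _ (Measurable.of_discrete).aemeasurable]
  refine (lintegral_mono fun g => hA.defect m g).trans ?_
  simp

theorem IsQuasiAdditive.memLp_defect (hA : IsQuasiAdditive μ A K) (n m : ℕ) :
    MemLp (fun p : Γ × Γ => A (p.1 * p.2) - A p.1 - A p.2) 2
      ((convPow μ n).toMeasure.prod (convPow μ m).toMeasure) :=
  (memLp_two_iff_integrable_sq (Measurable.of_discrete).aestronglyMeasurable).2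
    (integrable_sq_of_lintegral_le .of_discrete hA.ne_top (hA.defect_prod n m)).1

theorem IsQuasiAdditive.memLp (hA : IsQuasiAdditive μ A K) (n : ℕ) :
    MemLp A 2 (convPow μ n).toMeasure := by
  induction n with
  | zero =>
    rw [convPow, PMF.toMeasure_pure]
    refine (memLp_two_iff_integrable_sq (Measurable.of_discrete).aestronglyMeasurable).2 ?_
    exact integrable_dirac (by simp)
  | succ n ih =>
    have h1 : MemLp A 2 (convPow μ 1).toMeasure := by
      rw [convPow_one]
      exact (memLp_two_iff_integrable_sq (Measurable.of_discrete).aestronglyMeasurable).2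
        (integrable_sq_of_lintegral_le .of_discrete hA.ne_top hA.sq).1
    have h2 := ((ih.comp_fst (convPow μ 1).toMeasure).add
      (h1.comp_snd (convPow μ n).toMeasure)).add (hA.memLp_defect n 1)
    have hp := measurePreserving_mul_convPow μ n 1
    rw [← hp.map_eq, memLp_map_measure_iff (Measurable.of_discrete).aestronglyMeasurable
      hp.measurable.aemeasurable]
    refine h2.congr_norm (Measurable.of_discrete).aestronglyMeasurable (ae_of_all _ fun p => ?_)
    simp

theorem IsQuasiAdditive.integrable (hA : IsQuasiAdditive μ A K) (n : ℕ) :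
    Integrable A (convPow μ n).toMeasure := (hA.memLp n).integrable one_le_two

theorem IsQuasiAdditive.abs_integral_le (hA : IsQuasiAdditive μ A K) (n m : ℕ) :
    |∫ g, A g ∂(convPow μ (n + m)).toMeasure - ∫ g, A g ∂(convPow μ n).toMeasure -
      ∫ g, A g ∂(convPow μ m).toMeasure| ≤ 1 + K.toReal := by
  have hp := measurePreserving_mul_convPow μ n m
  set P := (convPow μ n).toMeasure.prod (convPow μ m).toMeasure with hP
  have e1 : ∫ g, A g ∂(convPow μ (n + m)).toMeasure = ∫ p, A (p.1 * p.2) ∂P := by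
    rw [← hp.map_eq, integral_map hp.measurable.aemeasurable
      (Measurable.of_discrete).aestronglyMeasurable]
  have e2 : ∫ g, A g ∂(convPow μ n).toMeasure = ∫ p, A p.1 ∂P := by
    rw [hP, integral_fun_fst]; simp
  have e3 : ∫ g, A g ∂(convPow μ m).toMeasure = ∫ p, A p.2 ∂P := by
    rw [hP, integral_fun_snd]; simp
  have i1 : Integrable (fun p : Γ × Γ => A (p.1 * p.2)) P :=
    hp.integrable_comp_of_integrable (hA.integrable (n + m))
  have i2 : Integrable (fun p : Γ × Γ => A p.1) P := (hA.integrable n).comp_fst _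
  have i3 : Integrable (fun p : Γ × Γ => A p.2) P := (hA.integrable m).comp_snd _
  obtain ⟨j1, j2⟩ := integrable_sq_of_lintegral_le .of_discrete hA.ne_top (hA.defect_prod n m)
  have i12 : Integrable (fun p : Γ × Γ => A (p.1 * p.2) - A p.1) P := i1.sub i2
  rw [e1, e2, e3, ← integral_sub i1 i2, ← integral_sub i12 i3]
  calc |∫ p, A (p.1 * p.2) - A p.1 - A p.2 ∂P|
      ≤ ∫ p, |A (p.1 * p.2) - A p.1 - A p.2| ∂P := abs_integral_le_integral_abs
    _ ≤ ∫ p, (1 + (A (p.1 * p.2) - A p.1 - A p.2) ^ 2) ∂P := by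
        refine integral_mono (i12.sub i3).abs ((integrable_const 1).add j1) fun p => ?_
        simp only
        nlinarith [sq_abs (A (p.1 * p.2) - A p.1 - A p.2),
          sq_nonneg (|A (p.1 * p.2) - A p.1 - A p.2| - 1)]
    _ ≤ 1 + K.toReal := by
        rw [integral_add (integrable_const 1) j1]
        simpa using j2

-- Independence makes the variances of A(g) and A(h) add up, and the defect D enters through (x +
-- D)² ≤ (5/4) x² + 5 D².
open ProbabilityTheory in
theorem IsQuasiAdditive.variance_le (hA : IsQuasiAdditive μ A K) (n m : ℕ) :
    Var[A; (convPow μ (n + m)).toMeasure] ≤ 5 / 4 * (Var[A; (convPow μ n).toMeasure] +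
      Var[A; (convPow μ m).toMeasure]) + 5 * K.toReal := by
  have hp := measurePreserving_mul_convPow μ n m
  set P := (convPow μ n).toMeasure.prod (convPow μ m).toMeasure with hP
  have m2 : MemLp (fun p : Γ × Γ => A p.1) 2 P := (hA.memLp n).comp_fst _
  have m3 : MemLp (fun p : Γ × Γ => A p.2) 2 P := (hA.memLp m).comp_snd _
  set c := ∫ p, ((fun p : Γ × Γ => A p.1) + fun p : Γ × Γ => A p.2) p ∂P with hc
  have meas : ∀ f : Γ × Γ → ℝ, AEStronglyMeasurable f P := fun f =>
    (Measurable.of_discrete).aestronglyMeasurable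
  have v2 : Var[fun p : Γ × Γ => A p.1; P] = Var[A; (convPow μ n).toMeasure] := by
    rw [variance_eq_integral (meas _).aemeasurable,
      variance_eq_integral (Measurable.of_discrete).aemeasurable, hP, integral_fun_fst A,
      integral_fun_fst fun g => (A g - _) ^ 2]
    simp
  have v3 : Var[fun p : Γ × Γ => A p.2; P] = Var[A; (convPow μ m).toMeasure] := by
    rw [variance_eq_integral (meas _).aemeasurable,
      variance_eq_integral (Measurable.of_discrete).aemeasurable, hP, integral_fun_snd A,
      integral_fun_snd fun g => (A g - _) ^ 2]
    simp
  have hadd := IndepFun.variance_add m2 m3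
    (indepFun_prod (Measurable.of_discrete (f := A)) (Measurable.of_discrete (f := A)))
  rw [v2, v3, variance_eq_integral (meas _).aemeasurable, ← hc] at hadd
  obtain ⟨j1, j2⟩ := integrable_sq_of_lintegral_le .of_discrete hA.ne_top (hA.defect_prod n m)
  have j3 : Integrable (fun p => (((fun p : Γ × Γ => A p.1) + fun p : Γ × Γ => A p.2) p - c) ^ 2) P :=
    ((m2.add m3).sub (memLp_const c)).integrable_sq
  rw [← hp.map_eq, variance_map (Measurable.of_discrete).aemeasurable hp.measurable.aemeasurable,
    ← variance_sub_const (meas _) c, ← hadd]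
  refine (variance_le_expectation_sq (meas _)).trans ?_
  calc ∫ p, ((fun p => (A ∘ fun p : Γ × Γ => p.1 * p.2) p - c) ^ 2) p ∂P
      ≤ ∫ p, (5 / 4 * (((fun p : Γ × Γ => A p.1) + fun p : Γ × Γ => A p.2) p - c) ^ 2 +
          5 * (A (p.1 * p.2) - A p.1 - A p.2) ^ 2) ∂P := by
        refine integral_mono_of_nonneg (ae_of_all _ fun p => sq_nonneg _)
          ((j3.const_mul _).add (j1.const_mul _)) (ae_of_all _ fun p => ?_)
        simp only [Pi.pow_apply, Function.comp_apply, Pi.add_apply]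
        nlinarith [sq_nonneg ((A p.1 + A p.2 - c) - 4 * (A (p.1 * p.2) - A p.1 - A p.2))]
    _ ≤ _ := by
        rw [integral_add (j3.const_mul _) (j1.const_mul _), integral_const_mul, integral_const_mul]
        linarith

theorem IsQuasiAdditive.lintegral_increment_le (hA : IsQuasiAdditive μ A K) (n : ℕ) :
    ∫⁻ x, ENNReal.ofReal ((A (walk x (n + 1)) - A (walk x n)) ^ 2) ∂pathMeasure μ ≤ 4 * K := by
  have hp := (measurePreserving_walk_prodMk μ n).2
  have h1 := hp.lintegral_comp
    (f := fun p : Γ × Γ => ENNReal.ofReal ((A (p.1 * p.2) - A p.1) ^ 2)) .of_discrete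
  change ∫⁻ x, ENNReal.ofReal ((A (walk x n * x n) - A (walk x n)) ^ 2) ∂pathMeasure μ ≤ 4 * K
  rw [h1]
  have hd := hA.defect_prod n 1
  rw [convPow_one] at hd
  have hs : ∫⁻ p, ENNReal.ofReal (A p.2 ^ 2) ∂((convPow μ n).toMeasure.prod μ.toMeasure) ≤ K := by
    rw [lintegral_prod _ (Measurable.of_discrete).aemeasurable]
    refine (lintegral_mono fun g => hA.sq).trans ?_
    simp
  calc _ ≤ ∫⁻ p, (2 * ENNReal.ofReal ((A (p.1 * p.2) - A p.1 - A p.2) ^ 2) +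
        2 * ENNReal.ofReal (A p.2 ^ 2)) ∂((convPow μ n).toMeasure.prod μ.toMeasure) := by
        refine lintegral_mono fun p => ?_
        have h2 : (2 : ℝ≥0∞) = ENNReal.ofReal 2 := by simp
        rw [h2, ← ENNReal.ofReal_mul (by norm_num), ← ENNReal.ofReal_mul (by norm_num),
          ← ENNReal.ofReal_add (by positivity) (by positivity)]
        refine ENNReal.ofReal_le_ofReal ?_
        nlinarith [sq_nonneg (A (p.1 * p.2) - A p.1 - A p.2 - A p.2)]
    _ ≤ 2 * K + 2 * K := by
        rw [lintegral_add_left .of_discrete, lintegral_const_mul _ .of_discrete,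
          lintegral_const_mul _ .of_discrete]
        gcongr
    _ = 4 * K := by ring

theorem IsQuasiAdditive.lintegral_variation_le (hA : IsQuasiAdditive μ A K) (a b : ℕ) :
    ∫⁻ x, ENNReal.ofReal ((∑ i ∈ Finset.Ico a b, |A (walk x (i + 1)) - A (walk x i)|) ^ 2)
      ∂pathMeasure μ ≤ ENNReal.ofReal (((b - a : ℕ) : ℝ) ^ 2) * (4 * K) := by
  have hm : ∀ i, Measurable fun x : ℕ → Γ =>
      ENNReal.ofReal ((A (walk x (i + 1)) - A (walk x i)) ^ 2) := fun i =>
    ((((Measurable.of_discrete (f := A)).comp (measurable_walk (i + 1))).sub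
      ((Measurable.of_discrete (f := A)).comp (measurable_walk i))).pow_const 2).ennreal_ofReal
  calc _ ≤ ∫⁻ x, ENNReal.ofReal ((b - a : ℕ) : ℝ) *
        ∑ i ∈ Finset.Ico a b, ENNReal.ofReal ((A (walk x (i + 1)) - A (walk x i)) ^ 2)
          ∂pathMeasure μ := by
        refine lintegral_mono fun x => ?_
        rw [← ENNReal.ofReal_sum_of_nonneg fun _ _ => sq_nonneg _,
          ← ENNReal.ofReal_mul (Nat.cast_nonneg _)]
        refine ENNReal.ofReal_le_ofReal (sq_sum_le_card_mul_sum_sq.trans_eq ?_)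
        simp [sq_abs]
    _ ≤ ENNReal.ofReal ((b - a : ℕ) : ℝ) * ∑ i ∈ Finset.Ico a b, 4 * K := by
        rw [lintegral_const_mul _ (Finset.measurable_fun_sum _ fun i _ => hm i),
          lintegral_finsetSum _ fun i _ => hm i]
        gcongr with i
        exact hA.lintegral_increment_le i
    _ = _ := by
        rw [Finset.sum_const, Nat.card_Ico, nsmul_eq_mul, ← mul_assoc, pow_two,
          ENNReal.ofReal_mul (Nat.cast_nonneg _), ENNReal.ofReal_natCast]

/-- The ergodic theorem for quasi-additive functions. -/
theorem IsQuasiAdditive.exists_tendsto (hA : IsQuasiAdditive μ A K) :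
    ∃ l : ℝ, (∀ᵐ x ∂pathMeasure μ, Tendsto (fun n : ℕ => A (walk x n) / n) atTop (𝓝 l)) ∧
      Tendsto (fun n : ℕ => (∫ g, A g ∂(convPow μ n).toMeasure) / n) atTop (𝓝 l) := by
  obtain ⟨l, hl⟩ := exists_tendsto_div_of_quasiAdditive
    (a := fun n => ∫ g, A g ∂(convPow μ n).toMeasure) hA.abs_integral_le
  refine ⟨l, ?_, hl⟩
  set a : ℕ → ℝ := fun n => ∫ g, A g ∂(convPow μ n).toMeasure with ha
  obtain ⟨C, hC, hCV⟩ := exists_forall_le_pow_six (c := 5 * K.toReal) (by positivity)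
    (fun n => ProbabilityTheory.variance_nonneg A (convPow μ n).toMeasure) hA.variance_le
  have hmA : ∀ n, Measurable fun x : ℕ → Γ => A (walk x n) := fun n =>
    (Measurable.of_discrete (f := A)).comp (measurable_walk n)
  -- Variance O((k+1)⁶) against the normalisation N² = (k+1)⁸ leaves the summable (k+1)⁻².
  have hsub : ∀ᵐ x ∂pathMeasure μ, Tendsto (fun k : ℕ =>
      (A (walk x ((k + 1) ^ 4)) - a ((k + 1) ^ 4)) / ((k + 1 : ℕ) ^ 4 : ℕ)) atTop (𝓝 0) := by
    refine ae_tendsto_zero_of_lintegral_sq_le (C := C)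
      (fun k => ((hmA _).sub_const _).div_const _) fun k => ?_
    set N := (k + 1) ^ 4 with hN
    have hN0 : (0 : ℝ) < N := by rw [hN]; positivity
    have h1 := (measurePreserving_walk_prodMk μ N).1.lintegral_comp
      (f := fun g => ENNReal.ofReal (((A g - a N) / N) ^ 2)) .of_discrete
    rw [h1, ← ofReal_integral_eq_lintegral_ofReal
      (((hA.memLp N).sub (memLp_const (a N))).integrable_sq.div_const ((N : ℝ) ^ 2) |>.congr
        (ae_of_all _ fun g => by simp [div_pow])) (ae_of_all _ fun g => sq_nonneg _)]
    refine ENNReal.ofReal_le_ofReal ?_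
    simp only [div_pow]
    rw [integral_div, ha, ← ProbabilityTheory.variance_eq_integral
      (Measurable.of_discrete).aemeasurable]
    have h2 := hCV (k + 1) (by omega)
    rw [← hN] at h2
    rw [div_le_div_iff₀ (by positivity) (by positivity)]
    have h3 : (N : ℝ) = ((k + 1 : ℕ) : ℝ) ^ 4 := by rw [hN]; push_cast; rfl
    rw [h3]
    calc _ ≤ C * ((k + 1 : ℕ) : ℝ) ^ 6 * ((k + 1 : ℕ) : ℝ) ^ 2 :=
          mul_le_mul_of_nonneg_right h2 (by positivity)
      _ = _ := by ring
  -- At most 15 (k+1)³ increments, each bounded in L², separate consecutive fourth powers. Divided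
  -- by (k+1)⁴ their total variation is O(1/(k+1)) in L², which is square summable.
  have hosc : ∀ᵐ x ∂pathMeasure μ, Tendsto (fun k : ℕ =>
      (∑ i ∈ Finset.Ico ((k + 1) ^ 4) ((k + 2) ^ 4), |A (walk x (i + 1)) - A (walk x i)|) /
        ((k + 1 : ℕ) ^ 4 : ℕ)) atTop (𝓝 0) := by
    refine ae_tendsto_zero_of_lintegral_sq_le (C := 225 * (4 * K.toReal)) (fun k =>
      (Finset.measurable_fun_sum _ fun i _ => ((hmA (i + 1)).sub (hmA i)).abs).div_const _)
      fun k => ?_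
    set N := (k + 1) ^ 4 with hN
    have hN0 : (0 : ℝ) < N := by rw [hN]; positivity
    have hgap : (((k + 2) ^ 4 - N : ℕ) : ℝ) ≤ 15 * ((k + 1 : ℕ) : ℝ) ^ 3 := by
      have : (k + 2) ^ 4 - N ≤ 15 * (k + 1) ^ 3 := by
        rw [hN, tsub_le_iff_right]
        nlinarith [sq_nonneg k, Nat.zero_le (k * k ^ 2)]
      exact_mod_cast this
    have h1 : ∀ x : ℕ → Γ, ENNReal.ofReal (((∑ i ∈ Finset.Ico N ((k + 2) ^ 4),
        |A (walk x (i + 1)) - A (walk x i)|) / N) ^ 2) = ENNReal.ofReal (1 / (N : ℝ) ^ 2) *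
        ENNReal.ofReal ((∑ i ∈ Finset.Ico N ((k + 2) ^ 4),
          |A (walk x (i + 1)) - A (walk x i)|) ^ 2) := by
      intro x
      rw [← ENNReal.ofReal_mul (by positivity), div_pow]
      congr 1; ring
    simp only [h1]
    rw [lintegral_const_mul' _ _ ENNReal.ofReal_ne_top]
    refine (mul_le_mul_right (hA.lintegral_variation_le _ _) _).trans ?_
    rw [← ENNReal.ofReal_toReal hA.ne_top, show (4 : ℝ≥0∞) = ENNReal.ofReal 4 by simp,
      ← ENNReal.ofReal_mul (by norm_num), ← ENNReal.ofReal_mul (by positivity),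
      ← ENNReal.ofReal_mul (by positivity), ENNReal.toReal_ofReal ENNReal.toReal_nonneg]
    refine ENNReal.ofReal_le_ofReal ?_
    have hk0 : (0 : ℝ) < ((k + 1 : ℕ) : ℝ) := by positivity
    have h3 : (N : ℝ) = ((k + 1 : ℕ) : ℝ) ^ 4 := by rw [hN]; push_cast; rfl
    have h4 := pow_le_pow_left₀ (Nat.cast_nonneg _) hgap 2
    rw [h3]
    calc _ ≤ 1 / (((k + 1 : ℕ) : ℝ) ^ 4) ^ 2 *
          ((15 * ((k + 1 : ℕ) : ℝ) ^ 3) ^ 2 * (4 * K.toReal)) := by gcongr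
      _ = _ := by field_simp; ring
  filter_upwards [hsub, hosc] with x h1 h2
  refine tendsto_div_of_tendsto_pow_four ?_ h2
  have h3 : Tendsto (fun k : ℕ => a ((k + 1) ^ 4) / ((k + 1 : ℕ) ^ 4 : ℕ)) atTop (𝓝 l) :=
    hl.comp ((tendsto_pow_atTop (by norm_num)).comp (tendsto_add_atTop_nat 1))
  have h4 := h1.add h3
  rw [zero_add] at h4
  refine h4.congr fun k => ?_
  rw [← add_div, sub_add_cancel]

end QuasiAdditive

/-! ### Discreteness and summability above the pressure -/

section Pressure

variable {X : Type*} [MetricSpace X] {Γ : Type*} [Group Γ] [MulAction Γ X] {F : UnitTangent X → ℝ}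

variable (Γ) in
/-- The annulus of group elements with displacement between `n - 1` and `n`. -/
def annulus (o : X) (n : ℕ) : Set Γ := {g | (n : ℝ) - 1 ≤ dist o (g • o) ∧ dist o (g • o) ≤ n}

variable (Γ) in
/-- The sum of `exp (d_F(o, g o))` over an annulus. -/
noncomputable def annulusSum (F : UnitTangent X → ℝ) (o : X) (n : ℕ) : ℝ≥0∞ :=
  ∑' g : annulus Γ o n, ENNReal.ofReal (Real.exp (fakeDist F o ((g : Γ) • o)))

theorem mem_annulus_ceil (o : X) (g : Γ) : g ∈ annulus Γ o ⌈dist o (g • o)⌉₊ :=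
  ⟨by linarith [Nat.ceil_lt_add_one (dist_nonneg (x := o) (y := g • o))], Nat.le_ceil _⟩

theorem eventually_annulusSum_le {o : X} {s : ℝ} (hs : pressure Γ F o < s) :
    ∀ᶠ n : ℕ in atTop, annulusSum Γ F o n ≤ ENNReal.ofReal (Real.exp (s * n)) := by
  have h := eventually_lt_of_limsup_lt hs
  filter_upwards [h, eventually_gt_atTop 0] with n hn hn0
  rw [EReal.div_lt_iff (by exact_mod_cast hn0) (EReal.natCast_ne_top n)] at hn
  rw [← ENNReal.log_le_log_iff, ENNReal.log_ofReal_of_pos (Real.exp_pos _), Real.log_exp]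
  refine hn.le.trans_eq ?_
  push_cast
  rfl

/-- The limsup says nothing about small annuli, so the ball is first moved out: right multiplication
by a high power h of a loxodromic element takes it into finitely many annuli n ≥ N, whose sums are
finite. As d_F(o, gh o) is bounded below for g in the ball, each of these annuli receives finitely
many elements. -/
theorem finite_setOf_dist_le [IsIsometricSMul Γ X] {o : X} (hv : pressure Γ F o < ⊤) {a : Γ}
    (ha : IsLoxodromic Γ X a) {B : ℝ}
    (hA : ∀ g : Γ, |fakeDist F o (g • o)| ≤ B * Real.exp (1 * dist o (g • o)))
    (hd : ∀ g h : Γ, |fakeDist F o ((g * h) • o) - fakeDist F o (g • o) - fakeDist F o (h • o)| ≤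
      B * Real.exp (1 * gromovProd o (g⁻¹ • o) (h • o))) (R : ℝ) :
    {g : Γ | dist o (g • o) ≤ R}.Finite := by
  obtain ⟨s, hs, -⟩ := EReal.lt_iff_exists_real_btwn.1 hv
  obtain ⟨N, hN⟩ := eventually_atTop.1 (eventually_annulusSum_le hs)
  obtain ⟨c, hc, hac⟩ := ha
  obtain ⟨k, hk⟩ := exists_nat_ge ((R + N) / c)
  rw [div_le_iff₀' hc] at hk
  have hB : 0 ≤ B := by
    have := (abs_nonneg _).trans (hA 1)
    exact nonneg_of_mul_nonneg_left this (Real.exp_pos _)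
  set h := a ^ k with hh
  have hfib : ∀ n ∈ Iic ⌈R + dist o (h • o)⌉₊,
      {g : Γ | dist o (g • o) ≤ R ∧ ⌈dist o ((g * h) • o)⌉₊ = n}.Finite := by
    intro n _
    by_cases hnN : n < N
    · convert Set.finite_empty
      refine eq_empty_of_forall_notMem fun g hg => ?_
      have h1 : dist (g • o) ((g * h) • o) = dist o (h • o) := by rw [mul_smul, dist_smul]
      have h2 := hac o k
      have h3 := dist_triangle (g • o) o ((g * h) • o)
      rw [dist_comm (g • o) o] at h3
      have h4 : (N : ℝ) ≤ dist o ((g * h) • o) := by linarith [hg.1]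
      have h5 : N ≤ n := by
        rw [← hg.2]
        exact_mod_cast h4.trans (Nat.le_ceil _)
      omega
    push Not at hnN
    have hW : ∑' g, (annulus Γ o n).indicator
        (fun g : Γ => ENNReal.ofReal (Real.exp (fakeDist F o (g • o)))) g ≠ ⊤ := by
      rw [← tsum_subtype]
      exact ((hN n hnN).trans_lt ENNReal.ofReal_lt_top).ne
    have hfin := ENNReal.finite_const_le_of_tsum_ne_top hW
      (ε := ENNReal.ofReal (Real.exp (fakeDist F o (h • o) - 2 * (B * Real.exp R))))
      (by simpa using Real.exp_pos _)
    refine (hfin.preimage (f := fun g => g * h) (mul_left_injective h).injOn).subset ?_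
    rintro g ⟨hgR, hgn⟩
    have hmem := mem_annulus_ceil o (g * h)
    rw [hgn] at hmem
    simp only [mem_preimage, mem_ofPred_eq, indicator_of_mem hmem]
    refine ENNReal.ofReal_le_ofReal (Real.exp_le_exp.2 ?_)
    have h1 : dist o (g⁻¹ • o) ≤ R := by
      rw [← dist_smul g, smul_inv_smul, dist_comm]
      exact hgR
    have h2 := (hA g).trans (mul_le_mul_of_nonneg_left
      (Real.exp_le_exp.2 ((one_mul _).trans_le hgR)) hB)
    have h3 := (hd g h).trans (mul_le_mul_of_nonneg_left
      (Real.exp_le_exp.2 ((one_mul _).trans_le ((gromovProd_le_left _ _ _).trans h1))) hB)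
    linarith [abs_le.1 h2, abs_le.1 h3]
  refine ((finite_Iic _).biUnion hfib).subset fun g hg => ?_
  simp only [mem_iUnion, mem_Iic]
  refine ⟨_, Nat.ceil_mono ?_, hg, rfl⟩
  have h1 : dist (g • o) ((g * h) • o) = dist o (h • o) := by rw [mul_smul, dist_smul]
  have hg' : dist o (g • o) ≤ R := hg
  linarith [dist_triangle o (g • o) ((g * h) • o)]

/-- With s' strictly between the pressure and s, the annuli beyond N contribute a geometric series
of ratio exp(s' - s); replacing d(o, go) by n in an annulus of width 1 costs at most |s| in the
exponent. The earlier annuli are covered by a finite ball. -/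
theorem tsum_exp_ne_top {o : X} (hfin : ∀ R : ℝ, {g : Γ | dist o (g • o) ≤ R}.Finite) {s : ℝ}
    (hs : pressure Γ F o < s) :
    ∑' g : Γ, ENNReal.ofReal (Real.exp (fakeDist F o (g • o) - s * dist o (g • o))) ≠ ⊤ := by
  obtain ⟨s', hs', hss⟩ := EReal.lt_iff_exists_real_btwn.1 hs
  rw [EReal.coe_lt_coe_iff] at hss
  obtain ⟨N, hN⟩ := eventually_atTop.1 (eventually_annulusSum_le hs')
  set f : Γ → ℝ≥0∞ := fun g =>
    ENNReal.ofReal (Real.exp (fakeDist F o (g • o) - s * dist o (g • o))) with hf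
  have hle : ∀ g, f g ≤ {g : Γ | dist o (g • o) ≤ N}.indicator f g +
      ∑' n : ℕ, (annulus Γ o (n + N)).indicator f g := by
    intro g
    by_cases hg : dist o (g • o) ≤ N
    · rw [indicator_of_mem (by exact hg)]
      exact le_self_add
    · have h1 : N ≤ ⌈dist o (g • o)⌉₊ := by
        exact_mod_cast (not_le.1 hg).le.trans (Nat.le_ceil _)
      refine le_add_left (le_trans ?_ (ENNReal.le_tsum (⌈dist o (g • o)⌉₊ - N)))
      rw [Nat.sub_add_cancel h1, indicator_of_mem (mem_annulus_ceil o g)]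
  have hann : ∀ n : ℕ, ∑' g, (annulus Γ o (n + N)).indicator f g ≤
      ENNReal.ofReal (Real.exp (|s| + (s' - s) * N)) *
        ENNReal.ofReal (Real.exp (s' - s)) ^ n := by
    intro n
    have h1 : ∀ g, (annulus Γ o (n + N)).indicator f g ≤
        ENNReal.ofReal (Real.exp (|s| - s * (n + N : ℕ))) * (annulus Γ o (n + N)).indicator
          (fun g : Γ => ENNReal.ofReal (Real.exp (fakeDist F o (g • o)))) g := by
      intro g
      by_cases hg : g ∈ annulus Γ o (n + N)
      · rw [indicator_of_mem hg, indicator_of_mem hg, ← ENNReal.ofReal_mul (Real.exp_pos _).le,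
          ← Real.exp_add]
        refine ENNReal.ofReal_le_ofReal (Real.exp_le_exp.2 ?_)
        have h2 : s * ((n + N : ℕ) - dist o (g • o)) ≤ |s| * 1 := by
          refine (le_abs_self _).trans ?_
          rw [abs_mul, abs_of_nonneg (by linarith [hg.2] :
            (0 : ℝ) ≤ ((n + N : ℕ) : ℝ) - dist o (g • o))]
          exact mul_le_mul_of_nonneg_left (by linarith [hg.1]) (abs_nonneg _)
        linarith
      · rw [indicator_of_notMem hg, indicator_of_notMem hg, mul_zero]
    refine (ENNReal.tsum_le_tsum h1).trans ?_
    rw [ENNReal.tsum_mul_left, ← tsum_subtype]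
    refine (mul_le_mul_right (hN (n + N) (by omega)) _).trans_eq ?_
    rw [← ENNReal.ofReal_mul (Real.exp_pos _).le, ← Real.exp_add,
      ← ENNReal.ofReal_pow (Real.exp_pos _).le, ← Real.exp_nat_mul,
      ← ENNReal.ofReal_mul (Real.exp_pos _).le, ← Real.exp_add]
    congr 2
    push_cast
    ring
  refine ne_top_of_le_ne_top ?_ (ENNReal.tsum_le_tsum hle)
  rw [ENNReal.tsum_add, ENNReal.tsum_comm]
  refine ENNReal.add_ne_top.2 ⟨?_, ne_top_of_le_ne_top ?_ (ENNReal.tsum_le_tsum hann)⟩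
  · rw [← tsum_subtype]
    have := (hfin N).fintype
    rw [tsum_fintype]
    exact ENNReal.sum_ne_top.2 fun g _ => ENNReal.ofReal_ne_top
  · rw [ENNReal.tsum_mul_left, ENNReal.tsum_geometric]
    refine ENNReal.mul_ne_top ENNReal.ofReal_ne_top (ENNReal.inv_ne_top.2 ?_)
    rw [Ne, tsub_eq_zero_iff_le, not_le, ENNReal.ofReal_lt_one, Real.exp_lt_one_iff]
    linarith

end Pressure

/-! ### Entropy -/

section Entropy

/-- This is 1 + x ≤ exp x at x = -u - log p. Summed, it has ∑ exp(-u) in place of its logarithm plus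
1, a loss that vanishes after division by n. -/
theorem negMulLog_le_mul_add_exp {p u : ℝ} (hp : 0 ≤ p) :
    Real.negMulLog p ≤ p * u + Real.exp (-u) := by
  rcases hp.eq_or_lt with rfl | hp
  · simpa using (Real.exp_pos _).le
  have h := Real.add_one_le_exp (-u - Real.log p)
  rw [Real.exp_sub, Real.exp_log hp, le_div_iff₀ hp] at h
  rw [Real.negMulLog]
  linarith

theorem negMulLog_toReal_nonneg {Γ : Type*} (p : PMF Γ) (g : Γ) :
    0 ≤ Real.negMulLog (p g).toReal :=
  Real.negMulLog_nonneg ENNReal.toReal_nonneg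
    (ENNReal.toReal_le_of_le_ofReal zero_le_one (by simpa using p.coe_le_one g))

variable {Γ : Type*} [Countable Γ] [MeasurableSpace Γ] [DiscreteMeasurableSpace Γ]

theorem summable_of_integrable_toMeasure {p : PMF Γ} {u : Γ → ℝ} (hu : Integrable u p.toMeasure) :
    Summable fun g => (p g).toReal * u g := by
  have h := hu.2
  rw [HasFiniteIntegral, lintegral_toMeasure] at h
  refine (ENNReal.summable_toReal h.ne).of_norm_bounded fun g => ?_
  rw [ENNReal.toReal_mul, toReal_enorm, norm_mul, Real.norm_of_nonneg ENNReal.toReal_nonneg]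

theorem summable_negMulLog {p : PMF Γ} {u : Γ → ℝ} (hu : Integrable u p.toMeasure)
    (hZ : ∑' g, ENNReal.ofReal (Real.exp (-u g)) ≠ ⊤) :
    Summable fun g => Real.negMulLog (p g).toReal := by
  have hs : Summable fun g => Real.exp (-u g) := by
    simpa [ENNReal.toReal_ofReal (Real.exp_pos _).le] using ENNReal.summable_toReal hZ
  exact ((summable_of_integrable_toMeasure hu).add hs).of_nonneg_of_le
    (negMulLog_toReal_nonneg p) fun g => negMulLog_le_mul_add_exp ENNReal.toReal_nonneg

/-- The Gibbs inequality. -/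
theorem tsum_negMulLog_le {p : PMF Γ} {u : Γ → ℝ} (hu : Integrable u p.toMeasure)
    (hZ : ∑' g, ENNReal.ofReal (Real.exp (-u g)) ≠ ⊤) :
    ∑' g, Real.negMulLog (p g).toReal ≤
      ∫ g, u g ∂p.toMeasure + ∑' g, Real.exp (-u g) := by
  have hs : Summable fun g => Real.exp (-u g) := by
    simpa [ENNReal.toReal_ofReal (Real.exp_pos _).le] using ENNReal.summable_toReal hZ
  have hp := summable_of_integrable_toMeasure hu
  rw [PMF.integral_eq_tsum p u hu]
  simp only [smul_eq_mul]
  rw [← hp.tsum_add hs]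
  exact (summable_negMulLog hu hZ).tsum_le_tsum
    (fun g => negMulLog_le_mul_add_exp ENNReal.toReal_nonneg) (hp.add hs)

end Entropy

/-! ### Subadditivity and existence of the entropy -/

section Subadditive

variable {Γ : Type*}

/-- The entropy of a probability measure, as an extended nonnegative real number. -/
noncomputable def entropy (p : PMF Γ) : ℝ≥0∞ :=
  ∑' g, p g * ENNReal.ofReal (-Real.log (p g).toReal)

theorem entropy_eq_ofReal {p : PMF Γ} (h : Summable fun g => Real.negMulLog (p g).toReal) :
    entropy p = ENNReal.ofReal (∑' g, Real.negMulLog (p g).toReal) := by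
  rw [ENNReal.ofReal_tsum_of_nonneg (negMulLog_toReal_nonneg p) h, entropy]
  refine tsum_congr fun g => ?_
  rw [Real.negMulLog, neg_mul_comm, ENNReal.ofReal_mul ENNReal.toReal_nonneg,
    ENNReal.ofReal_toReal (p.apply_ne_top g)]

variable [Group Γ]

theorem convPow_mul_le (μ : PMF Γ) (n m : ℕ) (g h : Γ) :
    convPow μ n g * convPow μ m h ≤ convPow μ (n + m) (g * h) := by
  classical
  have key := tsum_convPow_add μ n m fun k => if k = g * h then 1 else 0
  rw [tsum_eq_single (g * h) (fun k hk => by simp [hk])] at key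
  rw [if_pos rfl, mul_one] at key
  rw [key]
  refine le_trans ?_ (ENNReal.le_tsum g)
  refine mul_le_mul_right (le_trans ?_ (ENNReal.le_tsum h)) _
  simp

/-- Apply -log to μⁿ(g) μᵐ(h) ≤ μⁿ⁺ᵐ(gh) and average over g and h. Values in [0, ∞] let the sums be
rearranged freely. -/
theorem entropy_convPow_add_le (μ : PMF Γ) (n m : ℕ) :
    entropy (convPow μ (n + m)) ≤ entropy (convPow μ n) + entropy (convPow μ m) := by
  have hle : ∀ g h, convPow μ n g * (convPow μ m h *
      ENNReal.ofReal (-Real.log (convPow μ (n + m) (g * h)).toReal)) ≤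
      convPow μ n g * (convPow μ m h * (ENNReal.ofReal (-Real.log (convPow μ n g).toReal) +
        ENNReal.ofReal (-Real.log (convPow μ m h).toReal))) := by
    intro g h
    by_cases hg : convPow μ n g = 0
    · simp [hg]
    by_cases hh : convPow μ m h = 0
    · simp [hh]
    refine mul_le_mul_right (mul_le_mul_right (le_trans ?_ ENNReal.ofReal_add_le) _) _
    refine ENNReal.ofReal_le_ofReal ?_
    have h1 := ENNReal.toReal_pos hg ((convPow μ n).apply_ne_top g)
    have h2 := ENNReal.toReal_pos hh ((convPow μ m).apply_ne_top h)
    have h3 := ENNReal.toReal_mono ((convPow μ (n + m)).apply_ne_top _) (convPow_mul_le μ n m g h)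
    rw [ENNReal.toReal_mul] at h3
    have h4 := Real.log_le_log (mul_pos h1 h2) h3
    rw [Real.log_mul h1.ne' h2.ne'] at h4
    linarith
  rw [entropy, tsum_convPow_add μ n m fun k =>
    ENNReal.ofReal (-Real.log (convPow μ (n + m) k).toReal)]
  simp only [← ENNReal.tsum_mul_left]
  refine (ENNReal.tsum_le_tsum fun g => ENNReal.tsum_le_tsum (hle g)).trans_eq ?_
  simp only [mul_add, ENNReal.tsum_mul_left, ENNReal.tsum_add, ENNReal.tsum_mul_right,
    PMF.tsum_coe, one_mul]
  rfl

theorem exists_isEntropy {μ : PMF Γ}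
    (h : ∀ n, Summable fun g : Γ => Real.negMulLog (convPow μ n g).toReal) :
    ∃ l, IsEntropy μ l := by
  have hn : ∀ n, 0 ≤ ∑' g : Γ, Real.negMulLog (convPow μ n g).toReal := fun n =>
    tsum_nonneg (negMulLog_toReal_nonneg _)
  have hsub : Subadditive fun n => ∑' g : Γ, Real.negMulLog (convPow μ n g).toReal := by
    intro n m
    have := entropy_convPow_add_le μ n m
    rwa [entropy_eq_ofReal (h n), entropy_eq_ofReal (h m), entropy_eq_ofReal (h (n + m)),
      ← ENNReal.ofReal_add (hn n) (hn m),
      ENNReal.ofReal_le_ofReal_iff (add_nonneg (hn n) (hn m))] at this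
  refine ⟨hsub.lim, h, hsub.tendsto_lim ⟨0, ?_⟩⟩
  rintro _ ⟨n, rfl⟩
  exact div_nonneg (hn n) n.cast_nonneg

end Subadditive

/-! ### The drift and the fundamental inequality -/

section Drift

variable {X : Type*} [MetricSpace X] {Γ : Type*} [Group Γ] [Countable Γ] [MeasurableSpace Γ]
  [DiscreteMeasurableSpace Γ] [MulAction Γ X] {μ : PMF Γ}

/-- Squaring turns the rate κ/4 into κ/2, the rate at which the Gromov products have uniform
moments. -/
theorem exists_isQuasiAdditive_of_abs_le {o : X} {κ B : ℝ}
    (hM : ∑' g, μ g * expDist κ o (g • o) ≠ ⊤) {E : ℝ≥0∞} (hE : E ≠ ⊤)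
    (hgp : ∀ n y, iterSum μ n
      (fun g => ENNReal.ofReal (Real.exp (κ / 2 * gromovProd o y (g • o)))) ≤ E)
    (hκ : 0 < κ) {A : Γ → ℝ} (hA : ∀ g, |A g| ≤ B * Real.exp (κ / 4 * dist o (g • o)))
    (hd : ∀ g h, |A (g * h) - A g - A h| ≤
      B * Real.exp (κ / 4 * gromovProd o (g⁻¹ • o) (h • o))) :
    ∃ K, IsQuasiAdditive μ A K := by
  have hsq : ∀ a t : ℝ, |a| ≤ B * Real.exp (κ / 4 * t) →
      ENNReal.ofReal (a ^ 2) ≤ ENNReal.ofReal (B ^ 2) * ENNReal.ofReal (Real.exp (κ / 2 * t)) := by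
    intro a t h
    rw [← ENNReal.ofReal_mul (sq_nonneg B)]
    refine ENNReal.ofReal_le_ofReal ?_
    have h1 := pow_le_pow_left₀ (abs_nonneg a) h 2
    rwa [sq_abs, mul_pow, ← Real.exp_nat_mul,
      show ((2 : ℕ) : ℝ) * (κ / 4 * t) = κ / 2 * t by push_cast; ring] at h1
  refine ⟨ENNReal.ofReal (B ^ 2) * (E + ∑' g, μ g * expDist κ o (g • o)), ?_, ?_, ?_⟩
  · exact ENNReal.mul_ne_top ENNReal.ofReal_ne_top (ENNReal.add_ne_top.2 ⟨hE, hM⟩)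
  · intro n g
    refine (lintegral_mono fun h => hsq _ _ (hd g h)).trans ?_
    rw [lintegral_const_mul' _ _ ENNReal.ofReal_ne_top, lintegral_toMeasure, tsum_convPow]
    exact mul_le_mul_right ((hgp n _).trans le_self_add) _
  · refine (lintegral_mono fun g => hsq _ _ (hA g)).trans ?_
    rw [lintegral_const_mul' _ _ ENNReal.ofReal_ne_top, lintegral_toMeasure]
    refine mul_le_mul_right (le_add_left (ENNReal.tsum_le_tsum fun g => mul_le_mul_right ?_ _)) _
    exact expDist_mono (by linarith) o (g • o)

theorem fundamental_inequality {F : UnitTangent X → ℝ} {o : X} {h l lF s : ℝ}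
    (hs : ∑' g : Γ, ENNReal.ofReal
      (Real.exp (fakeDist F o (g • o) - s * dist o (g • o))) ≠ ⊤)
    (hd : ∀ n, Integrable (fun g : Γ => dist o (g • o)) (convPow μ n).toMeasure)
    (hF : ∀ n, Integrable (fun g : Γ => fakeDist F o (g • o)) (convPow μ n).toMeasure)
    (hl : Tendsto (fun n : ℕ => (∫ g, dist o (g • o) ∂(convPow μ n).toMeasure) / n) atTop (𝓝 l))
    (hlF : Tendsto (fun n : ℕ => (∫ g, fakeDist F o (g • o) ∂(convPow μ n).toMeasure) / n)
      atTop (𝓝 lF)) :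
    (∀ n, Summable fun g : Γ => Real.negMulLog (convPow μ n g).toReal) ∧
      (IsEntropy μ h → h ≤ s * l - lF) := by
  set u : Γ → ℝ := fun g => s * dist o (g • o) - fakeDist F o (g • o) with hu
  have hZ : ∑' g, ENNReal.ofReal (Real.exp (-u g)) ≠ ⊤ := by simpa only [hu, neg_sub] using hs
  have hui : ∀ n, Integrable u (convPow μ n).toMeasure := fun n =>
    ((hd n).const_mul s).sub (hF n)
  refine ⟨fun n => summable_negMulLog (hui n) hZ, fun hent => ?_⟩
  have h1 := ((hl.const_mul s).sub hlF).add
    (tendsto_const_div_atTop_nhds_zero_nat (∑' g, Real.exp (-u g)))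
  rw [add_zero] at h1
  refine le_of_tendsto_of_tendsto' hent.2 h1 fun n => ?_
  have h2 := tsum_negMulLog_le (hui n) hZ
  rw [integral_sub ((hd n).const_mul s) (hF n), integral_const_mul] at h2
  rw [← mul_div_assoc, ← sub_div, ← add_div]
  exact div_le_div_of_nonneg_right h2 n.cast_nonneg

variable [IsIsometricSMul Γ X]

theorem exists_isQuasiAdditive_dist {o : X} {κ : ℝ}
    (hM : ∑' g, μ g * expDist κ o (g • o) ≠ ⊤) {E : ℝ≥0∞} (hE : E ≠ ⊤)
    (hgp : ∀ n y, iterSum μ n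
      (fun g => ENNReal.ofReal (Real.exp (κ / 2 * gromovProd o y (g • o)))) ≤ E)
    (hκ : 0 < κ) : ∃ K, IsQuasiAdditive μ (fun g : Γ => dist o (g • o)) K := by
  have hle : ∀ t : ℝ, 0 ≤ t → 2 * t ≤ 8 / κ * Real.exp (κ / 4 * t) := by
    intro t ht
    rw [div_mul_eq_mul_div, le_div_iff₀ hκ]
    linarith [Real.add_one_le_exp (κ / 4 * t)]
  refine exists_isQuasiAdditive_of_abs_le (B := 8 / κ) hM hE hgp hκ (fun g => ?_) fun g h => ?_
  · rw [abs_of_nonneg dist_nonneg]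
    linarith [hle _ (dist_nonneg (x := o) (y := g • o)), dist_nonneg (x := o) (y := g • o)]
  -- The defect of the distance is exactly -2 (g⁻¹o | ho)_o.
  · refine le_trans (le_of_eq ?_) (hle _ (gromovProd_nonneg _ _ _))
    have h1 : dist o (g⁻¹ • o) = dist o (g • o) := by
      rw [← dist_smul g, smul_inv_smul, dist_comm]
    have h2 : dist (g⁻¹ • o) (h • o) = dist o ((g * h) • o) := by
      rw [← dist_smul g, smul_inv_smul, mul_smul]
    have h3 := gromovProd_nonneg o (g⁻¹ • o) (h • o)
    rw [gromovProd, h1, h2] at h3 ⊢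
    rw [abs_of_nonpos (by linarith)]
    ring

/-- By Jensen, exp(-κ E d(o, ω_n o)) ≤ E exp(-κ d(o, ω_n o)), which decays geometrically. -/
theorem drift_pos {o : X} {κ l : ℝ} (hκ : 0 < κ) {r C : ℝ≥0∞} (hr : r < 1) (hC : C ≠ ⊤)
    (hcontr : ∀ n z, iterSum μ n (fun g => expDist (-κ) o (g⁻¹ • z)) ≤
      C * r ^ n * expDist (-κ) o z)
    (hint : ∀ n, Integrable (fun g : Γ => dist o (g • o)) (convPow μ n).toMeasure)
    (hl : Tendsto (fun n : ℕ => (∫ g, dist o (g • o) ∂(convPow μ n).toMeasure) / n) atTop (𝓝 l)) :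
    0 < l := by
  -- The maximum, like C + 1 below, keeps the quantities positive so that logarithms can be taken.
  set r' := max r.toReal (1 / 2) with hr'
  have hr1 : r' < 1 := max_lt (by simpa using (ENNReal.toReal_lt_toReal hr.ne_top (by simp)).2 hr)
    (by norm_num)
  have hr0 : 0 < r' := lt_max_of_lt_right (by norm_num)
  have hC0 : 0 < C.toReal + 1 := by positivity
  have hexp : ∀ n, Real.exp (-κ * ∫ g, dist o (g • o) ∂(convPow μ n).toMeasure) ≤
      (C.toReal + 1) * r' ^ n := by
    intro n
    have hbd : Integrable (fun g : Γ => Real.exp (-κ * dist o (g • o)))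
        (convPow μ n).toMeasure := by
      refine Integrable.of_bound (C := 1) (Measurable.of_discrete).aestronglyMeasurable
        (ae_of_all _ fun g => ?_)
      rw [Real.norm_of_nonneg (Real.exp_pos _).le, Real.exp_le_one_iff]
      nlinarith [dist_nonneg (x := o) (y := g • o)]
    have hJ := convexOn_exp.map_integral_le Real.continuous_exp.continuousOn isClosed_univ
      (ae_of_all _ fun g => mem_univ _) ((hint n).const_mul (-κ)) hbd
    rw [integral_const_mul] at hJ
    refine hJ.trans ?_
    rw [integral_eq_lintegral_of_nonneg_ae (ae_of_all _ fun g => (Real.exp_pos _).le) hbd.1,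
      lintegral_toMeasure, tsum_convPow]
    have h1 := hcontr n o
    rw [expDist_self, mul_one] at h1
    have h2 : iterSum μ n (fun g : Γ => ENNReal.ofReal (Real.exp (-κ * dist o (g • o)))) ≤
        C * r ^ n := by
      refine (iterSum_mono (fun g => le_of_eq ?_) n).trans h1
      rw [expDist, ← dist_smul g o (g⁻¹ • o), smul_inv_smul, dist_comm]
    refine (ENNReal.toReal_mono
      (ENNReal.mul_ne_top hC (ENNReal.pow_ne_top hr.ne_top)) h2).trans ?_
    rw [ENNReal.toReal_mul, ENNReal.toReal_pow]
    have : r.toReal ≤ r' := le_max_left _ _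
    gcongr
    linarith
  have hlim : -κ * l ≤ Real.log r' := by
    have h1 := (hl.const_mul (-κ))
    have h2 : Tendsto (fun n : ℕ => Real.log (C.toReal + 1) / n + Real.log r') atTop
        (𝓝 (0 + Real.log r')) := (tendsto_const_div_atTop_nhds_zero_nat _).add_const _
    rw [zero_add] at h2
    refine le_of_tendsto_of_tendsto h1 h2 ?_
    filter_upwards [eventually_gt_atTop 0] with n hn
    have hn' : (0 : ℝ) < n := by exact_mod_cast hn
    have h3 := Real.log_le_log (Real.exp_pos _) (hexp n)
    rw [Real.log_exp, Real.log_mul hC0.ne' (pow_pos hr0 n).ne', Real.log_pow] at h3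
    rw [← mul_div_assoc, div_add' _ _ _ hn'.ne', div_le_div_iff_of_pos_right hn']
    linarith
  have := Real.log_neg hr0 hr1
  nlinarith

end Drift

end GibbsWalk

theorem mainTheorem6 {X : Type*} [MetricSpace X] [ProperSpace X]
    (hX : GibbsWalk.IsCATNegOne X) (hXc : GibbsWalk.IsGeodesicallyComplete X)
    {Γ : Type*} [Group Γ] [Countable Γ] [MeasurableSpace Γ] [DiscreteMeasurableSpace Γ]
    [MulAction Γ X] [IsIsometricSMul Γ X] (hΓ : GibbsWalk.IsNonelementary Γ X)
    (F : GibbsWalk.UnitTangent X → ℝ) (hF : GibbsWalk.IsPotential Γ F)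
    (hHC : GibbsWalk.HolderControl F)
    (o : X) (hv : GibbsWalk.pressure Γ F o < ⊤)
    (μ : PMF Γ) (hgen : GibbsWalk.IsGenerating μ) (hμ : GibbsWalk.HasExponentialMoment μ o) :
    ∃ h l v lF : ℝ, GibbsWalk.IsEntropy μ h ∧ GibbsWalk.IsDrift μ o l ∧
      GibbsWalk.pressure Γ F o = v ∧ GibbsWalk.IsFakeDrift μ F o lF ∧
      h ≤ l * v - lF := by
  open GibbsWalk in
  obtain ⟨κ, hκ, hM, r, hr, C, hC, hcontr⟩ := exists_contraction hX hΓ o hgen hμ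
  obtain ⟨J, hJ, hJle⟩ := exists_iterSum_gromovProd_le hX o hκ hM hr hC hcontr
  obtain ⟨E, hE, hgp⟩ := exists_expMoment_gromovProd hX o hκ hJ hJle
  obtain ⟨K, hd⟩ := exists_isQuasiAdditive_dist hM hE hgp hκ
  obtain ⟨B, -, hB, hBd⟩ :=
    exists_quasiAdditive_fakeDist hX hXc hF hHC o (by positivity : 0 < κ / 4)
  obtain ⟨K', hdF⟩ := exists_isQuasiAdditive_of_abs_le hM hE hgp hκ hB hBd
  obtain ⟨l, hl, hlint⟩ := hd.exists_tendsto
  obtain ⟨lF, hlF, hlFint⟩ := hdF.exists_tendsto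
  have hpos : 0 < l := drift_pos hκ hr hC hcontr hd.integrable hlint
  obtain ⟨B₁, -, hB₁, hB₁d⟩ := exists_quasiAdditive_fakeDist hX hXc hF hHC o one_pos
  obtain ⟨a, -, ha, -⟩ := hΓ
  have hfin := finite_setOf_dist_le hv ha hB₁ hB₁d
  have hfund : ∀ (h s : ℝ), pressure Γ F o < s →
      (∀ n, Summable fun g : Γ => Real.negMulLog (convPow μ n g).toReal) ∧
        (IsEntropy μ h → h ≤ s * l - lF) := fun h s hs =>
    fundamental_inequality (tsum_exp_ne_top hfin hs) hd.integrable hdF.integrable hlint hlFint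
  obtain ⟨s₀, hs₀, -⟩ := EReal.lt_iff_exists_real_btwn.1 hv
  obtain ⟨h, hh⟩ := exists_isEntropy (hfund 0 s₀ hs₀).1
  -- If the pressure were -∞, every real s would be admissible; since ℓ > 0, the chosen s turns the
  -- inequality into h ≤ h - 1.
  have hbot : pressure Γ F o ≠ ⊥ := by
    intro hbot
    have h1 := (hfund h ((h + lF - 1) / l) (by rw [hbot]; exact EReal.bot_lt_coe _)).2 hh
    rw [div_mul_cancel₀ _ hpos.ne'] at h1
    linarith
  obtain ⟨v, hv'⟩ : ∃ v : ℝ, pressure Γ F o = v :=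
    ⟨_, (EReal.coe_toReal hv.ne hbot).symm⟩
  refine ⟨h, l, v, lF, hh, hl, hv', hlF, ?_⟩
  -- Division by ℓ > 0 lets s decrease to v by density of the order.
  have h1 : (h + lF) / l ≤ v := by
    refine le_of_forall_gt_imp_ge_of_dense fun s hs => ?_
    have := (hfund h s (by rw [hv']; exact_mod_cast hs)).2 hh
    rw [div_le_iff₀ hpos]
    linarith
  rw [div_le_iff₀ hpos] at h1
  linarith
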